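/- Let $n\in\{1,2\}$, $\gamma>1$, $0\le\mu\le 3-n$, and let $A,\overline\rho,R>0$. For $\varepsilon>0$ consider the compressible isentropic Euler system with scale-invariant damping $$\rho_t+\nabla\cdot(\rho u)=0,\qquad (\rho u)_t+\nabla\cdot(\rho u\otimes u)+\nabla p(\rho)+\frac{\mu\,\rho u}{1+t}=0,\qquad p(\rho)=A\rho^\gamma,$$ for $(t,x)\in(0,T)\times\mathbb R^n$, with unknown density $\rho:[0,T)\times\mathbb R^n\to\mathbb R$ and velocity $u:[0,T)\times\mathbb R^n\to\mathbb R^n$, and with initial data $\rho(0,x)=\overline\rho+\varepsilon\rho_0(x)$, $u(0,x)=\varepsilon u_0(x)$. Assume that $\rho_0\in C_0^\infty(\mathbb R^n)$ and $u_0\in C_0^\infty(\mathbb R^n;\mathbb R^n)$ are supported in $\{|x|\le R\}$ and satisfy $$\int_{\mathbb R^n}\rho_0\,\phi\,dx>0,\qquad \int_{\mathbb R^n}u_0\cdot\nabla\phi\,dx>0,$$ where $\phi(x)=\frac{e^x+e^{-x}}2$ if $n=1$ and $\phi(x)=\frac1{2\pi}\int_{\mathbb S^{1}}e^{x\cdot\sigma}\,d\sigma$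 if $n=2$. Let the lifespan $T_\varepsilon\in[0,\infty]$ be the supremum of all $T$ such that a $C^1$ solution exists on $[0,T)\times\mathbb R^n$. Then there are constants $\varepsilon_0>0$ and $C>0$, independent of $\varepsilon$, such that for all $0<\varepsilon\le\varepsilon_0$ the system has no global $C^1$ solution (that is, none on $[0,\infty)\times\mathbb R^n$), and $$T_\varepsilon\le C\varepsilon^{-\frac{2}{3-n-\mu}}\ \text{ if }\mu<3-n,\qquad T_\varepsilon\le\exp\left(C\varepsilon^{-1}\right)\ \text{ if }\mu=3-n.$$ -/

import Mathlib

open MeasureTheory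
open scoped ENNReal ContDiff

noncomputable section

/-- The partial derivative `∂ᵢ f (x)` of a real function on `ℝⁿ`. -/
def partialDeriv {n : ℕ} (i : Fin n) (f : EuclideanSpace ℝ (Fin n) → ℝ)
    (x : EuclideanSpace ℝ (Fin n)) : ℝ :=
  fderiv ℝ f x (EuclideanSpace.single i 1)

/-- The space-time strip `[0, T) × ℝⁿ`; `T = ∞` is allowed. -/
def timeStrip (n : ℕ) (T : ℝ≥0∞) : Set (ℝ × EuclideanSpace ℝ (Fin n)) :=
  {q | 0 ≤ q.1 ∧ ENNReal.ofReal q.1 < T}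

/-- `(ρ, u)` is a `C¹` solution on `[0, T) × ℝⁿ` of the compressible isentropic Euler equations
with time dependent damping `μ / (1 + t) ^ lam` and pressure law `p(ρ) = A ρ ^ γ`, starting from
the perturbation of size `ε` in direction `(ρ₀, u₀)` of the constant state `(ρbar, 0)`.
`C¹` on the strip includes the initial time, with one-sided derivatives in time there.
Neither a sign of the density nor any behaviour at infinity is required. -/
structure IsEulerSolution {n : ℕ} (A γ lam μ ρbar ε : ℝ)
    (ρ₀ : EuclideanSpace ℝ (Fin n) → ℝ)
    (u₀ : EuclideanSpace ℝ (Fin n) → EuclideanSpace ℝ (Fin n))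
    (T : ℝ≥0∞)
    (ρ : ℝ → EuclideanSpace ℝ (Fin n) → ℝ)
    (u : ℝ → EuclideanSpace ℝ (Fin n) → EuclideanSpace ℝ (Fin n)) : Prop where
  /-- the density is `C¹` on `[0, T) × ℝⁿ` -/
  contDiffOn_density :
    ContDiffOn ℝ 1 (fun q : ℝ × EuclideanSpace ℝ (Fin n) => ρ q.1 q.2) (timeStrip n T)
  /-- the velocity is `C¹` on `[0, T) × ℝⁿ` -/
  contDiffOn_velocity :
    ContDiffOn ℝ 1 (fun q : ℝ × EuclideanSpace ℝ (Fin n) => u q.1 q.2) (timeStrip n T)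
  /-- conservation of mass: `ρ_t + ∇ · (ρ u) = 0` on `(0, T) × ℝⁿ` -/
  mass : ∀ t : ℝ, 0 < t → ENNReal.ofReal t < T → ∀ x : EuclideanSpace ℝ (Fin n),
    deriv (fun s => ρ s x) t + ∑ i, partialDeriv i (fun y => ρ t y * u t y i) x = 0
  /-- balance of momentum, componentwise:
  `(ρ u)_t + ∇ · (ρ u ⊗ u) + ∇ p(ρ) + μ ρ u / (1 + t) ^ lam = 0` on `(0, T) × ℝⁿ` -/
  momentum : ∀ t : ℝ, 0 < t → ENNReal.ofReal t < T → ∀ x : EuclideanSpace ℝ (Fin n),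
    ∀ j : Fin n,
      deriv (fun s => ρ s x * u s x j) t
        + ∑ i, partialDeriv i (fun y => ρ t y * u t y i * u t y j) x
        + partialDeriv j (fun y => A * ρ t y ^ γ) x
        + μ * (ρ t x * u t x j) / (1 + t) ^ lam = 0
  /-- `ρ(0, x) = ρbar + ε ρ₀(x)` -/
  initial_density : ∀ x, ρ 0 x = ρbar + ε * ρ₀ x
  /-- `u(0, x) = ε u₀(x)` -/
  initial_velocity : ∀ x, u 0 x = ε • u₀ x

/-- The lifespan: the supremum in `[0, ∞]` of all `T` such that a `C¹` solution exists on
`[0, T) × ℝⁿ`. -/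
def eulerLifespan {n : ℕ} (A γ lam μ ρbar ε : ℝ)
    (ρ₀ : EuclideanSpace ℝ (Fin n) → ℝ)
    (u₀ : EuclideanSpace ℝ (Fin n) → EuclideanSpace ℝ (Fin n)) : ℝ≥0∞ :=
  sSup {T : ℝ≥0∞ | ∃ ρ u, IsEulerSolution A γ lam μ ρbar ε ρ₀ u₀ T ρ u}

/-- The volume `π ^ (n / 2) / Γ (n / 2 + 1)` of the unit ball of `ℝⁿ`. -/
def unitBallVolume (n : ℕ) : ℝ :=
  Real.pi ^ ((n : ℝ) / 2) / Real.Gamma ((n : ℝ) / 2 + 1)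

/-- The function `φ`: the hyperbolic cosine for `n = 1`, and for `n ≥ 2` the mean
`(n ωₙ)⁻¹ ∫_{Sⁿ⁻¹} exp (x · σ) dσ` over the unit sphere with its surface measure. -/
def sphericalExp : (n : ℕ) → EuclideanSpace ℝ (Fin n) → ℝ
  | 1, x => (Real.exp (x 0) + Real.exp (-(x 0))) / 2
  | n, x => 1 / (n * unitBallVolume n) *
      ∫ σ : Metric.sphere (0 : EuclideanSpace ℝ (Fin n)) 1,
        Real.exp (inner ℝ x (σ : EuclideanSpace ℝ (Fin n)))
        ∂((volume : Measure (EuclideanSpace ℝ (Fin n))).toSphere)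

end

/-!
The proof follows two moments of a solution against the function `φ` of the theorem, which is
a positive superposition of plane waves `e^{x · σ}`, `|σ| = 1`, so that `Δ φ = φ` and the Hessian
of `φ` is positive semidefinite. With `c` the speed of sound of the constant state, put
`X = ∫ (ρ - ρbar) φ` and `Y = ∫ ρ u · ∇φ`.

* Finite speed of propagation (`IsEulerSolution.eq_const_of_lt_norm`): the solution equals the
  constant state `(ρbar, 0)` where `|x| > R + c t`, so all the moments are integrals over a ball.
  This rests on the relative energy, whose flux is at most `σ` times the energy density, for any
  `σ > c`, while the state is close enough to the constant one. The energy is integrated over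
  smoothed backward cones of speed `σ`, and the closeness is propagated by a continuity argument.
  The density stays positive by comparison with an exponential (`IsEulerSolution.density_pos`).
* Moment inequality (`IsEulerSolution.moment_inequality`): conservation of mass and balance of
  momentum give `X' = Y` and
  `Y' + μ Y / (1 + t) = ∫ ρ D²φ(u, u) + ∫ (p(ρ) - p(ρbar)) φ`. The first term is nonnegative.
  The pressure is convex, `p'(ρbar) = c²`, and its excess over the tangent line at `ρbar` is
  bounded below in the mean over the ball of radius `R + c t`, where `φ` has mass
  `O((1 + t)^{(n - 1) / 2} e^{c t})`. Hence
  `Y' + μ Y / (1 + t) ≥ c² X + κ X f (X / M)` with `f y = min (y, y ^ θ)`,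
  `θ = min (γ - 1, 1)`, and `M` that mass.
* Blow-up (`exists_bound_of_moment_inequality`): divide `X` by a subsolution `g` of the linear
  equation `g'' + μ g' / (1 + t) = c² g` that grows like `(1 + t)^{-μ / 2} e^{c t}`. Then
  `M` is at most of order `g / p` with `p = (1 + t)^{-(n - 1 + μ) / 2}`, so that the nonlinear term
  contributes `κ p W f W` to the equation of `W = X / g`. This forces the first order inequality
  `W' ≥ δ p / Q(W)`, where `Q` is integrable at infinity and a primitive of it is `O(1 / ε)` at
  the initial value of `W`. Hence the solution cannot exist beyond the time at which the primitive
  of `p` reaches `C / ε`. That primitive is a power of `1 + t` of exponent `(3 - n - μ) / 2` if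
  `μ < 3 - n` and a logarithm if `μ = 3 - n`, which yields the two bounds.
-/

section Blowup

open Set Filter Topology Function

local notation:max "𝔼" m:max => EuclideanSpace ℝ (Fin m)

/-! ### Calculus on a space-time strip -/

/-- A continuous function on `[a, b] × K`, positive at time `a` and not positive throughout, has a
first zero in time. Finite propagation, positivity of the density and the comparison with the
Riccati equation are all obtained by excluding such a first zero. -/
theorem exists_first_zero {X : Type*} [TopologicalSpace X] [T2Space X] {K : Set X}
    (hK : IsCompact K) {a b : ℝ} {d : ℝ → X → ℝ}
    (hd : ContinuousOn (fun q : ℝ × X => d q.1 q.2) (Icc a b ×ˢ K))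
    (h0 : ∀ x ∈ K, 0 < d a x) (hbad : ∃ t ∈ Icc a b, ∃ x ∈ K, d t x ≤ 0) :
    ∃ t ∈ Ioc a b, ∃ x ∈ K, d t x = 0 ∧ (∀ s ∈ Ico a t, ∀ y ∈ K, 0 < d s y) ∧
      ∀ y ∈ K, 0 ≤ d t y := by
  have hcomp : IsCompact (Icc a b ×ˢ K) := isCompact_Icc.prod hK
  have hbadc : IsCompact ((Icc a b ×ˢ K) ∩ (fun q : ℝ × X => d q.1 q.2) ⁻¹' Iic 0) :=
    hcomp.of_isClosed_subset (hd.preimage_isClosed_of_isClosed hcomp.isClosed isClosed_Iic)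
      inter_subset_left
  obtain ⟨t', ht', x', hx', hd'⟩ := hbad
  obtain ⟨⟨t, x⟩, ⟨⟨ht, hx⟩, htx⟩, hmin⟩ :=
    hbadc.exists_isMinOn ⟨(t', x'), ⟨ht', hx'⟩, hd'⟩ continuous_fst.continuousOn
  simp only [mem_preimage, mem_Iic] at ht hx htx
  have hta : a < t := by
    rcases eq_or_lt_of_le ht.1 with h | h
    · exact absurd (h0 x hx) (by rw [h]; exact not_lt.2 htx)
    · exact h
  have hbefore : ∀ s ∈ Ico a t, ∀ y ∈ K, 0 < d s y := by
    intro s hs y hy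
    by_contra hcon
    have := hmin (a := (s, y)) ⟨⟨⟨hs.1, hs.2.le.trans ht.2⟩, hy⟩, not_lt.1 hcon⟩
    exact absurd hs.2 (not_lt.2 this)
  have hnonneg : ∀ y ∈ K, 0 ≤ d t y := by
    intro y hy
    have hcont : ContinuousOn (fun s => d s y) (closure (Ico a t)) := by
      rw [closure_Ico hta.ne]
      refine hd.comp (f := fun s => (s, y)) (by fun_prop) fun s hs => ?_
      exact ⟨⟨hs.1, hs.2.trans ht.2⟩, hy⟩
    refine le_on_closure (f := fun _ => (0 : ℝ)) (fun s hs => (hbefore s hs y hy).le)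
      continuousOn_const hcont ?_
    rw [closure_Ico hta.ne]
    exact ⟨hta.le, le_rfl⟩
  exact ⟨t, ⟨hta, ht.2⟩, x, hx, le_antisymm htx (hnonneg x hx), hbefore, hnonneg⟩

/-- At a first zero in time the time derivative is nonpositive. -/
theorem hasDerivAt_nonpos_of_first_zero {f : ℝ → ℝ} {a t f' : ℝ} (hat : a < t)
    (hf : HasDerivAt f f' t) (ht : f t = 0) (hpos : ∀ s ∈ Ico a t, 0 < f s) : f' ≤ 0 := by
  have h := hf.tendsto_slope.mono_left
    (nhdsWithin_mono t (fun s (hs : s ∈ Iio t) => (ne_of_lt hs : s ≠ t)))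
  refine le_of_tendsto h ?_
  filter_upwards [Ioo_mem_nhdsLT hat] with s hs
  rw [slope_def_field, ht]
  exact (div_neg_of_pos_of_neg (by linarith [hpos s ⟨hs.1.le, hs.2⟩]) (by linarith [hs.2])).le

section Strip

variable {n : ℕ}

theorem contDiffAt_of_strip {V : Type*} [NormedAddCommGroup V] [NormedSpace ℝ V] {T : ℝ}
    {F : ℝ → 𝔼 n → V} (hF : ContDiffOn ℝ 1 (fun q : ℝ × 𝔼 n => F q.1 q.2) (Ico 0 T ×ˢ univ))
    {t : ℝ} (ht : t ∈ Ioo 0 T) (x : 𝔼 n) : ContDiffAt ℝ 1 (fun q : ℝ × 𝔼 n => F q.1 q.2) (t, x) :=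
  hF.contDiffAt (prod_mem_nhds (Ico_mem_nhds ht.1 ht.2) univ_mem)

theorem contDiff_slice {V : Type*} [NormedAddCommGroup V] [NormedSpace ℝ V] {T : ℝ}
    {F : ℝ → 𝔼 n → V} (hF : ContDiffOn ℝ 1 (fun q : ℝ × 𝔼 n => F q.1 q.2) (Ico 0 T ×ˢ univ))
    {t : ℝ} (ht : t ∈ Ico 0 T) : ContDiff ℝ 1 (F t) := by
  rw [← contDiffOn_univ]
  exact hF.comp (g := fun q : ℝ × 𝔼 n => F q.1 q.2) (f := fun x => (t, x)) (by fun_prop)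
    fun x _ => ⟨ht, mem_univ _⟩

theorem hasDerivAt_time {V : Type*} [NormedAddCommGroup V] [NormedSpace ℝ V] {F : ℝ → 𝔼 n → V}
    {t : ℝ} {x : 𝔼 n} (h : ContDiffAt ℝ 1 (fun q : ℝ × 𝔼 n => F q.1 q.2) (t, x)) :
    HasDerivAt (fun s => F s x) (fderiv ℝ (fun q : ℝ × 𝔼 n => F q.1 q.2) (t, x) (1, 0)) t := by
  have h1 := (h.differentiableAt one_ne_zero).hasFDerivAt
  have h2 : HasDerivAt (fun s : ℝ => (s, x)) ((1 : ℝ), (0 : 𝔼 n)) t :=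
    (hasDerivAt_id t).prodMk (hasDerivAt_const t x)
  exact h1.comp_hasDerivAt t h2

/-- Differentiation under the integral of a `C¹` function with uniformly bounded space support. -/
theorem hasDerivAt_integral_of_contDiffOn {a b : ℝ} {F : ℝ → 𝔼 n → ℝ}
    (hF : ContDiffOn ℝ 1 (fun q : ℝ × 𝔼 n => F q.1 q.2) (Ioo a b ×ˢ univ)) {K : Set 𝔼 n}
    (hK : IsCompact K) (hsupp : ∀ t ∈ Ioo a b, ∀ x ∉ K, F t x = 0) {t : ℝ} (ht : t ∈ Ioo a b) :
    Integrable (fun x => deriv (fun s => F s x) t) ∧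
      HasDerivAt (fun s => ∫ x, F s x) (∫ x, deriv (fun s => F s x) t) t := by
  have hopen : IsOpen (Ioo a b ×ˢ (univ : Set 𝔼 n)) := isOpen_Ioo.prod isOpen_univ
  set G : ℝ × 𝔼 n → ℝ := fun q => fderiv ℝ (fun q : ℝ × 𝔼 n => F q.1 q.2) q (1, 0) with hG
  have hGc : ContinuousOn G (Ioo a b ×ˢ univ) :=
    (hF.continuousOn_fderiv_of_isOpen hopen le_rfl).clm_apply continuousOn_const
  have hder : ∀ s ∈ Ioo a b, ∀ x, HasDerivAt (fun s => F s x) (G (s, x)) s := fun s hs x =>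
    hasDerivAt_time (hF.contDiffAt (hopen.mem_nhds ⟨hs, mem_univ _⟩))
  have hslice : ∀ s ∈ Ioo a b, Continuous (F s) := fun s hs =>
    continuousOn_univ.1 <| hF.continuousOn.comp (f := fun x => (s, x)) (by fun_prop)
      fun x _ => ⟨hs, mem_univ _⟩
  have hGslice : Continuous fun x => G (t, x) :=
    continuousOn_univ.1 <| hGc.comp (f := fun x => (t, x)) (by fun_prop)
      fun x _ => ⟨ht, mem_univ _⟩
  have hGzero : ∀ s ∈ Ioo a b, ∀ x ∉ K, G (s, x) = 0 := fun s hs x hx => by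
    refine (hder s hs x).unique ?_
    refine (hasDerivAt_const s (0 : ℝ)).congr_of_eventuallyEq ?_
    filter_upwards [isOpen_Ioo.mem_nhds hs] with r hr using hsupp r hr x hx
  obtain ⟨r, hr, hrs⟩ := Metric.nhds_basis_closedBall.mem_iff.1 (isOpen_Ioo.mem_nhds ht)
  obtain ⟨C, hC⟩ := ((isCompact_closedBall t r).prod hK).exists_bound_of_continuousOn
    (hGc.mono (prod_mono hrs (subset_univ K)))
  have key := hasDerivAt_integral_of_dominated_loc_of_deriv_le (μ := (volume : Measure 𝔼 n))
    (F := F) (F' := fun s x => G (s, x)) (x₀ := t) (bound := K.indicator fun _ => C)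
    (Metric.closedBall_mem_nhds t hr)
    (by filter_upwards [isOpen_Ioo.mem_nhds ht] with s hs
        exact (hslice s hs).aestronglyMeasurable)
    ((hslice t ht).integrable_of_hasCompactSupport (.intro hK (hsupp t ht)))
    hGslice.aestronglyMeasurable
    (Eventually.of_forall fun x s hs => by
      by_cases hx : x ∈ K
      · rw [indicator_of_mem hx]; exact hC (s, x) ⟨hs, hx⟩
      · rw [indicator_of_notMem hx, hGzero s (hrs hs) x hx, norm_zero])
    ((integrable_indicator_iff hK.measurableSet).2
      (integrableOn_const hK.measure_lt_top.ne))
    (Eventually.of_forall fun x s hs => hder s (hrs hs) x)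
  rw [show (fun x => deriv (fun s => F s x) t) = fun x => G (t, x) from
    funext fun x => (hder t ht x).deriv]
  exact key

theorem ContDiff.continuous_partialDeriv {f : 𝔼 n → ℝ} (hf : ContDiff ℝ 1 f) (i : Fin n) :
    Continuous (partialDeriv i f) :=
  (hf.continuous_fderiv one_ne_zero).clm_apply continuous_const

theorem HasCompactSupport.partialDeriv {f : 𝔼 n → ℝ} (hf : HasCompactSupport f) (i : Fin n) :
    HasCompactSupport (partialDeriv i f) :=
  (hf.fderiv ℝ).comp_left (g := fun L : 𝔼 n →L[ℝ] ℝ => L (EuclideanSpace.single i 1)) rfl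

theorem integral_mul_partialDeriv {f g : 𝔼 n → ℝ} (hf : ContDiff ℝ 1 f) (hg : ContDiff ℝ 1 g)
    (hfs : HasCompactSupport f) (i : Fin n) :
    ∫ x, f x * partialDeriv i g x = -∫ x, partialDeriv i f x * g x := by
  refine integral_mul_fderiv_eq_neg_fderiv_mul_of_integrable ?_ ?_ ?_
    (fun x _ => hf.differentiable one_ne_zero x) (fun x _ => hg.differentiable one_ne_zero x)
  · exact ((hf.continuous_partialDeriv i).mul hg.continuous).integrable_of_hasCompactSupport
      ((hfs.partialDeriv i).mul_right)
  · exact (hf.continuous.mul (hg.continuous_partialDeriv i)).integrable_of_hasCompactSupport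
      hfs.mul_right
  · exact (hf.continuous.mul hg.continuous).integrable_of_hasCompactSupport hfs.mul_right

theorem integral_partialDeriv_mul {f g : 𝔼 n → ℝ} (hf : ContDiff ℝ 1 f) (hg : ContDiff ℝ 1 g)
    (hfs : HasCompactSupport f) (i : Fin n) :
    ∫ x, partialDeriv i f x * g x = -∫ x, f x * partialDeriv i g x := by
  rw [integral_mul_partialDeriv hf hg hfs i, neg_neg]

theorem partialDeriv_mul {f g : 𝔼 n → ℝ} {x : 𝔼 n} (hf : DifferentiableAt ℝ f x)
    (hg : DifferentiableAt ℝ g x) (i : Fin n) :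
    partialDeriv i (fun y => f y * g y) x
      = partialDeriv i f x * g x + f x * partialDeriv i g x := by
  simp only [partialDeriv, fderiv_fun_mul hf hg]
  simp; ring

theorem partialDeriv_comp {h : ℝ → ℝ} {h' : ℝ} {f : 𝔼 n → ℝ} {x : 𝔼 n} (hh : HasDerivAt h h' (f x))
    (hf : DifferentiableAt ℝ f x) (i : Fin n) :
    partialDeriv i (fun y => h (f y)) x = h' * partialDeriv i f x := by
  have := (hh.comp_hasFDerivAt x hf.hasFDerivAt).fderiv
  rw [partialDeriv, show (fun y => h (f y)) = h ∘ f from rfl, this]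
  simp [partialDeriv]

end Strip

/-! ### The ordinary differential inequality -/

section Riccati

/-- The exponent `r = √((1 + μ/2)² + c² t²)` in `dampedGrowth`. -/
noncomputable def growthRadius (c μ t : ℝ) : ℝ := √((1 + μ / 2) ^ 2 + c ^ 2 * t ^ 2)

/-- A positive subsolution of `g'' + μ g' / (1 + t) = c² g` with `g'(0) = 0` and with the growth
`e^{ct} (1 + t)^{-μ/2}` of the dominant solution. It integrates an Amos type lower bound for the
logarithmic derivative of a modified Bessel function. -/
noncomputable def dampedGrowth (c μ t : ℝ) : ℝ :=
  Real.exp (growthRadius c μ t) * (μ / 2 + growthRadius c μ t) ^ (-(μ / 2))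

/-- The logarithmic derivative of `dampedGrowth`. -/
noncomputable def dampedRate (c μ t : ℝ) : ℝ := c ^ 2 * t / (μ / 2 + growthRadius c μ t)

variable {c μ : ℝ}

theorem growthRadius_sq (c μ t : ℝ) :
    growthRadius c μ t ^ 2 = (1 + μ / 2) ^ 2 + c ^ 2 * t ^ 2 :=
  Real.sq_sqrt (by positivity)

theorem le_growthRadius (c μ t : ℝ) : 1 + μ / 2 ≤ growthRadius c μ t :=
  Real.le_sqrt_of_sq_le (by nlinarith [mul_nonneg (sq_nonneg c) (sq_nonneg t)])

theorem growthRadius_pos (hμ : 0 ≤ μ) (c t : ℝ) : 0 < growthRadius c μ t := by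
  linarith [le_growthRadius c μ t]

theorem mul_le_growthRadius (c μ t : ℝ) : c * t ≤ growthRadius c μ t :=
  Real.le_sqrt_of_sq_le (by nlinarith [sq_nonneg (1 + μ / 2)])

theorem growthRadius_le (hμ : 0 ≤ μ) (hc : 0 ≤ c) {t : ℝ} (ht : 0 ≤ t) :
    growthRadius c μ t ≤ 1 + μ / 2 + c * t := by
  refine Real.sqrt_le_iff.2 ⟨by positivity, ?_⟩
  nlinarith [mul_nonneg (by positivity : (0 : ℝ) ≤ 1 + μ / 2) (mul_nonneg hc ht)]

theorem hasDerivAt_growthRadius (hμ : 0 ≤ μ) (c t : ℝ) :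
    HasDerivAt (growthRadius c μ) (c ^ 2 * t / growthRadius c μ t) t := by
  have h : HasDerivAt (fun t : ℝ => (1 + μ / 2) ^ 2 + c ^ 2 * t ^ 2) (c ^ 2 * (2 * t)) t := by
    simpa using ((hasDerivAt_pow 2 t).const_mul (c ^ 2)).const_add ((1 + μ / 2) ^ 2)
  have h' := h.sqrt (by positivity)
  refine h'.congr_deriv ?_
  have := growthRadius_pos hμ c t
  rw [growthRadius] at this ⊢
  field_simp

theorem dampedGrowth_pos (hμ : 0 ≤ μ) (c t : ℝ) : 0 < dampedGrowth c μ t := by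
  have := growthRadius_pos hμ c t
  unfold dampedGrowth
  positivity

theorem hasDerivAt_dampedGrowth (hμ : 0 ≤ μ) (c t : ℝ) :
    HasDerivAt (dampedGrowth c μ) (dampedRate c μ t * dampedGrowth c μ t) t := by
  have hr := growthRadius_pos hμ c t
  have hd := hasDerivAt_growthRadius hμ c t
  have hs : 0 < μ / 2 + growthRadius c μ t := by positivity
  have h1 := hd.exp.mul ((hd.const_add (μ / 2)).rpow_const (p := -(μ / 2)) (Or.inl hs.ne'))
  refine h1.congr_deriv ?_
  rw [Real.rpow_sub_one hs.ne', dampedRate, dampedGrowth]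
  field_simp
  ring

theorem hasDerivAt_dampedRate (hμ : 0 ≤ μ) (c t : ℝ) :
    HasDerivAt (dampedRate c μ)
      (c ^ 2 / (μ / 2 + growthRadius c μ t)
        - c ^ 2 * t * (c ^ 2 * t / growthRadius c μ t) / (μ / 2 + growthRadius c μ t) ^ 2) t := by
  have hr := growthRadius_pos hμ c t
  have hs : 0 < μ / 2 + growthRadius c μ t := by positivity
  have h1 := ((hasDerivAt_id t).const_mul (c ^ 2)).div
    ((hasDerivAt_growthRadius hμ c t).const_add (μ / 2)) hs.ne'
  refine h1.congr_deriv ?_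
  simp only [id]
  field_simp

theorem dampedRate_le (hμ : 0 ≤ μ) (hc : 0 ≤ c) (t : ℝ) : dampedRate c μ t ≤ c := by
  have hr := growthRadius_pos hμ c t
  rw [dampedRate, div_le_iff₀ (by positivity)]
  nlinarith [mul_le_mul_of_nonneg_left (mul_le_growthRadius c μ t) hc, mul_nonneg hc hμ]

/-- `dampedGrowth` is a subsolution, in Riccati form. -/
theorem dampedRate_riccati (hμ : 0 ≤ μ) (c : ℝ) {t : ℝ} (ht : 0 ≤ t) :
    (c ^ 2 / (μ / 2 + growthRadius c μ t)
        - c ^ 2 * t * (c ^ 2 * t / growthRadius c μ t) / (μ / 2 + growthRadius c μ t) ^ 2)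
      + dampedRate c μ t ^ 2 + dampedRate c μ t * (μ / (1 + t)) ≤ c ^ 2 := by
  have hr := growthRadius_pos hμ c t
  have hrm := le_growthRadius c μ t
  have hsq := growthRadius_sq c μ t
  set r := growthRadius c μ t with hrdef
  have hs : 0 < μ / 2 + r := by positivity
  have h1 : dampedRate c μ t * (μ / (1 + t)) ≤ c ^ 2 * μ / (μ / 2 + r) := by
    rw [dampedRate, ← hrdef, div_mul_div_comm, div_le_div_iff₀ (by positivity) hs]
    have : 0 ≤ c ^ 2 * μ * (μ / 2 + r) := by positivity
    nlinarith
  have h2 : (c ^ 2 / (μ / 2 + r) - c ^ 2 * t * (c ^ 2 * t / r) / (μ / 2 + r) ^ 2)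
      + dampedRate c μ t ^ 2 + c ^ 2 * μ / (μ / 2 + r)
      = c ^ 2 * ((μ / 2 + r) * r - c ^ 2 * t ^ 2 + c ^ 2 * t ^ 2 * r + μ * (μ / 2 + r) * r)
        / ((μ / 2 + r) ^ 2 * r) := by
    rw [dampedRate, ← hrdef]
    field_simp
  refine (add_le_add_right h1 _).trans ?_
  rw [h2, div_le_iff₀ (by positivity)]
  refine mul_le_mul_of_nonneg_left ?_ (sq_nonneg c)
  have h3 : c ^ 2 * t ^ 2 = r ^ 2 - (1 + μ / 2) ^ 2 := by rw [hsq]; ring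
  rw [h3]
  nlinarith [mul_nonneg (by positivity : (0 : ℝ) ≤ (1 + μ / 2)) (sub_nonneg.2 hrm),
    mul_nonneg (mul_nonneg hμ hμ) (sub_nonneg.2 hrm), mul_nonneg hμ (sub_nonneg.2 hrm)]

theorem exists_le_dampedGrowth (hμ : 0 ≤ μ) (hc : 0 < c) :
    ∃ k, 0 < k ∧ ∀ t, 0 ≤ t →
      k * (Real.exp (c * t) * (1 + t) ^ (-(μ / 2))) ≤ dampedGrowth c μ t := by
  refine ⟨(1 + μ + c) ^ (-(μ / 2)), by positivity, fun t ht => ?_⟩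
  have hr := growthRadius_pos hμ c t
  have h1 : μ / 2 + growthRadius c μ t ≤ (1 + μ + c) * (1 + t) := by
    nlinarith [growthRadius_le hμ hc.le ht, mul_nonneg hμ ht]
  calc (1 + μ + c) ^ (-(μ / 2)) * (Real.exp (c * t) * (1 + t) ^ (-(μ / 2)))
      = Real.exp (c * t) * ((1 + μ + c) * (1 + t)) ^ (-(μ / 2)) := by
        rw [Real.mul_rpow (by positivity) (by positivity)]; ring
    _ ≤ dampedGrowth c μ t := by
        unfold dampedGrowth
        refine mul_le_mul (Real.exp_le_exp.2 (mul_le_growthRadius c μ t))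
          (Real.rpow_le_rpow_of_nonpos (by positivity) h1 (by linarith)) (by positivity)
          (by positivity)

/-- The gain `f y = min (y, y ^ θ)` of the nonlinearity, per unit of the moment, when the mean
deviation of the density is `y`. -/
noncomputable def gain (θ y : ℝ) : ℝ := min y (y ^ θ)

theorem gain_mono {θ : ℝ} (hθ : 0 ≤ θ) {y z : ℝ} (hy : 0 ≤ y) (hyz : y ≤ z) :
    gain θ y ≤ gain θ z :=
  min_le_min hyz (Real.rpow_le_rpow hy hyz hθ)

theorem mul_gain_le {θ : ℝ} (hθ1 : θ ≤ 1) {s y : ℝ} (hs : 0 < s) (hs1 : s ≤ 1)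
    (hy : 0 ≤ y) : s * gain θ y ≤ gain θ (s * y) := by
  rw [gain, gain, Real.mul_rpow hs.le hy]
  refine le_min (mul_le_mul_of_nonneg_left (min_le_left _ _) hs.le) ?_
  have h1 : s ≤ s ^ θ := by simpa using Real.rpow_le_rpow_of_exponent_ge hs hs1 hθ1
  exact mul_le_mul h1 (min_le_right _ _) (le_min hy (by positivity)) (by positivity)

theorem gain_pos {θ y : ℝ} (hy : 0 < y) : 0 < gain θ y := lt_min hy (by positivity)

/-- The weight `w⁻² + w^{-1-η}`; a bound `W' ≥ δ / riccatiWeight W` forces blow-up. -/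
noncomputable def riccatiWeight (η w : ℝ) : ℝ := w ^ (-2 : ℝ) + w ^ (-1 - η)

/-- An antiderivative of `-riccatiWeight`, positive on the positive half-line. -/
noncomputable def riccatiPotential (η w : ℝ) : ℝ := w ^ (-1 : ℝ) + w ^ (-η) / η

theorem riccatiWeight_pos {η w : ℝ} (hw : 0 < w) : 0 < riccatiWeight η w := by
  unfold riccatiWeight; positivity

theorem hasDerivAt_riccatiPotential {η w : ℝ} (hη : 0 < η) (hw : 0 < w) :
    HasDerivAt (riccatiPotential η) (-riccatiWeight η w) w := by
  have h1 := Real.hasDerivAt_rpow_const (x := w) (p := -1) (Or.inl hw.ne')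
  have h2 := (Real.hasDerivAt_rpow_const (x := w) (p := -η) (Or.inl hw.ne')).div_const η
  refine (h1.add h2).congr_deriv ?_
  rw [riccatiWeight, show (-1 : ℝ) - 1 = -2 by norm_num, show -η - 1 = -1 - η by ring]
  field_simp
  ring

theorem hasDerivAt_riccatiWeight (η : ℝ) {w : ℝ} (hw : 0 < w) :
    HasDerivAt (riccatiWeight η) (-2 * w ^ (-3 : ℝ) + (-1 - η) * w ^ (-2 - η)) w := by
  have h1 := Real.hasDerivAt_rpow_const (x := w) (p := -2) (Or.inl hw.ne')
  have h2 := Real.hasDerivAt_rpow_const (x := w) (p := -1 - η) (Or.inl hw.ne')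
  refine (h1.add h2).congr_deriv ?_
  rw [show (-2 : ℝ) - 1 = -3 by norm_num, show -1 - η - 1 = -2 - η by ring]

theorem neg_deriv_riccatiWeight_le {η w : ℝ} (hη1 : η ≤ 1) (hw : 0 < w) :
    -(2 * riccatiWeight η w / w) ≤ -2 * w ^ (-3 : ℝ) + (-1 - η) * w ^ (-2 - η) := by
  have h1 : w ^ (-3 : ℝ) = w ^ (-2 : ℝ) / w := by
    rw [← Real.rpow_sub_one hw.ne']; norm_num
  have h2 : w ^ (-2 - η) = w ^ (-1 - η) / w := by
    rw [← Real.rpow_sub_one hw.ne']; congr 1; ring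
  rw [h1, h2, riccatiWeight]
  have h3 : 0 < w ^ (-1 - η) / w := by positivity
  have : 2 * (w ^ (-2 : ℝ) + w ^ (-1 - η)) / w
      = 2 * (w ^ (-2 : ℝ) / w) + 2 * (w ^ (-1 - η) / w) := by ring
  rw [this]
  nlinarith

theorem one_le_mul_gain_mul_riccatiWeight {η w : ℝ} (hη : 0 < η) (hη1 : 2 * η ≤ 1) (hw : 0 < w) :
    1 ≤ w * gain (2 * η) w * riccatiWeight η w := by
  unfold gain riccatiWeight
  have hA : 0 < w ^ (-2 : ℝ) := by positivity
  have hB : 0 < w ^ (-1 - η) := by positivity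
  have e1 : w * w * w ^ (-2 : ℝ) = 1 := by
    rw [Real.rpow_neg hw.le]; norm_cast; field_simp
  have e2 : w * w ^ (2 * η) * w ^ (-1 - η) = w ^ η := by
    nth_rewrite 1 [← Real.rpow_one w]
    rw [← Real.rpow_add hw, ← Real.rpow_add hw]; congr 1; ring
  rcases le_total w 1 with h1 | h1
  · have h : w ≤ w ^ (2 * η) := by
      simpa using Real.rpow_le_rpow_of_exponent_ge hw h1 hη1
    rw [min_eq_left h, mul_add, e1]
    have : 0 < w * w * w ^ (-1 - η) := by positivity
    linarith
  · have h : w ^ (2 * η) ≤ w := by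
      simpa using Real.rpow_le_rpow_of_exponent_le h1 hη1
    rw [min_eq_right h, mul_add, e2]
    have : 1 ≤ w ^ η := Real.one_le_rpow h1 hη.le
    have : 0 < w * w ^ (2 * η) * w ^ (-2 : ℝ) := by positivity
    linarith

theorem one_le_sq_mul_gain {η w : ℝ} (hη : 0 < η) (hη1 : 2 * η ≤ 1) (hw : 0 < w) :
    1 ≤ (w * riccatiWeight η w) ^ 2 * gain (2 * η) w := by
  unfold gain riccatiWeight
  have hA : 0 < w ^ (-2 : ℝ) := by positivity
  have hB : 0 < w ^ (-1 - η) := by positivity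
  rcases le_total w 1 with h1 | h1
  · have h : w ≤ w ^ (2 * η) := by
      simpa using Real.rpow_le_rpow_of_exponent_ge hw h1 hη1
    rw [min_eq_left h]
    have e1 : w * w * w ^ (-2 : ℝ) = 1 := by
      rw [Real.rpow_neg hw.le]; norm_cast; field_simp
    have e2 : 1 ≤ w * (w ^ (-2 : ℝ) + w ^ (-1 - η)) := by
      nlinarith [mul_pos hw hA, mul_pos hw hB]
    have e3 : 1 ≤ w * (w * (w ^ (-2 : ℝ) + w ^ (-1 - η))) := by
      nlinarith [mul_pos hw (mul_pos hw hB)]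
    nlinarith
  · have h : w ^ (2 * η) ≤ w := by
      simpa using Real.rpow_le_rpow_of_exponent_le h1 hη1
    rw [min_eq_right h]
    have e1 : w * w ^ (-1 - η) * w ^ η = 1 := by
      rw [mul_assoc, ← Real.rpow_add hw, show -1 - η + η = -1 by ring, Real.rpow_neg_one,
        mul_inv_cancel₀ hw.ne']
    have e2 : w ^ (2 * η) = w ^ η * w ^ η := by rw [← Real.rpow_add hw]; congr 1; ring
    have e3 : 0 < w ^ η := by positivity
    have e4 : 1 ≤ w * (w ^ (-2 : ℝ) + w ^ (-1 - η)) * w ^ η := by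
      have : 0 < w * w ^ (-2 : ℝ) * w ^ η := by positivity
      linarith
    rw [e2]
    nlinarith

end Riccati

section Comparison

variable {c μ θ κ K ν T x₀ δ : ℝ} {X Y Z : ℝ → ℝ}

theorem exists_first_zero_real {f : ℝ → ℝ} {a b : ℝ} (hab : a ≤ b)
    (hf : ContinuousOn f (Icc a b)) (h0 : 0 < f a) (hbad : f b ≤ 0) :
    ∃ t ∈ Ioc a b, f t = 0 ∧ ∀ s ∈ Ico a t, 0 < f s := by
  obtain ⟨t, ht, -, -, h1, h2, -⟩ := exists_first_zero (X := Unit) (K := univ) isCompact_univ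
    (a := a) (b := b) (d := fun s _ => f s)
    (hf.comp (f := fun q : ℝ × Unit => q.1) continuousOn_fst fun q hq => hq.1)
    (fun _ _ => h0) ⟨b, ⟨hab, le_rfl⟩, (), mem_univ _, hbad⟩
  exact ⟨t, ht, h1, fun s hs => h2 s hs () (mem_univ _)⟩

/-- Positive data stay positive: at a first zero of `Y = X'` the inequality gives `Y' > 0`. -/
theorem pos_of_damped_wave_inequality (hc : 0 < c)
    (hXc : ContinuousOn X (Ico 0 T)) (hYc : ContinuousOn Y (Ico 0 T))
    (hX : ∀ t ∈ Ioo 0 T, HasDerivAt X (Y t) t) (hY : ∀ t ∈ Ioo 0 T, HasDerivAt Y (Z t) t)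
    (hX0 : 0 < X 0) (hY0 : 0 < Y 0)
    (hZ : ∀ t ∈ Ioo 0 T, 0 < X t → c ^ 2 * X t ≤ Z t + μ / (1 + t) * Y t) :
    ∀ t ∈ Ico 0 T, 0 < X t ∧ 0 < Y t := by
  have mono : ∀ t ∈ Ico 0 T, (∀ s ∈ Ico 0 t, 0 < Y s) → 0 < X t := by
    intro t ht hpos
    have hm : MonotoneOn X (Icc 0 t) := by
      refine monotoneOn_of_deriv_nonneg (convex_Icc 0 t)
        (hXc.mono fun s hs => ⟨hs.1, hs.2.trans_lt ht.2⟩) ?_ ?_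
      all_goals rw [interior_Icc]; intro s hs
      · exact (hX s ⟨hs.1, hs.2.trans ht.2⟩).differentiableAt.differentiableWithinAt
      · rw [(hX s ⟨hs.1, hs.2.trans ht.2⟩).deriv]
        exact (hpos s ⟨hs.1.le, hs.2⟩).le
    exact hX0.trans_le (hm ⟨le_rfl, ht.1⟩ ⟨ht.1, le_rfl⟩ ht.1)
  have hYpos : ∀ t ∈ Ico 0 T, 0 < Y t := by
    intro t ht
    by_contra hcon
    obtain ⟨s, hs, hs0, hpos⟩ := exists_first_zero_real ht.1
      (hYc.mono fun s hs => ⟨hs.1, hs.2.trans_lt ht.2⟩) hY0 (not_lt.1 hcon)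
    have hsT : s ∈ Ioo 0 T := ⟨hs.1, hs.2.trans_lt ht.2⟩
    have h1 := mono s ⟨hs.1.le, hsT.2⟩ hpos
    have h2 := hZ s hsT h1
    have h3 := hasDerivAt_nonpos_of_first_zero hs.1 (hY s hsT) hs0 hpos
    rw [hs0, mul_zero, add_zero] at h2
    have : 0 < c ^ 2 * X s := by positivity
    linarith
  exact fun t ht => ⟨mono t ht fun s hs => hYpos s ⟨hs.1, hs.2.trans ht.2⟩, hYpos t ht⟩

/-- The algebra at a first zero of `W' Q(W) - δ p`: there `A q + q' V²` is the derivative of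
`W' Q(W)`, where `V = W'`, `A` bounds `W''`, and `q = Q(W)` has derivative `q'` in `W`. -/
theorem riccati_step {W G q q' p κ δ k V A : ℝ} (hW : 0 < W) (hq : 0 < q)
    (hp : 0 < p) (hp1 : p ≤ 1) (hk : 0 ≤ k) (hδ : 0 < δ) (hδκ : δ * k + 2 * δ ^ 2 < κ)
    (hVq : V * q = δ * p) (hA : κ * p * W * G - k * V ≤ A) (hq' : -(2 * q / W) ≤ q')
    (h1 : 1 ≤ W * G * q) (h2 : 1 ≤ (W * q) ^ 2 * G) : 0 < A * q + V * (q' * V) := by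
  have e1 : (κ * p * W * G - k * V) * q ≤ A * q := mul_le_mul_of_nonneg_right hA hq.le
  have e2 : -(2 * q / W) * V ^ 2 ≤ q' * V ^ 2 := mul_le_mul_of_nonneg_right hq' (sq_nonneg V)
  have e3 : V ^ 2 * q / W ≤ δ ^ 2 * p * (W * G * q) := by
    rw [div_le_iff₀ hW, ← mul_le_mul_iff_left₀ hq]
    have l1 : V ^ 2 * q * q = δ ^ 2 * p * p := by
      calc V ^ 2 * q * q = (V * q) ^ 2 := by ring
        _ = δ ^ 2 * p * p := by rw [hVq]; ring
    have l2 : δ ^ 2 * p * p ≤ δ ^ 2 * p * 1 := mul_le_mul_of_nonneg_left hp1 (by positivity)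
    have l3 : δ ^ 2 * p * 1 ≤ δ ^ 2 * p * ((W * q) ^ 2 * G) :=
      mul_le_mul_of_nonneg_left h2 (by positivity)
    rw [l1]
    refine (l2.trans l3).trans (le_of_eq ?_)
    ring
  have e4 : (κ * p * W * G - k * V) * q + -(2 * q / W) * V ^ 2
      = p * (κ * (W * G * q)) - k * (V * q) - 2 * (V ^ 2 * q / W) := by ring
  have e5 : k * (V * q) ≤ p * (k * δ * (W * G * q)) := by
    rw [hVq]
    have : p * (k * δ) * 1 ≤ p * (k * δ) * (W * G * q) :=
      mul_le_mul_of_nonneg_left h1 (by positivity)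
    calc k * (δ * p) = p * (k * δ) * 1 := by ring
      _ ≤ _ := this
      _ = _ := by ring
  have e6 : 0 < p * (W * G * q) * (κ - δ * k - 2 * δ ^ 2) :=
    mul_pos (mul_pos hp (by linarith)) (by linarith)
  have e7 : p * (W * G * q) * (κ - δ * k - 2 * δ ^ 2)
      = p * (κ * (W * G * q)) - p * (k * δ * (W * G * q)) - 2 * (δ ^ 2 * p * (W * G * q)) := by
    ring
  have e8 : V * (q' * V) = q' * V ^ 2 := by ring
  linarith

/-- The second order inequality for the moment, divided by `dampedGrowth`, dominates a first order
Riccati inequality: the quotient `W = X / g` satisfies `W' ≥ δ (1 + t)^{-(ν + μ/2)} / Q(W)`, with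
`Q = riccatiWeight`, as soon as this holds at time `0`. -/
theorem riccati_of_moment_inequality (hc : 0 < c) (hμ : 0 ≤ μ) (hθ : 0 < θ) (hθ1 : θ ≤ 1)
    (hν : 0 ≤ ν) (hδ : 0 < δ) (hδ1 : δ * (2 * c + μ) + 2 * δ ^ 2 < κ)
    (hXc : ContinuousOn X (Ico 0 T)) (hYc : ContinuousOn Y (Ico 0 T))
    (hX : ∀ t ∈ Ioo 0 T, HasDerivAt X (Y t) t) (hY : ∀ t ∈ Ioo 0 T, HasDerivAt Y (Z t) t)
    (hXpos : ∀ t ∈ Ico 0 T, 0 < X t)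
    (hZ : ∀ t ∈ Ioo 0 T, c ^ 2 * X t
      + κ * (1 + t) ^ (-(ν + μ / 2)) * X t * gain θ (X t / dampedGrowth c μ t)
        ≤ Z t + μ / (1 + t) * Y t)
    (hinit : δ < Y 0 / dampedGrowth c μ 0 * riccatiWeight (θ / 2) (X 0 / dampedGrowth c μ 0)) :
    ∀ t ∈ Ico 0 T, δ * (1 + t) ^ (-(ν + μ / 2)) <
      (Y t / dampedGrowth c μ t - dampedRate c μ t * (X t / dampedGrowth c μ t))
        * riccatiWeight (θ / 2) (X t / dampedGrowth c μ t) := by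
  set g := dampedGrowth c μ with hg
  set α := dampedRate c μ with hα
  set Q := riccatiWeight (θ / 2) with hQ
  have hgpos : ∀ t, 0 < g t := dampedGrowth_pos hμ c
  have hgd : ∀ t, HasDerivAt g (α t * g t) t := hasDerivAt_dampedGrowth hμ c
  have hgc : Continuous g := continuous_iff_continuousAt.2 fun t => (hgd t).continuousAt
  have hαc : Continuous α := continuous_iff_continuousAt.2 fun t =>
    (hasDerivAt_dampedRate hμ c t).continuousAt
  have hQc : ContinuousOn Q (Ioi 0) := fun w hw =>
    (hasDerivAt_riccatiWeight (θ / 2) hw).continuousAt.continuousWithinAt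
  intro t ht
  by_contra hcon
  have hsub : Icc 0 t ⊆ Ico 0 T := fun s hs => ⟨hs.1, hs.2.trans_lt ht.2⟩
  have hWc : ContinuousOn (fun s => X s / g s) (Icc 0 t) :=
    (hXc.mono hsub).div hgc.continuousOn fun s _ => (hgpos s).ne'
  obtain ⟨s, hs, hs0, hpos⟩ := exists_first_zero_real
    (f := fun s => (Y s / g s - α s * (X s / g s)) * Q (X s / g s) - δ * (1 + s) ^ (-(ν + μ / 2)))
    ht.1
    (by
      refine ((((hYc.mono hsub).div hgc.continuousOn fun s _ => (hgpos s).ne').sub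
        (hαc.continuousOn.mul hWc)).mul (hQc.comp hWc fun s hs =>
          div_pos (hXpos s (hsub hs)) (hgpos s))).sub (continuousOn_const.mul ?_)
      exact (continuousOn_const.add continuousOn_id).rpow_const fun s hs =>
        Or.inl (ne_of_gt (show (0 : ℝ) < 1 + s by linarith [hs.1])))
    (by
      have : α 0 = 0 := by simp [hα, dampedRate]
      simp only [this, zero_mul, sub_zero, add_zero, Real.one_rpow, mul_one]
      linarith)
    (by simpa using hcon)
  have hsT : s ∈ Ioo 0 T := ⟨hs.1, hs.2.trans_lt ht.2⟩
  have hs00 : 0 ≤ s := hs.1.le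
  have hXs : 0 < X s := hXpos s ⟨hs00, hsT.2⟩
  have hWd : HasDerivAt (fun s => X s / g s) (Y s / g s - α s * (X s / g s)) s := by
    refine ((hX s hsT).div (hgd s) (hgpos s).ne').congr_deriv ?_
    have := hgpos s
    field_simp
  have hYd : HasDerivAt (fun s => Y s / g s) (Z s / g s - α s * (Y s / g s)) s := by
    refine ((hY s hsT).div (hgd s) (hgpos s).ne').congr_deriv ?_
    have := hgpos s
    field_simp
  have hWpos : 0 < X s / g s := div_pos hXs (hgpos s)
  have hQd := (hasDerivAt_riccatiWeight (θ / 2) hWpos).comp s hWd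
  have h1s : (0 : ℝ) < 1 + s := by positivity
  have hpd := (((hasDerivAt_id s).const_add 1).rpow_const (p := -(ν + μ / 2))
    (Or.inl (by simpa using h1s.ne'))).const_mul δ
  have hαd := hasDerivAt_dampedRate hμ c s
  have hric := dampedRate_riccati hμ c hs00
  rw [← hα] at hαd hric
  set α' := c ^ 2 / (μ / 2 + growthRadius c μ s)
    - c ^ 2 * s * (c ^ 2 * s / growthRadius c μ s) / (μ / 2 + growthRadius c μ s) ^ 2 with hα'
  have hfd := ((hYd.sub (hαd.mul hWd)).mul hQd).sub hpd
  have hle := hasDerivAt_nonpos_of_first_zero hs.1 hfd hs0 hpos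
  simp only [id, comp_def, Pi.mul_apply, Pi.sub_apply] at hle
  have hZs := hZ s hsT
  have hQpos : 0 < Q (X s / g s) := riccatiWeight_pos hWpos
  have hQ' := neg_deriv_riccatiWeight_le (η := θ / 2) (by linarith) hWpos
  have hgain := one_le_mul_gain_mul_riccatiWeight (η := θ / 2) (by linarith) (by linarith) hWpos
  have hgp : 0 < gain θ (X s / g s) := gain_pos hWpos
  rw [show 2 * (θ / 2) = θ by ring] at hgain
  rw [← hQ] at hQ' hgain
  have hp : 0 < (1 + s) ^ (-(ν + μ / 2)) := by positivity
  have hp1 : (1 + s) ^ (-(ν + μ / 2)) ≤ 1 :=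
    Real.rpow_le_one_of_one_le_of_nonpos (by linarith) (by linarith [div_nonneg hμ zero_le_two])
  have hp' : 1 * -(ν + μ / 2) * (1 + s) ^ (-(ν + μ / 2) - 1) ≤ 0 := by
    have : 0 < (1 + s) ^ (-(ν + μ / 2) - 1) := by positivity
    have : 0 ≤ ν + μ / 2 := by positivity
    nlinarith
  have hαle : α s ≤ c := dampedRate_le hμ hc.le s
  have hm : μ / (1 + s) ≤ μ := div_le_self hμ (by linarith)
  have hZg : c ^ 2 * (X s / g s) + κ * (1 + s) ^ (-(ν + μ / 2)) * (X s / g s)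
      * gain θ (X s / g s) ≤ Z s / g s + μ / (1 + s) * (Y s / g s) := by
    have := div_le_div_of_nonneg_right hZs (hgpos s).le
    calc _ = (c ^ 2 * X s + κ * (1 + s) ^ (-(ν + μ / 2)) * X s * gain θ (X s / g s)) / g s := by
          ring
      _ ≤ _ := this
      _ = _ := by ring
  set W := X s / g s with hW
  set y := Y s / g s with hy
  set z := Z s / g s with hz
  set q := Q W with hq
  set q' := -2 * W ^ (-3 : ℝ) + (-1 - θ / 2) * W ^ (-2 - θ / 2) with hq'
  set p := (1 + s) ^ (-(ν + μ / 2)) with hpdef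
  set G := gain θ W with hG
  set m := μ / (1 + s) with hmdef
  set V := y - α s * W with hV
  have hVq : V * q = δ * p := by simpa [sub_eq_zero] using hs0
  have hVpos : 0 < V := by
    by_contra h
    have : V * q ≤ 0 := mul_nonpos_of_nonpos_of_nonneg (not_lt.1 h) hQpos.le
    have : 0 < δ * p := by positivity
    linarith
  -- the derivative of `V`, bounded below with the Riccati inequality for `α`
  have hV' : κ * p * W * G - (2 * c + μ) * V ≤ z - α s * y - (α' * W + α s * V) := by
    have hyV : y = V + α s * W := by rw [hV]; ring
    have h1 : (α' + α s ^ 2 + α s * m) * W ≤ c ^ 2 * W :=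
      mul_le_mul_of_nonneg_right hric hWpos.le
    have h2 : α s * V ≤ c * V := mul_le_mul_of_nonneg_right hαle hVpos.le
    have h3 : m * V ≤ μ * V := mul_le_mul_of_nonneg_right hm hVpos.le
    rw [hyV] at hZg ⊢
    linarith
  have hcontra : 0 < (z - α s * y - (α' * W + α s * V)) * q + V * (q' * V) :=
    riccati_step hWpos hQpos hp hp1 (by positivity) hδ hδ1 hVq hV' hQ' hgain
      (by simpa [show 2 * (θ / 2) = θ by ring] using
        one_le_sq_mul_gain (η := θ / 2) (by linarith) (by linarith) hWpos)
  have hδp' : δ * (1 * -(ν + μ / 2) * (1 + s) ^ (-(ν + μ / 2) - 1)) ≤ 0 :=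
    mul_nonpos_of_nonneg_of_nonpos hδ.le hp'
  linarith

end Comparison

/-- The blow-up time of the moment inequality, measured by a primitive `τ` of
`(1 + t)^{-(ν + μ/2)}`. The data of size `ε` force `τ ≤ C / ε` on the whole interval of existence,
because `riccatiPotential (X / g)` is positive, starts at `O(1 / ε)` and decreases at least as
fast as `δ τ` increases. -/
theorem exists_bound_of_moment_inequality {c μ θ κ K ν x₀ y₀ : ℝ} (hc : 0 < c) (hμ : 0 ≤ μ)
    (hθ : 0 < θ) (hθ1 : θ ≤ 1) (hκ : 0 < κ) (hK : 0 < K) (hν : 0 ≤ ν) (hx₀ : 0 < x₀)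
    (hy₀ : 0 < y₀) :
    ∃ ε₀, 0 < ε₀ ∧ ∃ C, 0 < C ∧ ∀ ε, 0 < ε → ε ≤ ε₀ → ∀ (T : ℝ) (X Y Z τ : ℝ → ℝ),
      ContinuousOn X (Ico 0 T) → ContinuousOn Y (Ico 0 T) →
      (∀ t ∈ Ioo 0 T, HasDerivAt X (Y t) t) → (∀ t ∈ Ioo 0 T, HasDerivAt Y (Z t) t) →
      X 0 = ε * x₀ → ε * y₀ ≤ Y 0 →
      (∀ t ∈ Ioo 0 T, 0 < X t → c ^ 2 * X t
        + κ * X t * gain θ (X t / (K * ((1 + t) ^ ν * Real.exp (c * t))))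
          ≤ Z t + μ / (1 + t) * Y t) →
      (∀ t, 0 ≤ t → HasDerivAt τ ((1 + t) ^ (-(ν + μ / 2))) t) → τ 0 = 0 →
      ∀ t ∈ Ico 0 T, τ t ≤ C / ε := by
  obtain ⟨k, hk, hkg⟩ := exists_le_dampedGrowth hμ hc
  have hgpos : ∀ t, 0 < dampedGrowth c μ t := dampedGrowth_pos hμ c
  set g₀ := dampedGrowth c μ 0 with hg₀
  have hg₀pos : 0 < g₀ := hgpos 0
  -- the scale `s ≤ 1` absorbs the ratio of the two growth functions
  set s := min (k / K) 1 with hs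
  have hspos : 0 < s := lt_min (by positivity) one_pos
  have hs1 : s ≤ 1 := min_le_right _ _
  set κ' := κ * s with hκ'
  have hκ'pos : 0 < κ' := by positivity
  set δ := κ' / (2 * c + μ + 3 + κ') with hδdef
  have hden : 0 < 2 * c + μ + 3 + κ' := by positivity
  have hδ : 0 < δ := by positivity
  have hδle : δ ≤ 1 := by
    rw [hδdef, div_le_one hden]; linarith
  have hδκ : δ * (2 * c + μ) + 2 * δ ^ 2 < κ' := by
    have h1 : δ * (2 * c + μ + 3 + κ') = κ' := by rw [hδdef]; field_simp
    nlinarith [mul_pos hδ hκ'pos]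
  have hθ2 : 0 < θ / 2 := by positivity
  refine ⟨min (g₀ / x₀) (y₀ * g₀ / (x₀ ^ 2 * (2 * δ))), by positivity,
    (1 + 1 / (θ / 2)) * (g₀ / x₀) / δ, by positivity, ?_⟩
  intro ε hε hεle T X Y Z τ hXc hYc hX hY hX0 hY0 hZ hτ hτ0
  have hε1 : ε ≤ g₀ / x₀ := hεle.trans (min_le_left _ _)
  have hε2 : ε ≤ y₀ * g₀ / (x₀ ^ 2 * (2 * δ)) := hεle.trans (min_le_right _ _)
  have hX0pos : 0 < X 0 := by rw [hX0]; positivity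
  have hY0pos : 0 < Y 0 := lt_of_lt_of_le (by positivity) hY0
  have hpos := pos_of_damped_wave_inequality (μ := μ) hc hXc hYc hX hY hX0pos hY0pos
    fun t ht hXt => by
      refine le_trans ?_ (hZ t ht hXt)
      have ht0 : 0 < 1 + t := by linarith [ht.1]
      have : 0 < gain θ (X t / (K * ((1 + t) ^ ν * Real.exp (c * t)))) := gain_pos (by positivity)
      have : 0 < κ * X t * gain θ (X t / (K * ((1 + t) ^ ν * Real.exp (c * t)))) := by positivity
      linarith
  have hZ' : ∀ t ∈ Ioo 0 T, c ^ 2 * X t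
      + κ' * (1 + t) ^ (-(ν + μ / 2)) * X t * gain θ (X t / dampedGrowth c μ t)
        ≤ Z t + μ / (1 + t) * Y t := by
    intro t ht
    have hXt := (hpos t ⟨ht.1.le, ht.2⟩).1
    refine le_trans ?_ (hZ t ht hXt)
    have ht0 : 0 < 1 + t := by linarith [ht.1]
    have hgt := hgpos t
    have hexp := Real.exp_pos (c * t)
    have hp1 : (1 + t) ^ (-(ν + μ / 2)) ≤ 1 :=
      Real.rpow_le_one_of_one_le_of_nonpos (by linarith [ht.1])
        (by linarith [div_nonneg hμ zero_le_two])
    have hp : 0 < (1 + t) ^ (-(ν + μ / 2)) := by positivity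
    have hmg := mul_gain_le hθ1 (mul_pos hspos hp) (mul_le_one₀ hs1 hp.le hp1)
      (div_pos hXt hgt).le
    have hle : s * (1 + t) ^ (-(ν + μ / 2)) * (X t / dampedGrowth c μ t)
        ≤ X t / (K * ((1 + t) ^ ν * Real.exp (c * t))) := by
      have h1 : s * K ≤ k := by
        have := min_le_left (k / K) 1
        rw [← hs, le_div_iff₀ hK] at this
        exact this
      have h2 : (1 + t) ^ (-(ν + μ / 2)) * (1 + t) ^ ν = (1 + t) ^ (-(μ / 2)) := by
        rw [← Real.rpow_add ht0]; congr 1; ring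
      rw [← mul_div_assoc, div_le_div_iff₀ hgt (by positivity)]
      calc s * (1 + t) ^ (-(ν + μ / 2)) * X t * (K * ((1 + t) ^ ν * Real.exp (c * t)))
          = X t * (s * K * (Real.exp (c * t)
            * ((1 + t) ^ (-(ν + μ / 2)) * (1 + t) ^ ν))) := by ring
        _ ≤ X t * dampedGrowth c μ t := by
          refine mul_le_mul_of_nonneg_left (le_trans ?_ (hkg t ht.1.le)) hXt.le
          rw [h2]
          exact mul_le_mul_of_nonneg_right h1 (by positivity)
    have hgm := gain_mono hθ.le (by positivity) hle
    have := mul_le_mul_of_nonneg_left (hmg.trans hgm) (mul_pos hκ hXt).le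
    have e : κ' * (1 + t) ^ (-(ν + μ / 2)) * X t * gain θ (X t / dampedGrowth c μ t)
        = κ * X t * (s * (1 + t) ^ (-(ν + μ / 2)) * gain θ (X t / dampedGrowth c μ t)) := by
      rw [hκ']; ring
    rw [e]
    linarith
  have hW0 : 0 < X 0 / g₀ := by positivity
  have hinit : δ < Y 0 / g₀ * riccatiWeight (θ / 2) (X 0 / g₀) := by
    have h1 : (X 0 / g₀) ^ (-2 : ℝ) ≤ riccatiWeight (θ / 2) (X 0 / g₀) := by
      unfold riccatiWeight
      linarith [Real.rpow_pos_of_pos hW0 (-1 - θ / 2)]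
    have h2 : (X 0 / g₀) ^ (-2 : ℝ) = g₀ ^ 2 / (ε * x₀) ^ 2 := by
      rw [Real.rpow_neg hW0.le, hX0]; norm_cast; field_simp
    rw [h2] at h1
    have h3 : ε * y₀ / g₀ * (g₀ ^ 2 / (ε * x₀) ^ 2)
        ≤ Y 0 / g₀ * riccatiWeight (θ / 2) (X 0 / g₀) :=
      mul_le_mul (by gcongr) h1 (by positivity) (by positivity)
    refine lt_of_lt_of_le ?_ h3
    rw [le_div_iff₀ (by positivity)] at hε2
    rw [show ε * y₀ / g₀ * (g₀ ^ 2 / (ε * x₀) ^ 2) = y₀ * g₀ / (ε * x₀ ^ 2) by field_simp,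
      lt_div_iff₀ (by positivity)]
    have : 0 < ε * (x₀ ^ 2 * δ) := by positivity
    linarith
  have hric := riccati_of_moment_inequality hc hμ hθ hθ1 hν hδ hδκ hXc hYc hX hY
    (fun t ht => (hpos t ht).1) hZ' hinit
  have hgd : ∀ t, HasDerivAt (dampedGrowth c μ) (dampedRate c μ t * dampedGrowth c μ t) t :=
    hasDerivAt_dampedGrowth hμ c
  have hgc : Continuous (dampedGrowth c μ) :=
    continuous_iff_continuousAt.2 fun t => (hgd t).continuousAt
  intro t ht
  have hsub : Icc 0 t ⊆ Ico 0 T := fun s hs => ⟨hs.1, hs.2.trans_lt ht.2⟩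
  have hWpos : ∀ s ∈ Icc 0 t, 0 < X s / dampedGrowth c μ s := fun s hs =>
    div_pos (hpos s (hsub hs)).1 (hgpos s)
  have hanti : AntitoneOn
      (fun s => riccatiPotential (θ / 2) (X s / dampedGrowth c μ s) + δ * τ s) (Icc 0 t) := by
    have hder : ∀ s ∈ Ioo 0 t, HasDerivAt
        (fun s => riccatiPotential (θ / 2) (X s / dampedGrowth c μ s) + δ * τ s)
        (-riccatiWeight (θ / 2) (X s / dampedGrowth c μ s) *
          (Y s / dampedGrowth c μ s - dampedRate c μ s * (X s / dampedGrowth c μ s))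
          + δ * (1 + s) ^ (-(ν + μ / 2))) s := by
      intro s hs
      have hsT : s ∈ Ioo 0 T := ⟨hs.1, hs.2.trans ht.2⟩
      have hWd : HasDerivAt (fun s => X s / dampedGrowth c μ s)
          (Y s / dampedGrowth c μ s - dampedRate c μ s * (X s / dampedGrowth c μ s)) s := by
        refine ((hX s hsT).div (hgd s) (hgpos s).ne').congr_deriv ?_
        have := hgpos s
        field_simp
      exact ((hasDerivAt_riccatiPotential hθ2 (hWpos s ⟨hs.1.le, hs.2.le⟩)).comp s hWd).add
        ((hτ s hs.1.le).const_mul δ)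
    refine antitoneOn_of_deriv_nonpos (convex_Icc 0 t) ?_ ?_ ?_
    · refine ContinuousOn.add (ContinuousOn.comp (t := Ioi 0) (g := riccatiPotential (θ / 2))
        (fun w hw => (hasDerivAt_riccatiPotential hθ2 hw).continuousAt.continuousWithinAt)
        ((hXc.mono hsub).div hgc.continuousOn fun s _ => (hgpos s).ne') hWpos)
        (continuousOn_const.mul fun s hs => (hτ s hs.1).continuousAt.continuousWithinAt)
    · rw [interior_Icc]
      exact fun s hs => (hder s hs).differentiableAt.differentiableWithinAt
    · rw [interior_Icc]
      intro s hs
      rw [(hder s hs).deriv]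
      have := hric s ⟨hs.1.le, hs.2.trans ht.2⟩
      linarith
  have h1 := hanti ⟨le_rfl, ht.1⟩ ⟨ht.1, le_rfl⟩ ht.1
  simp only [hτ0, mul_zero, add_zero] at h1
  have h2 : 0 < riccatiPotential (θ / 2) (X t / dampedGrowth c μ t) := by
    have := hWpos t ⟨ht.1, le_rfl⟩
    unfold riccatiPotential
    positivity
  have h3 : riccatiPotential (θ / 2) (X 0 / g₀) ≤ (1 + 1 / (θ / 2)) * (g₀ / x₀) / ε := by
    have hle1 : X 0 / g₀ ≤ 1 := by
      rw [div_le_one hg₀pos, hX0]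
      rwa [le_div_iff₀ hx₀] at hε1
    have h4 : (X 0 / g₀) ^ (-(θ / 2)) ≤ (X 0 / g₀) ^ (-1 : ℝ) :=
      Real.rpow_le_rpow_of_exponent_ge hW0 hle1 (by linarith)
    have h5 : (X 0 / g₀) ^ (-1 : ℝ) = g₀ / x₀ / ε := by
      rw [Real.rpow_neg_one, hX0]; field_simp
    rw [riccatiPotential, h5]
    rw [h5] at h4
    calc g₀ / x₀ / ε + (X 0 / g₀) ^ (-(θ / 2)) / (θ / 2)
        ≤ g₀ / x₀ / ε + g₀ / x₀ / ε / (θ / 2) := by gcongr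
      _ = _ := by ring
  have h4 : δ * τ t ≤ (1 + 1 / (θ / 2)) * (g₀ / x₀) / ε := by
    rw [hg₀] at h3
    linarith
  rw [div_div, mul_comm δ ε, ← div_div, le_div_iff₀ hδ]
  linarith

/-! ### Relative energy near the constant state -/

section State

/-- The internal energy relative to the constant state `ρbar`: it solves `H'' = p' / ρ` and
vanishes to second order at `ρbar`. -/
noncomputable def relEnergy (A γ ρbar r : ℝ) : ℝ :=
  A / (γ - 1) * (r ^ γ - ρbar ^ γ - γ * ρbar ^ (γ - 1) * (r - ρbar))

/-- The derivative of `relEnergy`. -/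
noncomputable def relEnthalpy (A γ ρbar r : ℝ) : ℝ :=
  A * γ / (γ - 1) * (r ^ (γ - 1) - ρbar ^ (γ - 1))

/-- The speed of sound `√p'(ρbar)` at the constant state. -/
noncomputable def soundSpeed (A γ ρbar : ℝ) : ℝ := √(A * γ * ρbar ^ (γ - 1))

variable {A γ ρbar : ℝ}

theorem soundSpeed_sq (hγ : 1 < γ) (hA : 0 < A) (hρ : 0 < ρbar) :
    soundSpeed A γ ρbar ^ 2 = A * γ * ρbar ^ (γ - 1) := Real.sq_sqrt (by positivity)

theorem soundSpeed_pos (hγ : 1 < γ) (hA : 0 < A) (hρ : 0 < ρbar) : 0 < soundSpeed A γ ρbar :=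
  Real.sqrt_pos.2 (by positivity)

theorem hasDerivAt_relEnergy (hγ : 1 < γ) (r : ℝ) :
    HasDerivAt (relEnergy A γ ρbar) (relEnthalpy A γ ρbar r) r := by
  have h1 := Real.hasDerivAt_rpow_const (x := r) (p := γ) (Or.inr hγ.le)
  have h2 := (((h1.sub_const (ρbar ^ γ)).sub (((hasDerivAt_id r).sub_const ρbar).const_mul
    (γ * ρbar ^ (γ - 1)))).const_mul (A / (γ - 1)))
  refine h2.congr_deriv ?_
  rw [relEnthalpy]
  ring

theorem hasDerivAt_pressure (hγ : 1 < γ) (r : ℝ) :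
    HasDerivAt (fun r => A * r ^ γ) (A * γ * r ^ (γ - 1)) r := by
  refine ((Real.hasDerivAt_rpow_const (x := r) (p := γ) (Or.inr hγ.le)).const_mul A).congr_deriv ?_
  ring

theorem contDiff_pressure (hγ : 1 < γ) : ContDiff ℝ 1 (fun r : ℝ => A * r ^ γ) :=
  contDiff_const.mul (by
    simpa using Real.contDiff_rpow_const_of_le (n := 1) (p := γ) (by simpa using hγ.le))

theorem contDiff_relEnergy (hγ : 1 < γ) : ContDiff ℝ 1 (relEnergy A γ ρbar) := by
  have h : ContDiff ℝ 1 (fun r : ℝ => r ^ γ) := by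
    simpa using Real.contDiff_rpow_const_of_le (n := 1) (p := γ) (by simpa using hγ.le)
  unfold relEnergy
  exact contDiff_const.mul ((h.sub contDiff_const).sub
    (contDiff_const.mul (contDiff_id.sub contDiff_const)))

@[simp] theorem relEnergy_self : relEnergy A γ ρbar ρbar = 0 := by simp [relEnergy]

/-- The Legendre identity `H + (p - p(ρbar)) = ρ H'`. -/
theorem relEnergy_add_pressure (hγ : 1 < γ) (hρ : 0 < ρbar) {r : ℝ} (hr : 0 < r) :
    relEnergy A γ ρbar r + (A * r ^ γ - A * ρbar ^ γ) = r * relEnthalpy A γ ρbar r := by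
  have h1 : r ^ γ = r * r ^ (γ - 1) := by
    rw [Real.rpow_sub_one hr.ne']; field_simp
  have h2 : ρbar ^ γ = ρbar * ρbar ^ (γ - 1) := by
    rw [Real.rpow_sub_one hρ.ne']; field_simp
  have h3 : γ - 1 ≠ 0 := by linarith
  rw [relEnergy, relEnthalpy, h1, h2]
  field_simp
  ring

/-- Second order lower bound for the relative energy, with the sharp constant up to `κ`. -/
theorem eventually_relEnergy_ge (hγ : 1 < γ) (hρ : 0 < ρbar) {κ : ℝ} (hκ : 0 < κ) :
    ∃ η > 0, ∀ r, |r - ρbar| < η →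
      (A * γ * ρbar ^ (γ - 1) / ρbar / 2 - κ) * (r - ρbar) ^ 2 ≤ relEnergy A γ ρbar r := by
  set k := A * γ * ρbar ^ (γ - 1) / ρbar with hk
  have hd : HasDerivAt (relEnthalpy A γ ρbar) k ρbar := by
    have h1 := Real.hasDerivAt_rpow_const (x := ρbar) (p := γ - 1) (Or.inl hρ.ne')
    refine ((h1.sub_const (ρbar ^ (γ - 1))).const_mul (A * γ / (γ - 1))).congr_deriv ?_
    have h3 : γ - 1 ≠ 0 := by linarith
    rw [hk, Real.rpow_sub_one hρ.ne' (γ - 1)]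
    field_simp
  have h0 : relEnthalpy A γ ρbar ρbar = 0 := by simp [relEnthalpy]
  have hev := (hasDerivAt_iff_isLittleO.1 hd).def hκ
  rw [Metric.eventually_nhds_iff] at hev
  obtain ⟨η, hη, hb⟩ := hev
  refine ⟨η, hη, fun r hr => ?_⟩
  have hder : ∀ x ∈ uIcc ρbar r, HasDerivWithinAt
      (fun x => relEnergy A γ ρbar x - k / 2 * (x - ρbar) ^ 2)
      (relEnthalpy A γ ρbar x - k * (x - ρbar)) (uIcc ρbar r) x := fun x _ => by
    have h1 := (((hasDerivAt_id x).sub_const ρbar).pow 2).const_mul (k / 2)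
    refine ((hasDerivAt_relEnergy hγ x).sub h1).hasDerivWithinAt.congr_deriv ?_
    simp only [id]
    ring
  have hbd : ∀ x ∈ uIcc ρbar r, ‖relEnthalpy A γ ρbar x - k * (x - ρbar)‖ ≤ κ * |r - ρbar| := by
    intro x hx
    have hxr : |x - ρbar| ≤ |r - ρbar| := abs_sub_left_of_mem_uIcc hx
    have := hb (y := x) (by rw [Real.dist_eq]; linarith)
    rw [h0, sub_zero, smul_eq_mul, mul_comm (x - ρbar), Real.norm_eq_abs (x - ρbar)] at this
    exact this.trans (mul_le_mul_of_nonneg_left hxr hκ.le)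
  have := Convex.norm_image_sub_le_of_norm_hasDerivWithin_le hder hbd (convex_uIcc ρbar r)
    left_mem_uIcc right_mem_uIcc
  simp only [relEnergy_self, sub_self, ne_eq, OfNat.ofNat_ne_zero, not_false_eq_true, zero_pow,
    mul_zero, sub_zero, Real.norm_eq_abs] at this
  have h2 := (abs_le.1 this).1
  have h3 : κ * |r - ρbar| * |r - ρbar| = κ * (r - ρbar) ^ 2 := by
    rw [mul_assoc, abs_mul_abs_self]; ring
  nlinarith

/-- Near the constant state the energy flux is at most `σ` times the energy, for any `σ` above the
speed of sound: this bounds the speed of propagation by `σ`. -/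
theorem exists_flux_le_energy (hγ : 1 < γ) (hA : 0 < A) (hρ : 0 < ρbar) {σ : ℝ}
    (hσ : soundSpeed A γ ρbar < σ) :
    ∃ η > 0, ∀ r v : ℝ, |r - ρbar| < η → 0 ≤ v → v < η →
      0 < r ∧ 0 ≤ 1 / 2 * r * v ^ 2 + relEnergy A γ ρbar r ∧
      |1 / 2 * r * v ^ 2 + relEnergy A γ ρbar r + (A * r ^ γ - A * ρbar ^ γ)| * v
        ≤ σ * (1 / 2 * r * v ^ 2 + relEnergy A γ ρbar r) ∧
      (1 / 2 * r * v ^ 2 + relEnergy A γ ρbar r = 0 → r = ρbar ∧ v = 0) := by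
  have hc := soundSpeed_pos hγ hA hρ
  have hcsq := soundSpeed_sq hγ hA hρ
  set c := soundSpeed A γ ρbar with hcdef
  set k := c ^ 2 / ρbar with hk
  have hkpos : 0 < k := by positivity
  -- the margin `κ` is chosen so small that the sharp inequality `c < σ` survives
  have hev : ∀ᶠ κ in 𝓝[>] (0 : ℝ), κ < σ ∧ κ < ρbar ∧ 2 * κ < k ∧
      (c ^ 2 + κ) ^ 2 < (σ - κ) ^ 2 * (ρbar - κ) * (k - 2 * κ) := by
    have hlt : (c ^ 2 + 0) ^ 2 < (σ - 0) ^ 2 * (ρbar - 0) * (k - 2 * 0) := by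
      have : (σ - 0) ^ 2 * (ρbar - 0) * (k - 2 * 0) = σ ^ 2 * c ^ 2 := by
        rw [hk]; field_simp; ring
      rw [this]
      have : c ^ 2 < σ ^ 2 := by nlinarith
      have : 0 < c ^ 2 := by positivity
      nlinarith
    have h4 : ∀ᶠ κ in 𝓝 (0 : ℝ), (c ^ 2 + κ) ^ 2 < (σ - κ) ^ 2 * (ρbar - κ) * (k - 2 * κ) :=
      ContinuousAt.eventually_lt (f := fun κ : ℝ => (c ^ 2 + κ) ^ 2)
        (g := fun κ : ℝ => (σ - κ) ^ 2 * (ρbar - κ) * (k - 2 * κ)) (by fun_prop) (by fun_prop) hlt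
    have h1 : ∀ᶠ κ in 𝓝 (0 : ℝ), κ < σ := eventually_lt_nhds (by linarith)
    have h2 : ∀ᶠ κ in 𝓝 (0 : ℝ), κ < ρbar := eventually_lt_nhds hρ
    have h3 : ∀ᶠ κ in 𝓝 (0 : ℝ), κ < k / 2 := eventually_lt_nhds (by positivity)
    have := nhdsWithin_le_nhds (s := Ioi (0 : ℝ)) (h1.and (h2.and (h3.and h4)))
    filter_upwards [this] with κ hκ
    exact ⟨hκ.1, hκ.2.1, by linarith [hκ.2.2.1], hκ.2.2.2⟩
  obtain ⟨κ, ⟨hκσ, hκρ, hκk, hκ4⟩, hκpos⟩ := (hev.and self_mem_nhdsWithin).exists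
  have hκpos : 0 < κ := hκpos
  obtain ⟨η₁, hη₁, hH⟩ := eventually_relEnergy_ge (A := A) hγ hρ hκpos
  have hP : ∃ η₂ > 0, ∀ r, |r - ρbar| < η₂ →
      |A * r ^ γ - A * ρbar ^ γ| ≤ (c ^ 2 + κ) * |r - ρbar| := by
    have hev := (hasDerivAt_iff_isLittleO.1 (hasDerivAt_pressure (A := A) hγ ρbar)).def hκpos
    rw [Metric.eventually_nhds_iff] at hev
    obtain ⟨η, hη, hb⟩ := hev
    refine ⟨η, hη, fun r hr => ?_⟩
    have h1 := hb (y := r) hr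
    rw [← hcsq, smul_eq_mul, Real.norm_eq_abs, Real.norm_eq_abs] at h1
    calc |A * r ^ γ - A * ρbar ^ γ|
        = |(A * r ^ γ - A * ρbar ^ γ - (r - ρbar) * c ^ 2) + (r - ρbar) * c ^ 2| := by
          rw [sub_add_cancel]
      _ ≤ κ * |r - ρbar| + |(r - ρbar) * c ^ 2| := (abs_add_le _ _).trans (by linarith)
      _ = (c ^ 2 + κ) * |r - ρbar| := by rw [abs_mul, abs_of_pos (by positivity : 0 < c ^ 2)]; ring
  obtain ⟨η₂, hη₂, hP⟩ := hP
  refine ⟨min κ (min η₁ η₂), by positivity, fun r v hr hv hvη => ?_⟩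
  have hrκ : |r - ρbar| < κ := hr.trans_le (min_le_left _ _)
  have hvκ : v < κ := hvη.trans_le (min_le_left _ _)
  have hHr := hH r (hr.trans_le ((min_le_right _ _).trans (min_le_left _ _)))
  have hPr := hP r (hr.trans_le ((min_le_right _ _).trans (min_le_right _ _)))
  rw [← hcsq, ← hk] at hHr
  set s := |r - ρbar| with hs
  have hs0 : 0 ≤ s := abs_nonneg _
  have hss : (r - ρbar) ^ 2 = s ^ 2 := (sq_abs _).symm
  rw [hss] at hHr
  have hrlow : ρbar - κ < r := by linarith [(abs_lt.1 hrκ).1]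
  have hrpos : 0 < r := by linarith
  set e := 1 / 2 * r * v ^ 2 + relEnergy A γ ρbar r with he
  set P := A * r ^ γ - A * ρbar ^ γ with hPdef
  have hav : 0 < ρbar - κ := by linarith
  have hak : 0 < k - 2 * κ := by linarith
  have hquad : (ρbar - κ) / 2 * v ^ 2 + (k - 2 * κ) / 2 * s ^ 2 ≤ e := by
    have : (ρbar - κ) / 2 * v ^ 2 ≤ 1 / 2 * r * v ^ 2 :=
      mul_le_mul_of_nonneg_right (by linarith) (sq_nonneg v)
    linarith
  have he0 : 0 ≤ e := le_trans (by positivity) hquad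
  refine ⟨hrpos, he0, ?_, fun h0 => ?_⟩
  · have h1 : |e + P| * v ≤ e * κ + (c ^ 2 + κ) * s * v := by
      have : |e + P| ≤ e + (c ^ 2 + κ) * s :=
        (abs_add_le _ _).trans (by rw [abs_of_nonneg he0]; linarith)
      calc |e + P| * v ≤ (e + (c ^ 2 + κ) * s) * v := mul_le_mul_of_nonneg_right this hv
        _ = e * v + (c ^ 2 + κ) * s * v := by ring
        _ ≤ _ := by linarith [mul_le_mul_of_nonneg_left hvκ.le he0]
    have h2 : (c ^ 2 + κ) * s * v
        ≤ (σ - κ) * ((ρbar - κ) / 2 * v ^ 2 + (k - 2 * κ) / 2 * s ^ 2) := by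
      have hσκ : 0 < σ - κ := by linarith
      set p := √(ρbar - κ) with hp
      set q := √(k - 2 * κ) with hq
      have hp2 : p ^ 2 = ρbar - κ := Real.sq_sqrt hav.le
      have hq2 : q ^ 2 = k - 2 * κ := Real.sq_sqrt hak.le
      have hppos : 0 < p := Real.sqrt_pos.2 hav
      have hqpos : 0 < q := Real.sqrt_pos.2 hak
      have h3 : c ^ 2 + κ ≤ (σ - κ) * (p * q) := by
        refine le_of_sq_le_sq ?_ (by positivity)
        rw [mul_pow, mul_pow, hp2, hq2]
        linarith
      rw [← hp2, ← hq2]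
      have h4 : (c ^ 2 + κ) * (s * v) ≤ (σ - κ) * (p * q) * (s * v) :=
        mul_le_mul_of_nonneg_right h3 (by positivity)
      have h5 : (σ - κ) * (p ^ 2 / 2 * v ^ 2 + q ^ 2 / 2 * s ^ 2)
          = (σ - κ) * (p * q) * (s * v) + (σ - κ) / 2 * (p * v - q * s) ^ 2 := by ring
      have h6 : 0 ≤ (σ - κ) / 2 * (p * v - q * s) ^ 2 := by positivity
      rw [h5]
      linarith
    have h3 : (σ - κ) * ((ρbar - κ) / 2 * v ^ 2 + (k - 2 * κ) / 2 * s ^ 2) ≤ (σ - κ) * e :=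
      mul_le_mul_of_nonneg_left hquad (by linarith)
    linarith
  · rw [h0] at hquad
    have hv2 : v ^ 2 ≤ 0 := by
      by_contra h
      have : 0 < (ρbar - κ) / 2 * v ^ 2 := mul_pos (by linarith) (not_le.1 h)
      have : 0 ≤ (k - 2 * κ) / 2 * s ^ 2 := by positivity
      linarith
    have hs2 : s ^ 2 ≤ 0 := by
      by_contra h
      have : 0 < (k - 2 * κ) / 2 * s ^ 2 := mul_pos (by linarith) (not_le.1 h)
      have : 0 ≤ (ρbar - κ) / 2 * v ^ 2 := by positivity
      linarith
    have hv0 : v = 0 := pow_eq_zero_iff two_ne_zero |>.1 (le_antisymm hv2 (sq_nonneg v))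
    have hs0 : s = 0 := pow_eq_zero_iff two_ne_zero |>.1 (le_antisymm hs2 (sq_nonneg s))
    exact ⟨by rw [hs] at hs0; linarith [abs_eq_zero.1 hs0], hv0⟩

end State

/-! ### The equations in nonconservative form -/

section Euler

variable {n : ℕ}

theorem timeStrip_ofReal (n : ℕ) (T : ℝ) :
    timeStrip n (ENNReal.ofReal T) = Ico 0 T ×ˢ univ := by
  ext q
  simp only [timeStrip, mem_ofPred_eq, mem_prod, mem_Ico, mem_univ, and_true]
  exact and_congr_right fun h => ENNReal.ofReal_lt_ofReal_iff_of_nonneg h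

variable {A γ μ ρbar ε T : ℝ} {ρ₀ : 𝔼 n → ℝ} {u₀ : 𝔼 n → 𝔼 n} {ρ : ℝ → 𝔼 n → ℝ} {u : ℝ → 𝔼 n → 𝔼 n}

theorem IsEulerSolution.density
    (h : IsEulerSolution A γ 1 μ ρbar ε ρ₀ u₀ (ENNReal.ofReal T) ρ u) :
    ContDiffOn ℝ 1 (fun q : ℝ × 𝔼 n => ρ q.1 q.2) (Ico 0 T ×ˢ univ) :=
  timeStrip_ofReal n T ▸ h.contDiffOn_density

theorem IsEulerSolution.velocity
    (h : IsEulerSolution A γ 1 μ ρbar ε ρ₀ u₀ (ENNReal.ofReal T) ρ u) :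
    ContDiffOn ℝ 1 (fun q : ℝ × 𝔼 n => u q.1 q.2) (Ico 0 T ×ˢ univ) :=
  timeStrip_ofReal n T ▸ h.contDiffOn_velocity

theorem IsEulerSolution.velocity_apply
    (h : IsEulerSolution A γ 1 μ ρbar ε ρ₀ u₀ (ENNReal.ofReal T) ρ u) (j : Fin n) :
    ContDiffOn ℝ 1 (fun q : ℝ × 𝔼 n => u q.1 q.2 j) (Ico 0 T ×ˢ univ) :=
  contDiffOn_euclidean.1 h.velocity j

theorem differentiableAt_time {F : ℝ → 𝔼 n → ℝ}
    (hF : ContDiffOn ℝ 1 (fun q : ℝ × 𝔼 n => F q.1 q.2) (Ico 0 T ×ˢ univ)) {t : ℝ}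
    (ht : t ∈ Ioo 0 T) (x : 𝔼 n) : DifferentiableAt ℝ (fun s => F s x) t :=
  (hasDerivAt_time (contDiffAt_of_strip hF ht x)).differentiableAt

theorem differentiableAt_slice {F : ℝ → 𝔼 n → ℝ}
    (hF : ContDiffOn ℝ 1 (fun q : ℝ × 𝔼 n => F q.1 q.2) (Ico 0 T ×ˢ univ)) {t : ℝ}
    (ht : t ∈ Ioo 0 T) (x : 𝔼 n) : DifferentiableAt ℝ (F t) x :=
  (contDiff_slice hF (Ioo_subset_Ico_self ht)).differentiable one_ne_zero x

theorem IsEulerSolution.mass_eq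
    (h : IsEulerSolution A γ 1 μ ρbar ε ρ₀ u₀ (ENNReal.ofReal T) ρ u) {t : ℝ}
    (ht : t ∈ Ioo 0 T) (x : 𝔼 n) :
    deriv (fun s => ρ s x) t + ∑ i, (partialDeriv i (ρ t) x * u t x i
      + ρ t x * partialDeriv i (fun y => u t y i) x) = 0 := by
  have := h.mass t ht.1 ((ENNReal.ofReal_lt_ofReal_iff_of_nonneg ht.1.le).2 ht.2) x
  rw [← this]
  congr 1
  refine Finset.sum_congr rfl fun i _ => ?_
  exact (partialDeriv_mul (differentiableAt_slice h.density ht x)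
    (differentiableAt_slice (F := fun t x => u t x i) (h.velocity_apply i) ht x) i).symm

theorem IsEulerSolution.momentum_eq
    (h : IsEulerSolution A γ 1 μ ρbar ε ρ₀ u₀ (ENNReal.ofReal T) ρ u) (hγ : 1 < γ) {t : ℝ}
    (ht : t ∈ Ioo 0 T) (x : 𝔼 n) (j : Fin n) :
    ρ t x * deriv (fun s => u s x j) t
      + ∑ i, ρ t x * u t x i * partialDeriv i (fun y => u t y j) x
      + A * γ * ρ t x ^ (γ - 1) * partialDeriv j (ρ t) x
      + μ / (1 + t) * ρ t x * u t x j = 0 := by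
  have hmom := h.momentum t ht.1 ((ENNReal.ofReal_lt_ofReal_iff_of_nonneg ht.1.le).2 ht.2) x j
  have hmass := h.mass_eq ht x
  have hρ := differentiableAt_slice h.density ht x
  have hu : ∀ i, DifferentiableAt ℝ (fun y => u t y i) x := fun i =>
    differentiableAt_slice (F := fun t x => u t x i) (h.velocity_apply i) ht x
  have h1 : deriv (fun s => ρ s x * u s x j) t
      = deriv (fun s => ρ s x) t * u t x j + ρ t x * deriv (fun s => u s x j) t :=
    deriv_fun_mul (differentiableAt_time h.density ht x)
      (differentiableAt_time (F := fun t x => u t x j) (h.velocity_apply j) ht x)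
  have h2 : ∀ i, partialDeriv i (fun y => ρ t y * u t y i * u t y j) x
      = (partialDeriv i (ρ t) x * u t x i + ρ t x * partialDeriv i (fun y => u t y i) x) * u t x j
        + ρ t x * u t x i * partialDeriv i (fun y => u t y j) x := fun i => by
    rw [partialDeriv_mul (f := fun y => ρ t y * u t y i) (hρ.mul (hu i)) (hu j) i,
      partialDeriv_mul hρ (hu i) i]
  have h3 : partialDeriv j (fun y => A * ρ t y ^ γ) x
      = A * γ * ρ t x ^ (γ - 1) * partialDeriv j (ρ t) x :=
    partialDeriv_comp (hasDerivAt_pressure hγ (ρ t x)) hρ j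
  rw [h1, h3, Finset.sum_congr rfl fun i _ => h2 i, Finset.sum_add_distrib, ← Finset.sum_mul,
    Real.rpow_one] at hmom
  linear_combination hmom - u t x j * hmass

/-- The energy of the flow relative to the constant state `(ρbar, 0)`. -/
noncomputable def relFlowEnergy (A γ ρbar r : ℝ) (v : 𝔼 n) : ℝ :=
  1 / 2 * r * (∑ j, v j ^ 2) + relEnergy A γ ρbar r

/-- Local balance of the relative energy. -/
theorem IsEulerSolution.energy_eq
    (h : IsEulerSolution A γ 1 μ ρbar ε ρ₀ u₀ (ENNReal.ofReal T) ρ u) (hγ : 1 < γ)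
    (hρbar : 0 < ρbar) {t : ℝ} (ht : t ∈ Ioo 0 T) {x : 𝔼 n} (hpos : 0 < ρ t x) :
    deriv (fun s => relFlowEnergy A γ ρbar (ρ s x) (u s x)) t
      + ∑ i, partialDeriv i (fun y => (relFlowEnergy A γ ρbar (ρ t y) (u t y)
          + (A * ρ t y ^ γ - A * ρbar ^ γ)) * u t y i) x
      = -(μ / (1 + t) * ρ t x * ∑ j, u t x j ^ 2) := by
  have hmass := h.mass_eq ht x
  have hmom := h.momentum_eq hγ ht x
  have hleg := relEnergy_add_pressure (A := A) hγ hρbar hpos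
  have hρx := differentiableAt_slice h.density ht x
  have hux : ∀ i, DifferentiableAt ℝ (fun y => u t y i) x := fun i =>
    differentiableAt_slice (F := fun t x => u t x i) (h.velocity_apply i) ht x
  have hρt := (differentiableAt_time h.density ht x).hasDerivAt
  have hut : ∀ i, HasDerivAt (fun s => u s x i) (deriv (fun s => u s x i) t) t := fun i =>
    (differentiableAt_time (F := fun t x => u t x i) (h.velocity_apply i) ht x).hasDerivAt
  have hSt : HasDerivAt (fun s => ∑ j, u s x j ^ 2)
      (∑ j, 2 * u t x j * deriv (fun s => u s x j) t) t :=
    HasDerivAt.fun_sum fun j _ => ((hut j).pow 2).congr_deriv (by simp)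
  have het : deriv (fun s => relFlowEnergy A γ ρbar (ρ s x) (u s x)) t
      = 1 / 2 * (deriv (fun s => ρ s x) t * ∑ j, u t x j ^ 2
          + ρ t x * ∑ j, 2 * u t x j * deriv (fun s => u s x j) t)
        + relEnthalpy A γ ρbar (ρ t x) * deriv (fun s => ρ s x) t := by
    have h1 := ((hρt.const_mul (1 / 2)).mul hSt).add ((hasDerivAt_relEnergy (A := A) (ρbar := ρbar) hγ _).comp t hρt)
    refine HasDerivAt.deriv (h1.congr_deriv ?_)
    ring
  have hSx : HasFDerivAt (fun y => ∑ j, u t y j ^ 2)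
      (∑ j, (2 * u t x j) • fderiv ℝ (fun y => u t y j) x) x :=
    HasFDerivAt.fun_sum fun j _ => ((hux j).hasFDerivAt.pow 2).congr_fderiv (by
      simp)
  have hSxi : ∀ i, partialDeriv i (fun y => ∑ j, u t y j ^ 2) x
      = ∑ j, 2 * u t x j * partialDeriv i (fun y => u t y j) x := fun i => by
    rw [partialDeriv, hSx.fderiv]
    simp [partialDeriv]
  have hSd : DifferentiableAt ℝ (fun y => ∑ j, u t y j ^ 2) x := hSx.differentiableAt
  have hHd : DifferentiableAt ℝ (fun y => relEnergy A γ ρbar (ρ t y)) x :=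
    (hasDerivAt_relEnergy hγ _).differentiableAt.comp x hρx
  have hPd : DifferentiableAt ℝ (fun y => A * ρ t y ^ γ) x :=
    (hasDerivAt_pressure hγ _).differentiableAt.comp x hρx
  have hQ : ∀ i, partialDeriv i (fun y => (relFlowEnergy A γ ρbar (ρ t y) (u t y)
          + (A * ρ t y ^ γ - A * ρbar ^ γ)) * u t y i) x
      = (1 / 2 * (partialDeriv i (ρ t) x * ∑ j, u t x j ^ 2
            + ρ t x * ∑ j, 2 * u t x j * partialDeriv i (fun y => u t y j) x)
          + (relEnthalpy A γ ρbar (ρ t x) + A * γ * ρ t x ^ (γ - 1)) * partialDeriv i (ρ t) x)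
          * u t x i
        + (1 / 2 * ρ t x * (∑ j, u t x j ^ 2) + ρ t x * relEnthalpy A γ ρbar (ρ t x))
          * partialDeriv i (fun y => u t y i) x := by
    intro i
    have e1 : ∀ y, (relFlowEnergy A γ ρbar (ρ t y) (u t y) + (A * ρ t y ^ γ - A * ρbar ^ γ))
        = 1 / 2 * (ρ t y * ∑ j, u t y j ^ 2)
          + (relEnergy A γ ρbar (ρ t y) + (A * ρ t y ^ γ - A * ρbar ^ γ)) := fun y => by
      rw [relFlowEnergy]; ring
    simp only [e1]
    have hM : DifferentiableAt ℝ (fun y => ρ t y * ∑ j, u t y j ^ 2) x := hρx.mul hSd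
    have hE : HasFDerivAt (fun y => 1 / 2 * (ρ t y * ∑ j, u t y j ^ 2)
          + (relEnergy A γ ρbar (ρ t y) + (A * ρ t y ^ γ - A * ρbar ^ γ)))
        ((1 / 2 : ℝ) • fderiv ℝ (fun y => ρ t y * ∑ j, u t y j ^ 2) x
          + (fderiv ℝ (fun y => relEnergy A γ ρbar (ρ t y)) x
            + fderiv ℝ (fun y => A * ρ t y ^ γ) x)) x :=
      (hM.hasFDerivAt.const_mul (1 / 2)).add
        (hHd.hasFDerivAt.add (hPd.hasFDerivAt.sub_const (A * ρbar ^ γ)))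
    rw [partialDeriv_mul hE.differentiableAt (hux i) i, hleg]
    have e2 : partialDeriv i (fun y => 1 / 2 * (ρ t y * ∑ j, u t y j ^ 2)
          + (relEnergy A γ ρbar (ρ t y) + (A * ρ t y ^ γ - A * ρbar ^ γ))) x
        = 1 / 2 * partialDeriv i (fun y => ρ t y * ∑ j, u t y j ^ 2) x
          + (partialDeriv i (fun y => relEnergy A γ ρbar (ρ t y)) x
            + partialDeriv i (fun y => A * ρ t y ^ γ) x) := by
      rw [partialDeriv, hE.fderiv]
      rfl
    rw [e2, partialDeriv_mul hρx hSd, hSxi,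
      partialDeriv_comp (hasDerivAt_relEnergy (A := A) (ρbar := ρbar) hγ (ρ t x)) hρx,
      partialDeriv_comp (hasDerivAt_pressure (A := A) hγ (ρ t x)) hρx]
    ring
  have hdot : ∑ j, u t x j * (ρ t x * deriv (fun s => u s x j) t
      + ∑ i, ρ t x * u t x i * partialDeriv i (fun y => u t y j) x
      + A * γ * ρ t x ^ (γ - 1) * partialDeriv j (ρ t) x
      + μ / (1 + t) * ρ t x * u t x j) = 0 :=
    Finset.sum_eq_zero fun j _ => by rw [hmom j, mul_zero]
  rw [het, Finset.sum_congr rfl fun i _ => hQ i]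
  set S := ∑ j, u t x j ^ 2 with hS
  set r := ρ t x
  set rt := deriv (fun s => ρ s x) t
  set H' := relEnthalpy A γ ρbar r
  set P' := A * γ * r ^ (γ - 1)
  set D := ∑ i, partialDeriv i (fun y => u t y i) x with hD
  set N := ∑ j, u t x j * deriv (fun s => u s x j) t with hN
  set G := ∑ i, partialDeriv i (ρ t) x * u t x i with hG
  set B := ∑ i, ∑ j, u t x i * u t x j * partialDeriv i (fun y => u t y j) x with hB
  have e1 : ∑ j, 2 * u t x j * deriv (fun s => u s x j) t = 2 * N := by
    rw [hN, Finset.mul_sum]; exact Finset.sum_congr rfl fun j _ => by ring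
  have e2 : rt + G + r * D = 0 := by
    rw [hG, hD, Finset.mul_sum, add_assoc, ← Finset.sum_add_distrib]; exact hmass
  have e3 : r * N + r * B + P' * G + μ / (1 + t) * r * S = 0 := by
    rw [← hdot, hB, Finset.sum_comm, hN, hG, hS, Finset.mul_sum, Finset.mul_sum, Finset.mul_sum,
      Finset.mul_sum, ← Finset.sum_add_distrib, ← Finset.sum_add_distrib,
      ← Finset.sum_add_distrib]
    refine Finset.sum_congr rfl fun j _ => ?_
    rw [mul_add, mul_add, mul_add, Finset.mul_sum, Finset.mul_sum]
    congr 1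
    · congr 1
      · congr 1
        · ring
        · exact Finset.sum_congr rfl fun i _ => by ring
      · ring
    · ring
  clear_value S
  have e4 : ∑ i, ((1 / 2 * (partialDeriv i (ρ t) x * S
            + r * ∑ j, 2 * u t x j * partialDeriv i (fun y => u t y j) x)
          + (H' + P') * partialDeriv i (ρ t) x) * u t x i
        + (1 / 2 * r * S + r * H') * partialDeriv i (fun y => u t y i) x)
      = (1 / 2 * S + H' + P') * G + r * B + (1 / 2 * r * S + r * H') * D := by
    rw [hG, hB, hD, Finset.mul_sum, Finset.mul_sum, Finset.mul_sum, ← Finset.sum_add_distrib,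
      ← Finset.sum_add_distrib]
    refine Finset.sum_congr rfl fun i _ => ?_
    congr 1
    have : ∑ j, u t x i * u t x j * partialDeriv i (fun y => u t y j) x
        = 1 / 2 * (∑ j, 2 * u t x j * partialDeriv i (fun y => u t y j) x) * u t x i := by
      rw [Finset.mul_sum, Finset.sum_mul]
      exact Finset.sum_congr rfl fun j _ => by ring
    rw [this]
    ring
  rw [e1, e4]
  linear_combination (1 / 2 * S + H') * e2 + e3

end Euler

/-! ### Finite speed of propagation -/

section Propagation

variable {n : ℕ} {σ L d : ℝ} {x₀ : 𝔼 n}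

/-- Positive inside a smoothed backward light cone with speed `σ` and base of radius about `L`
around `x₀`; the parameter `d > 0` rounds off the tip. -/
noncomputable def coneDepth (σ L d : ℝ) (x₀ : 𝔼 n) (t : ℝ) (x : 𝔼 n) : ℝ :=
  L - σ * t - √(d ^ 2 + ‖x - x₀‖ ^ 2)

theorem norm_le_coneRadius (d : ℝ) (x₀ x : 𝔼 n) : ‖x - x₀‖ ≤ √(d ^ 2 + ‖x - x₀‖ ^ 2) :=
  Real.le_sqrt_of_sq_le (by nlinarith [sq_nonneg d])

theorem coneRadius_pos (hd : 0 < d) (x₀ x : 𝔼 n) : 0 < √(d ^ 2 + ‖x - x₀‖ ^ 2) :=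
  Real.sqrt_pos.2 (by positivity)

theorem contDiff_coneDepth (hd : 0 < d) :
    ContDiff ℝ 1 (fun q : ℝ × 𝔼 n => coneDepth σ L d x₀ q.1 q.2) := by
  unfold coneDepth
  refine (contDiff_const.sub (contDiff_const.mul contDiff_fst)).sub (ContDiff.sqrt ?_ ?_)
  · exact contDiff_const.add ((contDiff_snd.sub contDiff_const).norm_sq ℝ)
  · intro q
    positivity

theorem hasDerivAt_coneDepth (t : ℝ) (x : 𝔼 n) :
    HasDerivAt (fun s => coneDepth σ L d x₀ s x) (-σ) t := by
  have := (((hasDerivAt_id t).const_mul σ).const_sub L).sub_const (√(d ^ 2 + ‖x - x₀‖ ^ 2))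
  exact this.congr_deriv (by simp)

theorem partialDeriv_coneDepth (hd : 0 < d) (t : ℝ) (x : 𝔼 n) (i : Fin n) :
    partialDeriv i (coneDepth σ L d x₀ t) x = -((x - x₀) i / √(d ^ 2 + ‖x - x₀‖ ^ 2)) := by
  have h1 : HasFDerivAt (fun y : 𝔼 n => d ^ 2 + ‖y - x₀‖ ^ 2) (2 • innerSL ℝ (x - x₀)) x := by
    have h := ((hasStrictFDerivAt_norm_sq (x - x₀)).hasFDerivAt.comp x
      ((hasFDerivAt_id x).sub_const x₀)).const_add (d ^ 2)
    exact h.congr_fderiv (by ext; simp)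
  have h2 := (h1.sqrt (by positivity)).const_sub (L - σ * t)
  have h3 : HasFDerivAt (coneDepth σ L d x₀ t) _ x := h2
  rw [partialDeriv, h3.fderiv]
  simp [EuclideanSpace.inner_single_right]
  field_simp

theorem mem_closedBall_of_coneDepth_nonneg (hσ : 0 ≤ σ) {t : ℝ} (ht : 0 ≤ t) {x : 𝔼 n}
    (hz : 0 ≤ coneDepth σ L d x₀ t x) : x ∈ Metric.closedBall x₀ L := by
  rw [mem_closedBall_iff_norm]
  have := norm_le_coneRadius d x₀ x
  unfold coneDepth at hz
  nlinarith [mul_nonneg hσ ht]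

theorem deriv_expNegInvGlue_of_nonpos {z : ℝ} (hz : z ≤ 0) : deriv expNegInvGlue z = 0 := by
  refine IsLocalMin.deriv_eq_zero (Eventually.of_forall fun y => ?_)
  rw [expNegInvGlue.zero_of_nonpos hz]
  exact expNegInvGlue.nonneg y

theorem hasDerivAt_expNegInvGlue (z : ℝ) :
    HasDerivAt expNegInvGlue (deriv expNegInvGlue z) z :=
  ((expNegInvGlue.contDiff (n := 1)).differentiable (by simp) z).hasDerivAt

variable {A γ μ ρbar ε T : ℝ} {ρ₀ : 𝔼 n → ℝ} {u₀ : 𝔼 n → 𝔼 n} {ρ : ℝ → 𝔼 n → ℝ}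
  {u : ℝ → 𝔼 n → 𝔼 n}

theorem IsEulerSolution.contDiffOn_energy
    (h : IsEulerSolution A γ 1 μ ρbar ε ρ₀ u₀ (ENNReal.ofReal T) ρ u) (hγ : 1 < γ) :
    ContDiffOn ℝ 1 (fun q : ℝ × 𝔼 n => relFlowEnergy A γ ρbar (ρ q.1 q.2) (u q.1 q.2))
      (Ico 0 T ×ˢ univ) := by
  unfold relFlowEnergy
  exact ((contDiffOn_const.mul h.density).mul
    (ContDiffOn.sum fun j _ => (h.velocity_apply j).pow 2)).add
    ((contDiff_relEnergy hγ).comp_contDiffOn h.density)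

theorem IsEulerSolution.contDiffOn_pressure
    (h : IsEulerSolution A γ 1 μ ρbar ε ρ₀ u₀ (ENNReal.ofReal T) ρ u) (hγ : 1 < γ) :
    ContDiffOn ℝ 1 (fun q : ℝ × 𝔼 n => A * ρ q.1 q.2 ^ γ) (Ico 0 T ×ˢ univ) :=
  (contDiff_pressure hγ).comp_contDiffOn h.density

/-- The energy flux through the boundary of a cone of speed `σ` is outgoing: as long as the flow
in the cone is so close to the constant state that `|flux| ≤ σ · energy`, it stays constant. -/
theorem IsEulerSolution.eq_const_in_cone
    (h : IsEulerSolution A γ 1 μ ρbar ε ρ₀ u₀ (ENNReal.ofReal T) ρ u) (hγ : 1 < γ)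
    (hμ : 0 ≤ μ) (hρbar : 0 < ρbar) (hσ : 0 ≤ σ) (hd : 0 < d) {η : ℝ}
    (hη : ∀ r v : ℝ, |r - ρbar| < η → 0 ≤ v → v < η →
      0 < r ∧ 0 ≤ 1 / 2 * r * v ^ 2 + relEnergy A γ ρbar r ∧
      |1 / 2 * r * v ^ 2 + relEnergy A γ ρbar r + (A * r ^ γ - A * ρbar ^ γ)| * v
        ≤ σ * (1 / 2 * r * v ^ 2 + relEnergy A γ ρbar r) ∧
      (1 / 2 * r * v ^ 2 + relEnergy A γ ρbar r = 0 → r = ρbar ∧ v = 0))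
    {t₁ : ℝ} (ht₁ : t₁ ≤ T)
    (hinit : ∀ x ∈ Metric.closedBall x₀ L, ρ 0 x = ρbar ∧ u 0 x = 0)
    (hnear : ∀ t ∈ Ico 0 t₁, ∀ x, 0 ≤ coneDepth σ L d x₀ t x →
      |ρ t x - ρbar| < η ∧ ‖u t x‖ < η) :
    ∀ t ∈ Ico 0 t₁, ∀ x, 0 < coneDepth σ L d x₀ t x → ρ t x = ρbar ∧ u t x = 0 := by
  set z := coneDepth σ L d x₀ with hz
  set e : ℝ → 𝔼 n → ℝ := fun t x => relFlowEnergy A γ ρbar (ρ t x) (u t x) with he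
  set F : ℝ → 𝔼 n → ℝ := fun t x => e t x * expNegInvGlue (z t x) with hF
  have hnear' : ∀ t ∈ Ico 0 t₁, ∀ x, 0 ≤ z t x → 0 < ρ t x ∧ 0 ≤ e t x ∧
      |e t x + (A * ρ t x ^ γ - A * ρbar ^ γ)| * ‖u t x‖ ≤ σ * e t x ∧
      (e t x = 0 → ρ t x = ρbar ∧ u t x = 0) := by
    intro t ht x hzx
    have h1 := hnear t ht x hzx
    have h2 := hη (ρ t x) ‖u t x‖ h1.1 (norm_nonneg _) h1.2
    rw [EuclideanSpace.real_norm_sq_eq] at h2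
    exact ⟨h2.1, h2.2.1, h2.2.2.1, fun h0 => by simpa using h2.2.2.2 h0⟩
  have hχ : ContDiff ℝ 1 (fun q : ℝ × 𝔼 n => expNegInvGlue (z q.1 q.2)) :=
    (expNegInvGlue.contDiff (n := 1)).comp (contDiff_coneDepth hd)
  have hec : ContDiffOn ℝ 1 (fun q : ℝ × 𝔼 n => e q.1 q.2) (Ico 0 T ×ˢ univ) :=
    h.contDiffOn_energy hγ
  have hFc : ContDiffOn ℝ 1 (fun q : ℝ × 𝔼 n => F q.1 q.2) (Ico 0 T ×ˢ univ) :=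
    hec.mul hχ.contDiffOn
  have hχsupp : ∀ t, 0 ≤ t → ∀ x ∉ Metric.closedBall x₀ L, expNegInvGlue (z t x) = 0 := by
    intro t ht x hx
    refine expNegInvGlue.zero_of_nonpos (le_of_lt (not_le.1 fun hcon => hx ?_))
    exact mem_closedBall_of_coneDepth_nonneg hσ ht hcon
  have hFsupp : ∀ t ∈ Ico 0 T, ∀ x ∉ Metric.closedBall x₀ L, F t x = 0 := fun t ht x hx => by
    simp only [hF, hχsupp t ht.1 x hx, mul_zero]
  have hK : IsCompact (Metric.closedBall x₀ L) := isCompact_closedBall x₀ L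
  have hFnonneg : ∀ t ∈ Ico 0 t₁, ∀ x, 0 ≤ F t x := by
    intro t ht x
    rcases le_total 0 (z t x) with hzx | hzx
    · exact mul_nonneg (hnear' t ht x hzx).2.1 (expNegInvGlue.nonneg _)
    · simp only [hF, expNegInvGlue.zero_of_nonpos hzx, mul_zero, le_refl]
  set I : ℝ → ℝ := fun t => ∫ x, F t x with hI
  have hIc : ContinuousOn I (Ico 0 T) :=
    continuousOn_integral_of_compact_support hK hFc.continuousOn
      fun t x ht hx => hFsupp t ht x hx
  have hI0 : I 0 = 0 := by
    refine integral_eq_zero_of_ae (Eventually.of_forall fun x => ?_)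
    by_cases hx : x ∈ Metric.closedBall x₀ L
    · simp [hF, he, relFlowEnergy, hinit x hx]
    · simp only [hF, hχsupp 0 le_rfl x hx, mul_zero, Pi.zero_apply]
  have hId : ∀ t ∈ Ioo 0 t₁, ∃ I', HasDerivAt I I' t ∧ I' ≤ 0 := by
    intro t ht
    have htT : t ∈ Ioo 0 T := ⟨ht.1, ht.2.trans_le ht₁⟩
    have htI : t ∈ Ico 0 T := Ioo_subset_Ico_self htT
    obtain ⟨hint, hder⟩ := hasDerivAt_integral_of_contDiffOn (F := F) (a := 0) (b := T)
      (hFc.mono (prod_mono Ioo_subset_Ico_self subset_rfl)) hK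
      (fun t ht x hx => hFsupp t (Ioo_subset_Ico_self ht) x hx) htT
    refine ⟨_, hder, ?_⟩
    set χ : 𝔼 n → ℝ := fun x => expNegInvGlue (z t x) with hχdef
    have hχt : ContDiff ℝ 1 χ := hχ.comp (f := fun x : 𝔼 n => (t, x)) (by fun_prop)
    have hχs : HasCompactSupport χ := .intro hK fun x hx => hχsupp t ht.1.le x hx
    set Q : Fin n → 𝔼 n → ℝ := fun i y =>
      (e t y + (A * ρ t y ^ γ - A * ρbar ^ γ)) * u t y i with hQ
    have hQc : ∀ i, ContDiff ℝ 1 (Q i) := fun i =>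
      ((contDiff_slice hec htI).add ((contDiff_slice (F := fun t y => A * ρ t y ^ γ)
        (h.contDiffOn_pressure hγ) htI).sub contDiff_const)).mul
        (contDiff_slice (F := fun t y => u t y i) (h.velocity_apply i) htI)
    -- the divergence of `χ Q` has zero integral
    have hint₁ : ∀ i, Integrable fun x => χ x * partialDeriv i (Q i) x := fun i =>
      (hχt.continuous.mul ((hQc i).continuous_partialDeriv i)).integrable_of_hasCompactSupport
        hχs.mul_right
    have hint₂ : ∀ i, Integrable fun x => partialDeriv i χ x * Q i x := fun i =>
      ((hχt.continuous_partialDeriv i).mul (hQc i).continuous).integrable_of_hasCompactSupport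
        (hχs.partialDeriv i).mul_right
    have hdivint : ∀ i, Integrable fun x =>
        χ x * partialDeriv i (Q i) x + partialDeriv i χ x * Q i x := fun i =>
      (hint₁ i).add (hint₂ i)
    have hdiv : ∫ x, ∑ i, (χ x * partialDeriv i (Q i) x + partialDeriv i χ x * Q i x) = 0 := by
      rw [integral_finsetSum _ fun i _ => hdivint i]
      refine Finset.sum_eq_zero fun i _ => ?_
      rw [integral_add (hint₁ i) (hint₂ i), integral_mul_partialDeriv hχt (hQc i) hχs i,
        neg_add_cancel]
    have hsum := integral_add hint (integrable_finsetSum Finset.univ fun i _ => hdivint i)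
    rw [hdiv, add_zero] at hsum
    rw [← hsum]
    refine integral_nonpos fun x => ?_
    -- pointwise: energy balance inside the cone, everything vanishes outside
    have hzd := hasDerivAt_coneDepth (σ := σ) (L := L) (d := d) (x₀ := x₀) t x
    have hχd : HasDerivAt (fun s => expNegInvGlue (z s x)) (deriv expNegInvGlue (z t x) * (-σ)) t :=
      HasDerivAt.comp (h₂ := expNegInvGlue) t (hasDerivAt_expNegInvGlue (z t x)) hzd
    have hed : HasDerivAt (fun s => e s x) (deriv (fun s => e s x) t) t :=
      (differentiableAt_time hec htT x).hasDerivAt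
    have hFd : deriv (fun s => F s x) t = deriv (fun s => e s x) t * χ x
        + e t x * (deriv expNegInvGlue (z t x) * (-σ)) := (hed.mul hχd).deriv
    have hzx : DifferentiableAt ℝ (z t) x :=
      ((contDiff_coneDepth hd).comp (f := fun x : 𝔼 n => (t, x)) (by fun_prop)).differentiable
        one_ne_zero x
    have hχx : ∀ i, partialDeriv i χ x
        = deriv expNegInvGlue (z t x) * -((x - x₀) i / √(d ^ 2 + ‖x - x₀‖ ^ 2)) := fun i => by
      rw [hχdef, partialDeriv_comp (hasDerivAt_expNegInvGlue (z t x)) hzx,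
        partialDeriv_coneDepth hd]
    simp only [hFd, hχx, Pi.zero_apply]
    rcases le_or_gt (z t x) 0 with hneg | hpos
    · simp [hχdef, deriv_expNegInvGlue_of_nonpos hneg, expNegInvGlue.zero_of_nonpos hneg]
    · obtain ⟨hρpos, he0, hflux, -⟩ := hnear' t (Ioo_subset_Ico_self ht) x hpos.le
      have hen := h.energy_eq hγ hρbar htT hρpos
      have hθ : 0 ≤ deriv expNegInvGlue (z t x) := expNegInvGlue.monotone.deriv_nonneg
      have hχ0 : 0 ≤ χ x := expNegInvGlue.nonneg _
      set θ' := deriv expNegInvGlue (z t x)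
      set w := √(d ^ 2 + ‖x - x₀‖ ^ 2) with hw
      have hwpos : 0 < w := coneRadius_pos hd x₀ x
      set q := e t x + (A * ρ t x ^ γ - A * ρbar ^ γ) with hq
      have hinner : |∑ i, (x - x₀) i / w * u t x i| ≤ ‖u t x‖ := by
        have e1 : ∑ i, (x - x₀) i / w * u t x i = inner ℝ (x - x₀) (u t x) / w := by
          rw [PiLp.inner_apply, Finset.sum_div]
          refine Finset.sum_congr rfl fun i _ => ?_
          simp only [RCLike.inner_apply, conj_trivial]
          ring
        rw [e1, abs_div, abs_of_pos hwpos, div_le_iff₀ hwpos]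
        calc |inner ℝ (x - x₀) (u t x)| ≤ ‖x - x₀‖ * ‖u t x‖ := abs_real_inner_le_norm _ _
          _ ≤ w * ‖u t x‖ := mul_le_mul_of_nonneg_right (norm_le_coneRadius d x₀ x) (norm_nonneg _)
          _ = _ := mul_comm _ _
      have hsumeq : ∑ i, (χ x * partialDeriv i (Q i) x + θ' * -((x - x₀) i / w) * Q i x)
          = χ x * ∑ i, partialDeriv i (Q i) x - θ' * (q * ∑ i, (x - x₀) i / w * u t x i) := by
        have e2 : ∑ i, θ' * -((x - x₀) i / w) * Q i x
            = -(θ' * (q * ∑ i, (x - x₀) i / w * u t x i)) := by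
          rw [Finset.mul_sum, Finset.mul_sum, ← Finset.sum_neg_distrib]
          exact Finset.sum_congr rfl fun i _ => by simp only [hQ]; ring
        rw [Finset.sum_add_distrib, ← Finset.mul_sum, e2]
        exact (sub_eq_add_neg _ _).symm
      rw [hsumeq]
      have hqb : -(q * ∑ i, (x - x₀) i / w * u t x i) ≤ σ * e t x :=
        (neg_le_abs _).trans (by
          rw [abs_mul]
          exact (mul_le_mul_of_nonneg_left hinner (abs_nonneg _)).trans hflux)
      have h1 := mul_le_mul_of_nonneg_left hqb hθ
      have hν : 0 ≤ μ / (1 + t) * ρ t x * ∑ j, u t x j ^ 2 := by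
        have : 0 < 1 + t := by linarith [ht.1]
        positivity
      have h2 : χ x * (deriv (fun s => e s x) t + ∑ i, partialDeriv i (Q i) x) ≤ 0 := by
        rw [hen]
        exact mul_nonpos_of_nonneg_of_nonpos hχ0 (by linarith)
      linarith
  intro t ht x hzx
  have hIt : I t ≤ 0 := by
    rw [← hI0]
    have hanti : AntitoneOn I (Icc 0 t) := by
      refine antitoneOn_of_deriv_nonpos (convex_Icc 0 t)
        (hIc.mono fun s hs => ⟨hs.1, (hs.2.trans_lt ht.2).trans_le ht₁⟩) ?_ ?_
      all_goals
        rw [interior_Icc]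
        intro s hs
        obtain ⟨I', hI', hle⟩ := hId s ⟨hs.1, hs.2.trans ht.2⟩
      · exact hI'.differentiableAt.differentiableWithinAt
      · rw [hI'.deriv]; exact hle
    exact hanti ⟨le_rfl, ht.1⟩ ⟨ht.1, le_rfl⟩ ht.1
  have htT : t ∈ Ico 0 T := ⟨ht.1, ht.2.trans_le ht₁⟩
  have hFt : Continuous (F t) := (contDiff_slice hFc htT).continuous
  have hFint : Integrable (F t) := hFt.integrable_of_hasCompactSupport
    (.intro hK fun x hx => hFsupp t htT x hx)
  have hzero : F t =ᵐ[volume] 0 := (integral_eq_zero_iff_of_nonneg (hFnonneg t ht) hFint).1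
    (le_antisymm hIt (integral_nonneg (hFnonneg t ht)))
  have hzero' : F t = 0 := Continuous.ae_eq_iff_eq volume hFt continuous_zero |>.1 hzero
  have hFx := congrFun hzero' x
  have hχpos := expNegInvGlue.pos_of_pos hzx
  refine (hnear' t ht x hzx.le).2.2.2 ?_
  simpa [hF, hχpos.ne'] using hFx

end Propagation

section Consequences

variable {n : ℕ} {A γ μ ρbar ε T R : ℝ} {ρ₀ : 𝔼 n → ℝ} {u₀ : 𝔼 n → 𝔼 n} {ρ : ℝ → 𝔼 n → ℝ}
  {u : ℝ → 𝔼 n → 𝔼 n}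

/-- Finite speed of propagation. No bound on the solution at infinity is needed: the cone is
compact, and at the first time at which the flow in the cone leaves the neighbourhood of the
constant state in which `exists_flux_le_energy` holds, it would still be constant. -/
theorem IsEulerSolution.eq_const_of_lt_norm
    (h : IsEulerSolution A γ 1 μ ρbar ε ρ₀ u₀ (ENNReal.ofReal T) ρ u) (hγ : 1 < γ)
    (hA : 0 < A) (hμ : 0 ≤ μ) (hρbar : 0 < ρbar)
    (hinit : ∀ x, R < ‖x‖ → ρ 0 x = ρbar ∧ u 0 x = 0) {t : ℝ} (ht : t ∈ Ico 0 T) {x : 𝔼 n}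
    (hx : R + soundSpeed A γ ρbar * t < ‖x‖) : ρ t x = ρbar ∧ u t x = 0 := by
  rcases eq_or_lt_of_le ht.1 with rfl | htpos
  · exact hinit x (by simpa using hx)
  have hc := soundSpeed_pos hγ hA hρbar
  obtain ⟨σ, hcσ, hσx⟩ : ∃ σ, soundSpeed A γ ρbar < σ ∧ σ < (‖x‖ - R) / t :=
    exists_between (by rw [lt_div_iff₀ htpos]; linarith)
  rw [lt_div_iff₀ htpos] at hσx
  have hσ : 0 < σ := hc.trans hcσ
  obtain ⟨L, hL1, hL2⟩ := exists_between hσx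
  obtain ⟨d, hd, hdL⟩ : ∃ d, 0 < d ∧ d < L - σ * t := exists_between (by linarith)
  obtain ⟨η, hη, hflux⟩ := exists_flux_le_energy hγ hA hρbar hcσ
  set z := coneDepth σ L d x with hz
  set dev : ℝ → 𝔼 n → ℝ := fun s y => max |ρ s y - ρbar| ‖u s y‖ with hdev
  have hdev0 : ∀ s y, dev s y ≤ 0 → ρ s y = ρbar ∧ u s y = 0 := by
    intro s y hle
    have h1 : |ρ s y - ρbar| ≤ 0 := (le_max_left _ _).trans hle
    have h2 : ‖u s y‖ ≤ 0 := (le_max_right _ _).trans hle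
    exact ⟨by linarith [abs_nonpos_iff.1 h1], norm_le_zero_iff.1 h2⟩
  have hdevc : ContinuousOn (fun q : ℝ × 𝔼 n => dev q.1 q.2) (Ico 0 T ×ˢ univ) :=
    (h.density.continuousOn.sub continuousOn_const).abs.sup h.velocity.continuousOn.norm
  have hball : ∀ y ∈ Metric.closedBall x L, ρ 0 y = ρbar ∧ u 0 y = 0 := by
    intro y hy
    refine hinit y ?_
    rw [mem_closedBall_iff_norm'] at hy
    have := norm_sub_norm_le x y
    linarith
  -- if the flow is near the constant state before `t'`, it is constant up to `t'`
  have hcl : ∀ t' ∈ Ioc 0 t, (∀ s ∈ Ico 0 t', ∀ y, 0 ≤ z s y → dev s y < η) →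
      ∀ y, 0 ≤ z t' y → dev t' y ≤ 0 := by
    intro t' ht' hnear y hy
    have hconst := h.eq_const_in_cone hγ hμ hρbar hσ.le hd hflux (ht'.2.trans ht.2.le) hball
      (fun s hs y hy => max_lt_iff.1 (hnear s hs y hy))
    have hclos : closure (Ico 0 t') = Icc 0 t' := closure_Ico ht'.1.ne
    refine le_on_closure (s := Ico 0 t') (f := fun s => dev s y) (g := fun _ => 0) ?_ ?_
      continuousOn_const (by rw [hclos]; exact ⟨ht'.1.le, le_rfl⟩)
    · intro s hs
      have hzs : 0 < z s y := by
        have : σ * s < σ * t' := mul_lt_mul_of_pos_left hs.2 hσ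
        simp only [hz, coneDepth] at hy ⊢
        linarith
      obtain ⟨h1, h2⟩ := hconst s hs y hzs
      simp [hdev, h1, h2]
    · rw [hclos]
      refine hdevc.comp (f := fun s => (s, y)) (by fun_prop) fun s hs => ?_
      exact ⟨⟨hs.1, (hs.2.trans ht'.2).trans_lt ht.2⟩, mem_univ _⟩
  have hzc : Continuous fun q : ℝ × 𝔼 n => z q.1 q.2 := (contDiff_coneDepth hd).continuous
  have hnear : ∀ s ∈ Icc 0 t, ∀ y, 0 ≤ z s y → dev s y < η := by
    by_contra! hcon
    obtain ⟨s, hs, y, hzy, hdy⟩ := hcon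
    obtain ⟨t', ht', y', hy', h0, hbefore, -⟩ := exists_first_zero
      (isCompact_closedBall x L) (a := 0) (b := t)
      (d := fun s y => max (η - dev s y) (-z s y))
      ((continuousOn_const.sub (hdevc.mono (prod_mono
        (fun s hs => ⟨hs.1, hs.2.trans_lt ht.2⟩) (subset_univ _)))).sup hzc.neg.continuousOn)
      (fun y hy => by
        obtain ⟨h1, h2⟩ := hball y hy
        refine lt_max_of_lt_left ?_
        simpa [hdev, h1, h2] using hη)
      ⟨s, hs, y, mem_closedBall_of_coneDepth_nonneg hσ.le hs.1 hzy,
        max_le (by linarith) (by linarith)⟩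
    have h1 : η - dev t' y' ≤ 0 := (le_max_left _ _).trans h0.le
    have h2 : -z t' y' ≤ 0 := (le_max_right _ _).trans h0.le
    have h3 := hcl t' ht' (fun s hs w hw => by
      have := hbefore s hs w (mem_closedBall_of_coneDepth_nonneg hσ.le hs.1 hw)
      rcases lt_max_iff.1 this with h | h
      · linarith
      · linarith) y' (by linarith)
    linarith
  refine hdev0 t x (hcl t ⟨htpos, le_rfl⟩ (fun s hs => hnear s ⟨hs.1, hs.2.le⟩) x ?_)
  simp only [hz, coneDepth, sub_self, norm_zero, ne_eq, OfNat.ofNat_ne_zero, not_false_eq_true,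
    zero_pow, add_zero, Real.sqrt_sq hd.le]
  linarith

/-- The density stays positive, with the barrier `c₀ e^{-(M + 1) t}`, where `M` is a bound for the
divergence of `u`: where `ρ` first touches the barrier its gradient vanishes, and by the equation
of mass it decreases more slowly than the barrier. -/
theorem IsEulerSolution.density_pos
    (h : IsEulerSolution A γ 1 μ ρbar ε ρ₀ u₀ (ENNReal.ofReal T) ρ u) (hγ : 1 < γ)
    (hA : 0 < A) (hμ : 0 ≤ μ) (hρbar : 0 < ρbar)
    (hinit : ∀ x, R < ‖x‖ → ρ 0 x = ρbar ∧ u 0 x = 0) (hpos : ∀ x, 0 < ρ 0 x) {t : ℝ}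
    (ht : t ∈ Ico 0 T) (x : 𝔼 n) : 0 < ρ t x := by
  by_contra hcon
  have hc := soundSpeed_pos hγ hA hρbar
  set K := Metric.closedBall (0 : 𝔼 n) (R + soundSpeed A γ ρbar * t) with hK
  have hKc : IsCompact K := isCompact_closedBall _ _
  have hout : ∀ s ∈ Icc 0 t, ∀ y ∉ K, ρ s y = ρbar := by
    intro s hs y hy
    refine (h.eq_const_of_lt_norm hγ hA hμ hρbar hinit ⟨hs.1, hs.2.trans_lt ht.2⟩ ?_).1
    rw [hK, mem_closedBall_zero_iff, not_le] at hy
    exact lt_of_le_of_lt (by gcongr; exact hs.2) hy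
  have hxK : x ∈ K := by
    by_contra hx
    rw [hout t ⟨ht.1, le_rfl⟩ x hx] at hcon
    exact hcon hρbar
  have hsub : Icc 0 t ⊆ Ico 0 T := fun s hs => ⟨hs.1, hs.2.trans_lt ht.2⟩
  have hT : 0 < T := ht.1.trans_lt ht.2
  have hud : UniqueDiffOn ℝ (Ico 0 T ×ˢ (univ : Set (𝔼 n))) :=
    (uniqueDiffOn_Ico 0 T).prod uniqueDiffOn_univ
  -- the divergence of the velocity is bounded on the compact set, up to the initial time
  obtain ⟨M, hM0, hM⟩ : ∃ M, 0 ≤ M ∧ ∀ s ∈ Ioc 0 t, ∀ y ∈ K,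
      ∑ i, partialDeriv i (fun w => u s w i) y ≤ M := by
    have hcont : ContinuousOn (fun q : ℝ × 𝔼 n => ∑ i, fderivWithin ℝ
        (fun q : ℝ × 𝔼 n => u q.1 q.2 i) (Ico 0 T ×ˢ univ) q (0, EuclideanSpace.single i 1))
        (Icc 0 t ×ˢ K) :=
      (continuousOn_finsetSum _ fun i _ => (((h.velocity_apply i).continuousOn_fderivWithin hud
        le_rfl).clm_apply continuousOn_const)).mono (prod_mono hsub (subset_univ K))
    obtain ⟨M, hM⟩ := (isCompact_Icc.prod hKc).exists_bound_of_continuousOn hcont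
    refine ⟨max M 0, le_max_right _ _, fun s hs y hy => le_trans ?_ (le_max_left _ _)⟩
    have h1 := (le_abs_self _).trans (hM (s, y) ⟨⟨hs.1.le, hs.2⟩, hy⟩)
    refine le_trans (le_of_eq (Finset.sum_congr rfl fun i _ => ?_)) h1
    have hsT : s ∈ Ioo 0 T := ⟨hs.1, hs.2.trans_lt ht.2⟩
    rw [fderivWithin_of_mem_nhds (prod_mem_nhds (Ico_mem_nhds hsT.1 hsT.2) univ_mem)]
    have hd := ((contDiffAt_of_strip (F := fun t x => u t x i) (h.velocity_apply i) hsT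
      y).differentiableAt one_ne_zero).hasFDerivAt
    have hd' := hd.comp y ((hasFDerivAt_const s y).prodMk (hasFDerivAt_id y))
    have hd'' : HasFDerivAt (fun w => u s w i) _ y := hd'
    rw [partialDeriv, hd''.fderiv]
    simp
  obtain ⟨x₁, hx₁, hmin⟩ := hKc.exists_isMinOn ⟨x, hxK⟩
    (f := ρ 0) (contDiff_slice h.density ⟨le_rfl, hT⟩).continuous.continuousOn
  set c₀ := min (ρ 0 x₁) ρbar / 2 with hc₀
  have hc₀pos : 0 < c₀ := by have := hpos x₁; positivity
  have hc₀ρ : c₀ < ρbar := by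
    have := min_le_right (ρ 0 x₁) ρbar
    linarith
  obtain ⟨s, hs, y, hy, h0, hbefore, hafter⟩ := exists_first_zero hKc (a := 0) (b := t)
    (d := fun s y => ρ s y - c₀ * Real.exp (-((M + 1) * s)))
    ((h.density.continuousOn.mono (prod_mono hsub (subset_univ K))).sub
      (Continuous.continuousOn (by fun_prop)))
    (fun y hy => by
      have h1 : ρ 0 x₁ ≤ ρ 0 y := hmin hy
      have h2 := min_le_left (ρ 0 x₁) ρbar
      have h3 := hpos x₁
      simp only [mul_zero, neg_zero, Real.exp_zero, mul_one]
      linarith)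
    ⟨t, ⟨ht.1, le_rfl⟩, x, hxK, by
      have := Real.exp_pos (-((M + 1) * t))
      have : 0 < c₀ * Real.exp (-((M + 1) * t)) := by positivity
      linarith⟩
  have hsT : s ∈ Ioo 0 T := ⟨hs.1, hs.2.trans_lt ht.2⟩
  have hE : 0 < Real.exp (-((M + 1) * s)) := Real.exp_pos _
  have hE1 : Real.exp (-((M + 1) * s)) ≤ 1 :=
    Real.exp_le_one_iff.2 (by nlinarith [hs.1])
  have hρy : ρ s y = c₀ * Real.exp (-((M + 1) * s)) := sub_eq_zero.1 h0
  have hglob : IsLocalMin (ρ s) y := Eventually.of_forall fun w => by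
    by_cases hw : w ∈ K
    · linarith [hafter w hw]
    · rw [hout s ⟨hs.1.le, hs.2⟩ w hw, hρy]
      nlinarith
  have hgrad : ∀ i, partialDeriv i (ρ s) y = 0 := fun i => by
    rw [partialDeriv, hglob.fderiv_eq_zero]; rfl
  have hmass := h.mass_eq hsT y
  simp only [hgrad, zero_mul, zero_add, ← Finset.mul_sum] at hmass
  have hρd := (differentiableAt_time h.density hsT y).hasDerivAt
  have hexp : HasDerivAt (fun s : ℝ => c₀ * Real.exp (-((M + 1) * s)))
      (c₀ * (Real.exp (-((M + 1) * s)) * -(M + 1))) s := by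
    simpa using (((hasDerivAt_id s).const_mul (M + 1)).fun_neg.exp).const_mul c₀
  have hle := hasDerivAt_nonpos_of_first_zero hs.1 (hρd.sub hexp) h0 fun r hr => hbefore r hr y hy
  have hD := hM s hs y hy
  have hρpos : 0 < ρ s y := by rw [hρy]; positivity
  nlinarith [mul_le_mul_of_nonneg_left hD hρpos.le]

end Consequences

/-! ### Superpositions of plane waves -/

section PlaneWaves

variable {n : ℕ}

/-- The superposition `∫ w(σ) e^{x · σ} dν(σ)` of exponential plane waves over the unit sphere. The
function `φ` of the theorem and its derivatives up to second order are of this form. -/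
noncomputable def waveMean (ν : Measure (Metric.sphere (0 : 𝔼 n) 1))
    (w : Metric.sphere (0 : 𝔼 n) 1 → ℝ) (x : 𝔼 n) : ℝ :=
  ∫ σ, w σ * Real.exp (inner ℝ x (σ : 𝔼 n)) ∂ν

variable {ν : Measure (Metric.sphere (0 : 𝔼 n) 1)} [IsFiniteMeasure ν]
  {w : Metric.sphere (0 : 𝔼 n) 1 → ℝ}

theorem integrable_wave (hw : Continuous w) (x : 𝔼 n) :
    Integrable (fun σ => w σ * Real.exp (inner ℝ x (σ : 𝔼 n))) ν := by
  have hc : Continuous fun σ : Metric.sphere (0 : 𝔼 n) 1 =>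
      w σ * Real.exp (inner ℝ x (σ : 𝔼 n)) := by fun_prop
  exact hc.integrable_of_hasCompactSupport (HasCompactSupport.of_compactSpace _)

theorem continuous_waveMean (hw : Continuous w) : Continuous (waveMean ν w) := by
  have h := continuous_parametric_integral_of_continuous (μ := ν) (s := univ)
    (f := fun (x : 𝔼 n) (σ : Metric.sphere (0 : 𝔼 n) 1) => w σ * Real.exp (inner ℝ x (σ : 𝔼 n)))
    (by unfold Function.uncurry; fun_prop) isCompact_univ
  simp only [Measure.restrict_univ] at h
  exact h

theorem hasFDerivAt_waveMean (hw : Continuous w) (x : 𝔼 n) :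
    HasFDerivAt (waveMean ν w)
      (∫ σ, (w σ * Real.exp (inner ℝ x (σ : 𝔼 n))) • innerSL ℝ (σ : 𝔼 n) ∂ν) x := by
  obtain ⟨C, hC⟩ := isCompact_univ.exists_bound_of_continuousOn hw.continuousOn
  have hmeas : ∀ y : 𝔼 n, Continuous fun σ : Metric.sphere (0 : 𝔼 n) 1 =>
      w σ * Real.exp (inner ℝ y (σ : 𝔼 n)) := fun y => by fun_prop
  refine hasFDerivAt_integral_of_dominated_of_fderiv_le (s := Metric.ball x 1)
    (bound := fun _ => C * Real.exp (‖x‖ + 1)) (Metric.ball_mem_nhds x one_pos)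
    (Eventually.of_forall fun y => (hmeas y).aestronglyMeasurable) (integrable_wave hw x)
    (F' := fun y σ => (w σ * Real.exp (inner ℝ y (σ : 𝔼 n))) • innerSL ℝ (σ : 𝔼 n)) ?_ ?_
    (integrable_const _) ?_
  · have : Continuous fun σ : Metric.sphere (0 : 𝔼 n) 1 =>
        (w σ * Real.exp (inner ℝ x (σ : 𝔼 n))) • innerSL ℝ (σ : 𝔼 n) :=
      (hmeas x).smul ((innerSL ℝ (E := 𝔼 n)).continuous.comp continuous_subtype_val)
    exact this.aestronglyMeasurable
  · refine Eventually.of_forall fun σ y hy => ?_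
    have hσ : ‖(σ : 𝔼 n)‖ = 1 := by simp
    rw [norm_smul, innerSL_apply_norm, hσ, mul_one, norm_mul, Real.norm_eq_abs (Real.exp _),
      Real.abs_exp]
    refine mul_le_mul (hC σ (mem_univ _)) (Real.exp_le_exp.2 ?_) (Real.exp_pos _).le
      ((norm_nonneg _).trans (hC σ (mem_univ _)))
    have h1 : inner ℝ y (σ : 𝔼 n) ≤ ‖y‖ * ‖(σ : 𝔼 n)‖ := real_inner_le_norm _ _
    rw [hσ, mul_one] at h1
    have h2 : ‖y‖ ≤ ‖x‖ + ‖y - x‖ := by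
      have := norm_add_le x (y - x)
      rwa [add_sub_cancel] at this
    have h3 : ‖y - x‖ < 1 := mem_ball_iff_norm.1 hy
    linarith
  · refine Eventually.of_forall fun σ y _ => ?_
    have h1 : HasFDerivAt (fun y : 𝔼 n => inner ℝ y (σ : 𝔼 n)) (innerSL ℝ (σ : 𝔼 n)) y := by
      have := (innerSL ℝ (σ : 𝔼 n)).hasFDerivAt (x := y)
      refine this.congr_of_eventuallyEq (Eventually.of_forall fun z => ?_)
      simp [real_inner_comm]
    refine (h1.exp.const_mul (w σ)).congr_fderiv ?_
    rw [smul_smul]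

theorem partialDeriv_waveMean (hw : Continuous w) (i : Fin n) :
    partialDeriv i (waveMean ν w) = waveMean ν fun σ => w σ * (σ : 𝔼 n) i := by
  funext x
  have hint : Integrable (fun σ : Metric.sphere (0 : 𝔼 n) 1 =>
      (w σ * Real.exp (inner ℝ x (σ : 𝔼 n))) • innerSL ℝ (σ : 𝔼 n)) ν := by
    have : Continuous fun σ : Metric.sphere (0 : 𝔼 n) 1 =>
        (w σ * Real.exp (inner ℝ x (σ : 𝔼 n))) • innerSL ℝ (σ : 𝔼 n) :=
      (by fun_prop : Continuous fun σ : Metric.sphere (0 : 𝔼 n) 1 =>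
        w σ * Real.exp (inner ℝ x (σ : 𝔼 n))).smul
        ((innerSL ℝ (E := 𝔼 n)).continuous.comp continuous_subtype_val)
    exact this.integrable_of_hasCompactSupport (HasCompactSupport.of_compactSpace _)
  rw [partialDeriv, (hasFDerivAt_waveMean hw x).fderiv, ContinuousLinearMap.integral_apply hint]
  refine integral_congr_ae (Eventually.of_forall fun σ => ?_)
  simp [EuclideanSpace.inner_single_right]
  ring

theorem contDiff_waveMean (hw : Continuous w) : ContDiff ℝ 1 (waveMean ν w) := by
  rw [contDiff_one_iff_fderiv]
  refine ⟨fun x => (hasFDerivAt_waveMean hw x).differentiableAt, ?_⟩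
  have hf : fderiv ℝ (waveMean ν w) = fun x =>
      ∫ σ, (w σ * Real.exp (inner ℝ x (σ : 𝔼 n))) • innerSL ℝ (σ : 𝔼 n) ∂ν :=
    funext fun x => (hasFDerivAt_waveMean hw x).fderiv
  rw [hf]
  have h := continuous_parametric_integral_of_continuous (μ := ν) (s := univ)
    (f := fun (x : 𝔼 n) (σ : Metric.sphere (0 : 𝔼 n) 1) =>
      (w σ * Real.exp (inner ℝ x (σ : 𝔼 n))) • innerSL ℝ (σ : 𝔼 n))
    (by
      unfold Function.uncurry
      exact (by fun_prop : Continuous fun q : 𝔼 n × Metric.sphere (0 : 𝔼 n) 1 =>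
        w q.2 * Real.exp (inner ℝ q.1 (q.2 : 𝔼 n))).smul
        ((innerSL ℝ (E := 𝔼 n)).continuous.comp (continuous_subtype_val.comp continuous_snd)))
    isCompact_univ
  simpa using h

theorem fderiv_apply_eq_sum (f : 𝔼 n → ℝ) (x v : 𝔼 n) :
    fderiv ℝ f x v = ∑ i, v i * partialDeriv i f x := by
  have hv : v = ∑ i, v i • EuclideanSpace.single i (1 : ℝ) := by
    have := (EuclideanSpace.basisFun (Fin n) ℝ).sum_repr v
    simpa using this.symm
  nth_rewrite 1 [hv]
  simp [partialDeriv]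

/-- `φ` as a superposition of plane waves. For `n = 1` the sphere consists of two points. -/
theorem exists_sphericalExp_eq_waveMean (hn : n = 1 ∨ n = 2) :
    ∃ ν : Measure (Metric.sphere (0 : 𝔼 n) 1), IsFiniteMeasure ν ∧
      sphericalExp n = waveMean ν fun _ => 1 := by
  rcases hn with rfl | rfl
  · have hmem : ∀ s : ℝ, |s| = 1 → EuclideanSpace.single (0 : Fin 1) s ∈
        Metric.sphere (0 : 𝔼 1) 1 := fun s hs => by simpa using hs
    set p : Metric.sphere (0 : 𝔼 1) 1 := ⟨_, hmem 1 (by simp)⟩ with hp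
    set q : Metric.sphere (0 : 𝔼 1) 1 := ⟨_, hmem (-1) (by simp)⟩ with hq
    refine ⟨ENNReal.ofReal (1 / 2) • Measure.dirac p + ENNReal.ofReal (1 / 2) • Measure.dirac q,
      ?_, ?_⟩
    · have h1 : IsFiniteMeasure (ENNReal.ofReal (1 / 2) • Measure.dirac p) :=
        Measure.smul_finite _ ENNReal.ofReal_ne_top
      have h2 : IsFiniteMeasure (ENNReal.ofReal (1 / 2) • Measure.dirac q) :=
        Measure.smul_finite _ ENNReal.ofReal_ne_top
      infer_instance
    · funext x
      rw [waveMean, integral_add_measure, integral_smul_measure, integral_smul_measure,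
        integral_dirac, integral_dirac]
      · simp [sphericalExp, hp, hq, EuclideanSpace.inner_single_right]
        ring
      · exact (integrable_dirac (by simp)).smul_measure ENNReal.ofReal_ne_top
      · exact (integrable_dirac (by simp)).smul_measure ENNReal.ofReal_ne_top
  · refine ⟨ENNReal.ofReal (1 / ((2 : ℕ) * unitBallVolume 2)) •
      (volume : Measure (𝔼 2)).toSphere, Measure.smul_finite _ ENNReal.ofReal_ne_top, ?_⟩
    funext x
    have hpos : 0 ≤ 1 / (((2 : ℕ) : ℝ) * unitBallVolume 2) := by
      have : 0 < Real.Gamma ((2 : ℕ) / 2 + 1 : ℝ) := Real.Gamma_pos_of_pos (by positivity)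
      unfold unitBallVolume
      positivity
    rw [waveMean, integral_smul_measure, ENNReal.toReal_ofReal hpos]
    simp only [sphericalExp, one_mul, smul_eq_mul]

/-- A plane wave in a ball of radius `r` is dominated by a product of functions of one variable,
with Gaussians in the directions orthogonal to the wave: on the ball `∑_{j ≠ i} yⱼ²` is at most
`2 r (r - yᵢ)`. -/
theorem integral_exp_coord_closedBall_le (i : Fin n) {r : ℝ} (hr : 0 < r) :
    ∫ y in Metric.closedBall (0 : 𝔼 n) r, Real.exp (y i)
      ≤ 2 * Real.exp r * √(Real.pi * (4 * r)) ^ (n - 1) := by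
  set f : Fin n → ℝ → ℝ := fun j s => if j = i then
    (Iic r).indicator (fun s => Real.exp (r / 2) * Real.exp (1 / 2 * s)) s
    else Real.exp (-(1 / (4 * r)) * s ^ 2) with hf
  have hfi : ∀ s, f i s = (Iic r).indicator
      (fun s => Real.exp (r / 2) * Real.exp (1 / 2 * s)) s := fun s => by simp [hf]
  have hfj : ∀ j ≠ i, ∀ s, f j s = Real.exp (-(1 / (4 * r)) * s ^ 2) := fun j hj s => by
    simp [hf, hj]
  have hfint : ∀ j, Integrable (f j) := by
    intro j
    by_cases hj : j = i
    · subst hj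
      rw [show f j = _ from funext hfi, integrable_indicator_iff measurableSet_Iic]
      exact (integrableOn_exp_mul_Iic (by norm_num) r).const_mul _
    · rw [show f j = _ from funext (hfj j hj)]
      exact integrable_exp_neg_mul_sq (by positivity)
  have hval : ∫ y : Fin n → ℝ, ∏ j, f j (y j)
      = 2 * Real.exp r * √(Real.pi * (4 * r)) ^ (n - 1) := by
    rw [integral_fintype_prod_volume_eq_prod, ← Finset.mul_prod_erase _ _ (Finset.mem_univ i)]
    have h1 : ∫ s, f i s = 2 * Real.exp r := by
      rw [show f i = _ from funext hfi, integral_indicator measurableSet_Iic,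
        integral_const_mul, integral_exp_mul_Iic (by norm_num)]
      have : Real.exp (r / 2) * Real.exp (1 / 2 * r) = Real.exp r := by
        rw [← Real.exp_add]; congr 1; ring
      rw [← this]; ring
    have h2 : ∀ j ∈ Finset.univ.erase i, ∫ s, f j s = √(Real.pi * (4 * r)) := fun j hj => by
      rw [show f j = _ from funext (hfj j (Finset.ne_of_mem_erase hj)), integral_gaussian]
      congr 1
      field_simp
    rw [h1, Finset.prod_congr rfl h2, Finset.prod_const, Finset.card_erase_of_mem
      (Finset.mem_univ i), Finset.card_univ, Fintype.card_fin]
  have hmp := EuclideanSpace.volume_preserving_symm_measurableEquiv_toLp (Fin n)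
  have hGint : Integrable fun y : 𝔼 n => ∏ j, f j (y j) :=
    (hmp.integrable_comp_emb (MeasurableEquiv.measurableEmbedding _)
      (g := fun y : Fin n → ℝ => ∏ j, f j (y j))).2 (Integrable.fintype_prod hfint)
  have hG : ∫ y : 𝔼 n, ∏ j, f j (y j) = ∫ y : Fin n → ℝ, ∏ j, f j (y j) :=
    hmp.integral_comp (MeasurableEquiv.measurableEmbedding _)
      (fun y : Fin n → ℝ => ∏ j, f j (y j))
  rw [← hval, ← hG, ← integral_indicator Metric.isClosed_closedBall.measurableSet]
  have hc : Continuous fun y : 𝔼 n => Real.exp (y i) := by fun_prop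
  refine integral_mono ((integrable_indicator_iff Metric.isClosed_closedBall.measurableSet).2
    (hc.continuousOn.integrableOn_compact (isCompact_closedBall 0 r))) hGint fun y => ?_
  by_cases hy : y ∈ Metric.closedBall (0 : 𝔼 n) r
  · rw [indicator_of_mem hy]
    have hnorm : ‖y‖ ^ 2 ≤ r ^ 2 := by
      rw [mem_closedBall_zero_iff] at hy
      exact pow_le_pow_left₀ (norm_nonneg _) hy 2
    rw [EuclideanSpace.real_norm_sq_eq, ← Finset.add_sum_erase _ _ (Finset.mem_univ i)] at hnorm
    set S := ∑ j ∈ Finset.univ.erase i, y j ^ 2 with hS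
    have hS0 : 0 ≤ S := Finset.sum_nonneg fun j _ => sq_nonneg _
    have hyi : y i ≤ r := le_of_sq_le_sq (by linarith) hr.le
    change Real.exp (y i) ≤ ∏ j, f j (y j)
    rw [← Finset.mul_prod_erase _ _ (Finset.mem_univ i), hfi, indicator_of_mem (mem_Iic.2 hyi),
      Finset.prod_congr rfl fun j hj => hfj j (Finset.ne_of_mem_erase hj) (y j),
      ← Real.exp_sum, ← Finset.mul_sum, ← hS, ← Real.exp_add, ← Real.exp_add]
    refine Real.exp_le_exp.2 ?_
    have h1 : 1 / (4 * r) * S ≤ (r - y i) / 2 := by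
      rw [one_div_mul_eq_div, div_le_iff₀ (by positivity)]
      nlinarith [sq_nonneg (r - y i)]
    linarith
  · rw [indicator_of_notMem hy]
    refine Finset.prod_nonneg fun j _ => ?_
    by_cases hj : j = i
    · subst hj
      rw [hfi]
      exact indicator_nonneg (fun s _ => by positivity) _
    · rw [hfj j hj]
      positivity

theorem integral_exp_inner_closedBall_le (hn : 0 < n) {r : ℝ} (hr : 0 < r)
    (σ : Metric.sphere (0 : 𝔼 n) 1) :
    ∫ y in Metric.closedBall (0 : 𝔼 n) r, Real.exp (inner ℝ y (σ : 𝔼 n))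
      ≤ 2 * Real.exp r * √(Real.pi * (4 * r)) ^ (n - 1) := by
  have hσ : ‖(σ : 𝔼 n)‖ = 1 := by simp
  set i : Fin n := ⟨0, hn⟩
  obtain ⟨b, hb⟩ := Orthonormal.exists_orthonormalBasis_extension_of_card_eq (𝕜 := ℝ) (E := 𝔼 n)
    (ι := Fin n) (by simp) (v := fun _ => (σ : 𝔼 n)) (s := {i}) (by
      constructor
      · intro j
        exact hσ
      · intro j k hjk
        exact absurd (Subsingleton.elim j k) hjk)
  have hbi : b i = σ := hb i rfl
  have hpre : b.repr ⁻¹' Metric.closedBall (0 : 𝔼 n) r = Metric.closedBall 0 r := by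
    ext y; simp
  have h := b.measurePreserving_repr.setIntegral_preimage_emb
    b.repr.toHomeomorph.measurableEmbedding (fun y : 𝔼 n => Real.exp (y i))
    (Metric.closedBall 0 r)
  rw [hpre] at h
  refine le_trans (le_of_eq ?_) (integral_exp_coord_closedBall_le i hr)
  rw [← h]
  refine integral_congr_ae (Eventually.of_forall fun y => ?_)
  simp only [b.repr_apply_apply, hbi, real_inner_comm]

/-- The mass of a mean of plane waves in the ball of radius `r` grows like
`(1 + r)^{(n - 1) / 2} e^r`. -/
theorem integral_waveMean_closedBall_le (hn : 0 < n) {r : ℝ} (hr : 0 < r) :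
    ∫ x in Metric.closedBall (0 : 𝔼 n) r, waveMean ν (fun _ => 1) x
      ≤ ν.real univ * (2 * Real.exp r * √(Real.pi * (4 * r)) ^ (n - 1)) := by
  unfold waveMean
  have hint : Integrable (uncurry fun (x : 𝔼 n) (σ : Metric.sphere (0 : 𝔼 n) 1) =>
      1 * Real.exp (inner ℝ x (σ : 𝔼 n)))
      ((volume.restrict (Metric.closedBall (0 : 𝔼 n) r)).prod ν) := by
    have hc : Continuous (uncurry fun (x : 𝔼 n) (σ : Metric.sphere (0 : 𝔼 n) 1) =>
      1 * Real.exp (inner ℝ x (σ : 𝔼 n))) := by unfold Function.uncurry; fun_prop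
    have := hc.continuousOn.integrableOn_compact (μ := (volume : Measure (𝔼 n)).prod ν)
      ((isCompact_closedBall (0 : 𝔼 n) r).prod (isCompact_univ (X := Metric.sphere (0 : 𝔼 n) 1)))
    rwa [IntegrableOn, ← Measure.prod_restrict, Measure.restrict_univ] at this
  rw [integral_integral_swap hint]
  refine (le_abs_self _).trans ?_
  rw [mul_comm, ← Real.norm_eq_abs]
  refine norm_integral_le_of_norm_le_const (Eventually.of_forall fun σ => ?_)
  rw [Real.norm_eq_abs, abs_of_nonneg (integral_nonneg fun x => by positivity)]
  simpa using integral_exp_inner_closedBall_le hn hr σ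

end PlaneWaves

/-! ### Convexity of the pressure -/

section Convexity

theorem rpow_one_add_sub_one_ge {θ z : ℝ} (hθ : 0 ≤ θ) (hθ1 : θ ≤ 1) (hz : 0 < z) :
    θ / 2 * gain θ z ≤ (1 + z) ^ θ - 1 := by
  have h1z : 0 < 1 + z := by linarith
  -- Bernoulli's inequality for `1 / (1 + z) = 1 - z / (1 + z)`
  have hb : (1 + z) ^ (-θ) ≤ 1 - θ * (z / (1 + z)) := by
    have h := rpow_one_add_le_one_add_mul_self (s := -(z / (1 + z)))
      (by rw [neg_le_neg_iff, div_le_one h1z]; linarith) hθ hθ1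
    have e : 1 + -(z / (1 + z)) = (1 + z)⁻¹ := by field_simp; ring
    rw [e, Real.inv_rpow h1z.le, ← Real.rpow_neg h1z.le] at h
    linarith
  have hP : 0 < (1 + z) ^ θ := by positivity
  have hmul : (1 + z) ^ θ * (1 + z) ^ (-θ) = 1 := by
    rw [← Real.rpow_add h1z, add_neg_cancel, Real.rpow_zero]
  have key : (1 + z) ^ θ * (θ * (z / (1 + z))) ≤ (1 + z) ^ θ - 1 := by
    nlinarith [mul_le_mul_of_nonneg_left hb hP.le]
  refine le_trans ?_ key
  rcases le_total z 1 with hz1 | hz1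
  · have h1 : z / 2 ≤ z / (1 + z) := div_le_div_of_nonneg_left hz.le h1z (by linarith)
    have h2 : 1 ≤ (1 + z) ^ θ := Real.one_le_rpow (by linarith) hθ
    have h3 : θ / 2 * gain θ z ≤ θ * (z / 2) := by
      have : gain θ z ≤ z := min_le_left _ _
      nlinarith
    have h4 : θ * (z / 2) ≤ θ * (z / (1 + z)) := mul_le_mul_of_nonneg_left h1 hθ
    have h5 : 0 ≤ θ * (z / (1 + z)) := by positivity
    nlinarith
  · have h1 : 1 / 2 ≤ z / (1 + z) := by
      rw [div_le_div_iff₀ two_pos h1z]; linarith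
    have h2 : z ^ θ ≤ (1 + z) ^ θ := Real.rpow_le_rpow hz.le (by linarith) hθ
    have h3 : gain θ z ≤ z ^ θ := min_le_right _ _
    have h4 : θ / 2 * gain θ z ≤ (1 + z) ^ θ * (θ / 2) := by nlinarith
    have h5 : θ / 2 ≤ θ * (z / (1 + z)) := by nlinarith
    exact h4.trans (mul_le_mul_of_nonneg_left h5 hP.le)

theorem rpow_one_add_sub_ge {γ z : ℝ} (hγ : 1 < γ) (hz : 0 < z) :
    γ * min (γ - 1) 1 / 8 * (z * gain (min (γ - 1) 1) z) ≤ (1 + z) ^ γ - 1 - γ * z := by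
  set θ := min (γ - 1) 1 with hθdef
  have hθ : 0 < θ := lt_min (by linarith) one_pos
  have hθ1 : θ ≤ 1 := min_le_right _ _
  set q := 1 + z / 2 with hq
  have hqpos : 0 < q := by positivity
  have hbern : q ^ γ + γ * (q ^ (γ - 1) * (z / 2)) ≤ (1 + z) ^ γ := by
    have h := one_add_mul_self_le_rpow_one_add (s := z / 2 / q)
      (by have : 0 < z / 2 / q := by positivity
          linarith) hγ.le
    have e : q * (1 + z / 2 / q) = 1 + z := by rw [hq]; field_simp; ring
    have h' := mul_le_mul_of_nonneg_left h (Real.rpow_nonneg hqpos.le γ)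
    rw [← Real.mul_rpow hqpos.le (by positivity), e] at h'
    refine le_trans (le_of_eq ?_) h'
    rw [Real.rpow_sub_one hqpos.ne']
    field_simp
  have hbern0 : 1 + γ * (z / 2) ≤ q ^ γ :=
    one_add_mul_self_le_rpow_one_add (by linarith) hγ.le
  have h1 : q ^ θ ≤ q ^ (γ - 1) :=
    Real.rpow_le_rpow_of_exponent_le (by linarith) (min_le_left _ _)
  have h2 := rpow_one_add_sub_one_ge hθ.le hθ1 (z := z / 2) (by positivity)
  have h3 := mul_gain_le (s := 1 / 2) hθ1 (by norm_num) (by norm_num) hz.le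
  rw [show 1 / 2 * z = z / 2 by ring] at h3
  rw [← hq] at h2
  have h4 : θ / 2 * (1 / 2 * gain θ z) ≤ q ^ (γ - 1) - 1 := by
    have := mul_le_mul_of_nonneg_left h3 (by positivity : (0 : ℝ) ≤ θ / 2)
    linarith
  have h5 := mul_le_mul_of_nonneg_left h4 (by positivity : 0 ≤ γ * (z / 2))
  linarith

/-- Linear lower bounds for the convex excess of the pressure, uniform in the slope. Optimizing the
parameter `y` turns them into a nonlinear bound for averages, which covers `γ < 2`, where the
pressure is not quadratically convex at infinity. -/
theorem exists_pressure_excess_ge {A γ ρbar : ℝ} (hγ : 1 < γ) (hA : 0 < A) (hρ : 0 < ρbar) :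
    ∃ κ > 0, ∀ r > 0, ∀ y > 0, κ * gain (min (γ - 1) 1) y * (r - ρbar - y / 2)
      ≤ A * r ^ γ - A * ρbar ^ γ - A * γ * ρbar ^ (γ - 1) * (r - ρbar) := by
  set θ := min (γ - 1) 1 with hθdef
  have hθ : 0 < θ := lt_min (by linarith) one_pos
  have hθ1 : θ ≤ 1 := min_le_right _ _
  have hscale : ∀ r > 0, A * r ^ γ - A * ρbar ^ γ - A * γ * ρbar ^ (γ - 1) * (r - ρbar)
      = A * ρbar ^ γ * ((1 + (r - ρbar) / ρbar) ^ γ - 1 - γ * ((r - ρbar) / ρbar)) := by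
    intro r hr
    have e1 : 1 + (r - ρbar) / ρbar = r / ρbar := by field_simp; ring
    rw [e1, Real.div_rpow hr.le hρ.le, Real.rpow_sub_one hρ.ne']
    field_simp
  have hnonneg : ∀ r > 0,
      0 ≤ A * r ^ γ - A * ρbar ^ γ - A * γ * ρbar ^ (γ - 1) * (r - ρbar) := by
    intro r hr
    rw [hscale r hr]
    have := one_add_mul_self_le_rpow_one_add (s := (r - ρbar) / ρbar)
      (by rw [le_div_iff₀ hρ]; linarith) hγ.le
    have h2 : 0 < A * ρbar ^ γ := by positivity
    exact mul_nonneg h2.le (by linarith)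
  set k := min (1 / ρbar) 1 with hk
  have hkpos : 0 < k := lt_min (by positivity) one_pos
  set κ₁ := A * ρbar ^ γ * (γ * θ / 8 * (1 / ρbar * k)) with hκ₁
  have hκ₁pos : 0 < κ₁ := by positivity
  refine ⟨κ₁ / 2, by positivity, fun r hr y hy => ?_⟩
  have hgy : 0 < gain θ y := gain_pos hy
  rcases le_or_gt (r - ρbar) (y / 2) with hle | hlt
  · refine le_trans ?_ (hnonneg r hr)
    exact mul_nonpos_of_nonneg_of_nonpos (by positivity) (by linarith)
  · rw [hscale r hr]
    set s := r - ρbar with hs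
    have hspos : 0 < s := by linarith
    have h1 := rpow_one_add_sub_ge hγ (z := s / ρbar) (by positivity)
    have h2 : k * gain θ s ≤ gain θ (s / ρbar) := by
      refine (mul_gain_le hθ1 hkpos (min_le_right _ _) hspos.le).trans
        (gain_mono hθ.le (by positivity) ?_)
      rw [div_eq_inv_mul, ← one_div]
      exact mul_le_mul_of_nonneg_right (min_le_left _ _) hspos.le
    have h3 : gain θ y ≤ 2 * gain θ s := by
      have h4 := gain_mono hθ.le hy.le (by linarith : y ≤ 2 * s)
      have h5 := mul_gain_le (s := 1 / 2) hθ1 (by norm_num) (by norm_num)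
        (by positivity : 0 ≤ 2 * s)
      rw [show 1 / 2 * (2 * s) = s by ring] at h5
      linarith
    have hgs : 0 < gain θ s := gain_pos hspos
    calc κ₁ / 2 * gain θ y * (s - y / 2) ≤ κ₁ / 2 * (2 * gain θ s) * s := by
          gcongr
          linarith
      _ = A * ρbar ^ γ * (γ * θ / 8 * (s / ρbar * (k * gain θ s))) := by rw [hκ₁]; ring
      _ ≤ A * ρbar ^ γ * (γ * θ / 8 * (s / ρbar * gain θ (s / ρbar))) := by gcongr
      _ ≤ _ := by gcongr

end Convexity

/-! ### Weighted moments of a solution -/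

section Moments

variable {n : ℕ} {A γ μ ρbar ε T R : ℝ} {ρ₀ : 𝔼 n → ℝ} {u₀ : 𝔼 n → 𝔼 n} {ρ : ℝ → 𝔼 n → ℝ}
  {u : ℝ → 𝔼 n → 𝔼 n} {K : Set (𝔼 n)} {ψ : 𝔼 n → ℝ}

theorem continuousOn_moment {f : ℝ → 𝔼 n → ℝ}
    (hf : ContDiffOn ℝ 1 (fun q : ℝ × 𝔼 n => f q.1 q.2) (Ico 0 T ×ˢ univ)) (hK : IsCompact K)
    (hfK : ∀ t ∈ Ico 0 T, ∀ x ∉ K, f t x = 0) (hψ : ContDiff ℝ 1 ψ) :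
    ContinuousOn (fun t => ∫ x, f t x * ψ x) (Ico 0 T) :=
  continuousOn_integral_of_compact_support hK
    (hf.continuousOn.mul (hψ.continuous.comp continuous_snd).continuousOn)
    fun t x ht hx => by rw [hfK t ht x hx, zero_mul]

theorem hasDerivAt_moment {f : ℝ → 𝔼 n → ℝ}
    (hf : ContDiffOn ℝ 1 (fun q : ℝ × 𝔼 n => f q.1 q.2) (Ico 0 T ×ˢ univ)) (hK : IsCompact K)
    (hfK : ∀ t ∈ Ico 0 T, ∀ x ∉ K, f t x = 0) (hψ : ContDiff ℝ 1 ψ) {t : ℝ} (ht : t ∈ Ioo 0 T) :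
    HasDerivAt (fun t => ∫ x, f t x * ψ x) (∫ x, deriv (fun s => f s x) t * ψ x) t := by
  have h := (hasDerivAt_integral_of_contDiffOn (F := fun t x => f t x * ψ x) (a := 0) (b := T)
    ((hf.mul (hψ.comp contDiff_snd).contDiffOn).mono
      (prod_mono Ioo_subset_Ico_self subset_rfl)) hK
    (fun s hs x hx => by rw [hfK s (Ioo_subset_Ico_self hs) x hx, zero_mul]) ht).2
  refine h.congr_deriv (integral_congr_ae (Eventually.of_forall fun x => ?_))
  exact deriv_mul_const (differentiableAt_time hf ht x) _

theorem IsEulerSolution.contDiffOn_momentum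
    (h : IsEulerSolution A γ 1 μ ρbar ε ρ₀ u₀ (ENNReal.ofReal T) ρ u) (i : Fin n) :
    ContDiffOn ℝ 1 (fun q : ℝ × 𝔼 n => ρ q.1 q.2 * u q.1 q.2 i) (Ico 0 T ×ˢ univ) :=
  h.density.mul (h.velocity_apply i)

theorem IsEulerSolution.hasDerivAt_mass_moment
    (h : IsEulerSolution A γ 1 μ ρbar ε ρ₀ u₀ (ENNReal.ofReal T) ρ u) (hK : IsCompact K)
    (hout : ∀ t ∈ Ico 0 T, ∀ x ∉ K, ρ t x = ρbar ∧ u t x = 0) (hψ : ContDiff ℝ 1 ψ) {t : ℝ}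
    (ht : t ∈ Ioo 0 T) :
    HasDerivAt (fun t => ∫ x, (ρ t x - ρbar) * ψ x)
      (∑ i, ∫ x, ρ t x * u t x i * partialDeriv i ψ x) t := by
  have hf : ContDiffOn ℝ 1 (fun q : ℝ × 𝔼 n => ρ q.1 q.2 - ρbar) (Ico 0 T ×ˢ univ) :=
    h.density.sub contDiffOn_const
  have htI := Ioo_subset_Ico_self ht
  refine (hasDerivAt_moment (f := fun t x => ρ t x - ρbar) hf hK
    (fun t ht x hx => by rw [(hout t ht x hx).1, sub_self]) hψ ht).congr_deriv ?_
  have hm : ∀ i, ContDiff ℝ 1 (fun y => ρ t y * u t y i) := fun i =>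
    contDiff_slice (F := fun t y => ρ t y * u t y i) (h.contDiffOn_momentum i) htI
  have hs : ∀ i, HasCompactSupport (fun y => ρ t y * u t y i) := fun i =>
    .intro hK fun x hx => by simp [(hout t htI x hx).2]
  have hderiv : ∀ x, deriv (fun s => ρ s x - ρbar) t * ψ x
      = ∑ i, -(partialDeriv i (fun y => ρ t y * u t y i) x * ψ x) := fun x => by
    have := h.mass t ht.1 ((ENNReal.ofReal_lt_ofReal_iff_of_nonneg ht.1.le).2 ht.2) x
    rw [deriv_sub_const, eq_neg_of_add_eq_zero_left this, Finset.sum_neg_distrib,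
      ← Finset.sum_mul, neg_mul]
  simp_rw [hderiv]
  rw [integral_finsetSum]
  · refine Finset.sum_congr rfl fun i _ => ?_
    rw [integral_neg, integral_partialDeriv_mul (hm i) hψ (hs i) i, neg_neg]
  · intro i _
    exact ((((hm i).continuous_partialDeriv i).mul hψ.continuous).integrable_of_hasCompactSupport
      ((hs i).partialDeriv i).mul_right).neg

theorem IsEulerSolution.hasDerivAt_momentum_moment
    (h : IsEulerSolution A γ 1 μ ρbar ε ρ₀ u₀ (ENNReal.ofReal T) ρ u) (hγ : 1 < γ)
    (hK : IsCompact K) (hout : ∀ t ∈ Ico 0 T, ∀ x ∉ K, ρ t x = ρbar ∧ u t x = 0)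
    (hψ : ContDiff ℝ 1 ψ) {t : ℝ} (ht : t ∈ Ioo 0 T) (j : Fin n) :
    HasDerivAt (fun t => ∫ x, ρ t x * u t x j * ψ x)
      ((∑ i, ∫ x, ρ t x * u t x i * u t x j * partialDeriv i ψ x)
        + (∫ x, (A * ρ t x ^ γ - A * ρbar ^ γ) * partialDeriv j ψ x)
        - μ / (1 + t) * ∫ x, ρ t x * u t x j * ψ x) t := by
  have htI := Ioo_subset_Ico_self ht
  refine (hasDerivAt_moment (f := fun t x => ρ t x * u t x j) (h.contDiffOn_momentum j) hK
    (fun t ht x hx => by simp [(hout t ht x hx).2]) hψ ht).congr_deriv ?_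
  have hm : ContDiff ℝ 1 (fun y => ρ t y * u t y j) :=
    contDiff_slice (F := fun t y => ρ t y * u t y j) (h.contDiffOn_momentum j) htI
  have hms : HasCompactSupport (fun y => ρ t y * u t y j) :=
    .intro hK fun x hx => by simp [(hout t htI x hx).2]
  have hq : ∀ i, ContDiff ℝ 1 (fun y => ρ t y * u t y i * u t y j) := fun i =>
    contDiff_slice (F := fun t y => ρ t y * u t y i * u t y j)
      ((h.contDiffOn_momentum i).mul (h.velocity_apply j)) htI
  have hqs : ∀ i, HasCompactSupport (fun y => ρ t y * u t y i * u t y j) := fun i =>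
    .intro hK fun x hx => by simp [(hout t htI x hx).2]
  have hp0 : ContDiff ℝ 1 (fun y => A * ρ t y ^ γ) :=
    contDiff_slice (F := fun t y => A * ρ t y ^ γ) (h.contDiffOn_pressure hγ) htI
  have hp : ContDiff ℝ 1 (fun y => A * ρ t y ^ γ - A * ρbar ^ γ) := hp0.sub contDiff_const
  have hps : HasCompactSupport (fun y => A * ρ t y ^ γ - A * ρbar ^ γ) :=
    .intro hK fun x hx => by rw [(hout t htI x hx).1, sub_self]
  have hpd : ∀ x, partialDeriv j (fun y => A * ρ t y ^ γ - A * ρbar ^ γ) x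
      = partialDeriv j (fun y => A * ρ t y ^ γ) x := fun x => by
    rw [partialDeriv, partialDeriv, fderiv_sub_const]
  have hderiv : ∀ x, deriv (fun s => ρ s x * u s x j) t * ψ x
      = (∑ i, -(partialDeriv i (fun y => ρ t y * u t y i * u t y j) x * ψ x))
        + -(partialDeriv j (fun y => A * ρ t y ^ γ - A * ρbar ^ γ) x * ψ x)
        - μ / (1 + t) * (ρ t x * u t x j * ψ x) := fun x => by
    have := h.momentum t ht.1 ((ENNReal.ofReal_lt_ofReal_iff_of_nonneg ht.1.le).2 ht.2) x j
    rw [Real.rpow_one] at this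
    rw [hpd, Finset.sum_neg_distrib, ← Finset.sum_mul]
    linear_combination ψ x * this
  have hint₁ : ∀ i, Integrable fun x =>
      -(partialDeriv i (fun y => ρ t y * u t y i * u t y j) x * ψ x) := fun i =>
    ((((hq i).continuous_partialDeriv i).mul hψ.continuous).integrable_of_hasCompactSupport
      ((hqs i).partialDeriv i).mul_right).neg
  have hint₂ : Integrable fun x =>
      -(partialDeriv j (fun y => A * ρ t y ^ γ - A * ρbar ^ γ) x * ψ x) :=
    (((hp.continuous_partialDeriv j).mul hψ.continuous).integrable_of_hasCompactSupport
      (hps.partialDeriv j).mul_right).neg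
  have hint₃ : Integrable fun x => μ / (1 + t) * (ρ t x * u t x j * ψ x) :=
    ((hm.continuous.mul hψ.continuous).integrable_of_hasCompactSupport hms.mul_right).const_mul _
  have hint₁' := integrable_finsetSum Finset.univ fun i _ => hint₁ i
  have hint₁₂ : Integrable fun x =>
      (∑ i, -(partialDeriv i (fun y => ρ t y * u t y i * u t y j) x * ψ x))
        + -(partialDeriv j (fun y => A * ρ t y ^ γ - A * ρbar ^ γ) x * ψ x) := hint₁'.add hint₂
  simp_rw [hderiv]
  rw [integral_sub hint₁₂ hint₃, integral_add hint₁' hint₂,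
    integral_finsetSum _ fun i _ => hint₁ i, integral_const_mul, integral_neg,
    integral_partialDeriv_mul hp hψ hps j, neg_neg]
  congr 2
  refine Finset.sum_congr rfl fun i _ => ?_
  rw [integral_neg, integral_partialDeriv_mul (hq i) hψ (hqs i) i, neg_neg]

end Moments

/-! ### The moment inequality -/

section MomentInequality

variable {n : ℕ} {A γ μ ρbar ε T R κ M L X : ℝ} {ρ₀ : 𝔼 n → ℝ} {u₀ : 𝔼 n → 𝔼 n} {ρ : ℝ → 𝔼 n → ℝ}
  {u : ℝ → 𝔼 n → 𝔼 n} {ν : Measure (Metric.sphere (0 : 𝔼 n) 1)}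

theorem waveMean_nonneg {w : Metric.sphere (0 : 𝔼 n) 1 → ℝ} (hw : ∀ σ, 0 ≤ w σ) (x : 𝔼 n) :
    0 ≤ waveMean ν w x :=
  integral_nonneg fun σ => mul_nonneg (hw σ) (Real.exp_pos _).le

variable [IsFiniteMeasure ν]

theorem waveMean_sum {ι : Type*} (s : Finset ι) {w : ι → Metric.sphere (0 : 𝔼 n) 1 → ℝ}
    (hw : ∀ i, Continuous (w i)) (a : ι → ℝ) (x : 𝔼 n) :
    ∑ i ∈ s, a i * waveMean ν (w i) x = waveMean ν (fun σ => ∑ i ∈ s, a i * w i σ) x := by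
  unfold waveMean
  simp_rw [← integral_const_mul, Finset.sum_mul]
  rw [integral_finsetSum]
  · simp_rw [mul_assoc]
  · intro i _
    simpa only [mul_assoc] using (integrable_wave (hw i) x).const_mul (a i)

/-- The Hessian of a positive superposition of plane waves is positive semidefinite. -/
theorem sum_mul_waveMean_nonneg (v : 𝔼 n) (x : 𝔼 n) :
    0 ≤ ∑ j, ∑ i, v i * v j *
      waveMean ν (fun σ => 1 * (σ : 𝔼 n) j * (σ : 𝔼 n) i) x := by
  have hw : ∀ j i, Continuous fun σ : Metric.sphere (0 : 𝔼 n) 1 =>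
      1 * (σ : 𝔼 n) j * (σ : 𝔼 n) i := fun j i => by fun_prop
  rw [← Fintype.sum_prod_type' (f := fun j i => v i * v j *
      waveMean ν (fun σ => 1 * (σ : 𝔼 n) j * (σ : 𝔼 n) i) x),
    waveMean_sum Finset.univ (fun p : Fin n × Fin n => hw p.1 p.2) (fun p => v p.2 * v p.1)]
  refine waveMean_nonneg (fun σ => ?_) x
  have : ∑ p : Fin n × Fin n, v p.2 * v p.1 * (1 * (σ : 𝔼 n) p.1 * (σ : 𝔼 n) p.2)
      = (∑ i, v i * (σ : 𝔼 n) i) ^ 2 := by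
    rw [sq, Finset.sum_mul_sum, ← Fintype.sum_prod_type']
    exact Finset.sum_congr rfl fun p _ => by ring
  rw [this]
  exact sq_nonneg _

/-- A superposition of plane waves `e^{x · σ}` with `|σ| = 1` satisfies `Δ φ = φ`. -/
theorem sum_waveMean_diag (x : 𝔼 n) :
    ∑ j, waveMean ν (fun σ => 1 * (σ : 𝔼 n) j * (σ : 𝔼 n) j) x = waveMean ν (fun _ => 1) x := by
  have h := waveMean_sum (ν := ν) Finset.univ
    (w := fun (j : Fin n) σ => 1 * (σ : 𝔼 n) j * (σ : 𝔼 n) j) (fun j => by fun_prop)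
    (fun _ => 1) x
  simp only [one_mul] at h ⊢
  rw [h]
  congr 1
  funext σ
  have hσ : ‖(σ : 𝔼 n)‖ ^ 2 = 1 := by simp
  rw [EuclideanSpace.real_norm_sq_eq] at hσ
  simpa [sq] using hσ

/-- The excess of pressure over its linearization, in the mean. The tangent line at which the
convexity bound is used is placed at half of the mean density excess `X / M`. -/
theorem pressure_moment_ge (hA : 0 < A) (hρbar : 0 < ρbar) (hκ : 0 < κ) (hγ : 1 < γ)
    (hconv : ∀ r > 0, ∀ y > 0, κ * gain (min (γ - 1) 1) y * (r - ρbar - y / 2)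
      ≤ A * r ^ γ - A * ρbar ^ γ - A * γ * ρbar ^ (γ - 1) * (r - ρbar))
    {r φ : 𝔼 n → ℝ} (hr : Continuous r) (hrpos : ∀ x, 0 < r x)
    (hrout : ∀ x, L < ‖x‖ → r x = ρbar) (hφ : Continuous φ) (hφ0 : ∀ x, 0 ≤ φ x)
    (hX : X = ∫ x, (r x - ρbar) * φ x) (hXpos : 0 < X) (hM : 0 < M)
    (hφM : ∫ x in Metric.closedBall (0 : 𝔼 n) L, φ x ≤ M) :
    soundSpeed A γ ρbar ^ 2 * X + κ / 2 * X * gain (min (γ - 1) 1) (X / M)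
      ≤ ∫ x, (A * r x ^ γ - A * ρbar ^ γ) * φ x := by
  set B := Metric.closedBall (0 : 𝔼 n) L
  set y := X / M with hy
  set G := gain (min (γ - 1) 1) y
  have hypos : 0 < y := div_pos hXpos hM
  have hG : 0 < G := gain_pos hypos
  have hKc : IsCompact B := isCompact_closedBall 0 L
  have hout : ∀ x ∉ B, r x = ρbar := fun x hx => hrout x (by simpa [B] using hx)
  have hi₁ : Integrable fun x => (r x - ρbar) * φ x := by
    have hc : Continuous fun x => (r x - ρbar) * φ x := (hr.sub continuous_const).mul hφ
    exact hc.integrable_of_hasCompactSupport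
      (.intro hKc fun x hx => by rw [hout x hx, sub_self, zero_mul])
  have hi₂ : Integrable (B.indicator φ) :=
    (integrable_indicator_iff Metric.isClosed_closedBall.measurableSet).2
      (hφ.continuousOn.integrableOn_compact hKc)
  have hi₃ : Integrable fun x => (A * r x ^ γ - A * ρbar ^ γ) * φ x := by
    have hc : Continuous fun x => (A * r x ^ γ - A * ρbar ^ γ) * φ x :=
      (((hr.rpow_const fun x => Or.inl (hrpos x).ne').const_mul A).sub continuous_const).mul hφ
    exact hc.integrable_of_hasCompactSupport
      (.intro hKc fun x hx => by rw [hout x hx, sub_self, zero_mul])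
  have hpt : ∀ x, (soundSpeed A γ ρbar ^ 2 + κ * G) * ((r x - ρbar) * φ x)
      - κ * G * (y / 2) * B.indicator φ x ≤ (A * r x ^ γ - A * ρbar ^ γ) * φ x := by
    intro x
    by_cases hx : x ∈ B
    · rw [indicator_of_mem hx, soundSpeed_sq hγ hA hρbar]
      have := mul_le_mul_of_nonneg_right (hconv (r x) (hrpos x) y hypos) (hφ0 x)
      linarith
    · rw [indicator_of_notMem hx, hout x hx]
      simp
  have hint := integral_mono (((hi₁.const_mul _).sub (hi₂.const_mul _))) hi₃ hpt
  have hl : ∫ x, ((soundSpeed A γ ρbar ^ 2 + κ * G) * ((r x - ρbar) * φ x)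
      - κ * G * (y / 2) * B.indicator φ x)
      = (soundSpeed A γ ρbar ^ 2 + κ * G) * X - κ * G * (y / 2) * ∫ x in B, φ x := by
    rw [integral_sub (hi₁.const_mul _) (hi₂.const_mul _), integral_const_mul, integral_const_mul,
      integral_indicator Metric.isClosed_closedBall.measurableSet, ← hX]
  have hm : κ * G * (y / 2) * ∫ x in B, φ x ≤ κ * G * (X / 2) := by
    have h1 : y * M = X := div_mul_cancel₀ _ hM.ne'
    calc _ ≤ κ * G * (y / 2) * M := mul_le_mul_of_nonneg_left hφM (by positivity)
      _ = κ * G * (y * M / 2) := by ring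
      _ = _ := by rw [h1]
  refine le_trans ?_ hint
  refine le_trans ?_ hl.ge
  linarith

variable (ν) in
/-- The moment `∫ (ρ - ρbar) φ` of the density excess against the superposition `φ` of plane
waves. -/
noncomputable def massMoment (ρbar : ℝ) (ρ : ℝ → 𝔼 n → ℝ) (t : ℝ) : ℝ :=
  ∫ x, (ρ t x - ρbar) * waveMean ν (fun _ => 1) x

variable (ν) in
/-- The moment `∫ ρ u · ∇φ` of the momentum against the gradient of the superposition `φ` of
plane waves. -/
noncomputable def momentumMoment (ρ : ℝ → 𝔼 n → ℝ) (u : ℝ → 𝔼 n → 𝔼 n) (t : ℝ) : ℝ :=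
  ∑ j, ∫ x, ρ t x * u t x j * waveMean ν (fun σ => 1 * (σ : 𝔼 n) j) x

theorem continuous_one_mul_coord (j : Fin n) :
    Continuous fun σ : Metric.sphere (0 : 𝔼 n) 1 => 1 * (σ : 𝔼 n) j := by fun_prop

theorem IsEulerSolution.hasDerivAt_massMoment {K : Set (𝔼 n)}
    (h : IsEulerSolution A γ 1 μ ρbar ε ρ₀ u₀ (ENNReal.ofReal T) ρ u) (hK : IsCompact K)
    (hout : ∀ t ∈ Ico 0 T, ∀ x ∉ K, ρ t x = ρbar ∧ u t x = 0) {t : ℝ} (ht : t ∈ Ioo 0 T) :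
    HasDerivAt (massMoment ν ρbar ρ) (momentumMoment ν ρ u t) t := by
  have h := h.hasDerivAt_mass_moment hK hout
    (contDiff_waveMean (ν := ν) (w := fun _ => 1) continuous_const) ht
  simp_rw [partialDeriv_waveMean (ν := ν) (w := fun _ => 1) continuous_const] at h
  exact h

theorem IsEulerSolution.hasDerivAt_momentumMoment {K : Set (𝔼 n)}
    (h : IsEulerSolution A γ 1 μ ρbar ε ρ₀ u₀ (ENNReal.ofReal T) ρ u) (hγ : 1 < γ)
    (hK : IsCompact K)
    (hout : ∀ t ∈ Ico 0 T, ∀ x ∉ K, ρ t x = ρbar ∧ u t x = 0) {t : ℝ} (ht : t ∈ Ioo 0 T) :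
    HasDerivAt (momentumMoment ν ρ u)
      ((∫ x, ρ t x * ∑ j, ∑ i, u t x i * u t x j *
          waveMean ν (fun σ => 1 * (σ : 𝔼 n) j * (σ : 𝔼 n) i) x)
        + (∫ x, (A * ρ t x ^ γ - A * ρbar ^ γ) * waveMean ν (fun _ => 1) x)
        - μ / (1 + t) * momentumMoment ν ρ u t) t := by
  have htI := Ioo_subset_Ico_self ht
  have hd := HasDerivAt.fun_sum (u := Finset.univ) fun j _ => h.hasDerivAt_momentum_moment hγ hK hout
    (contDiff_waveMean (ν := ν) (continuous_one_mul_coord j)) ht j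
  simp_rw [fun j => partialDeriv_waveMean (ν := ν) (continuous_one_mul_coord j)] at hd
  refine hd.congr_deriv ?_
  have hc : ∀ j i, Continuous (waveMean ν fun σ => 1 * (σ : 𝔼 n) j * (σ : 𝔼 n) i) := fun j i =>
    continuous_waveMean (by fun_prop)
  have hcq : ∀ j i, Integrable fun x => ρ t x * u t x i * u t x j *
      waveMean ν (fun σ => 1 * (σ : 𝔼 n) j * (σ : 𝔼 n) i) x := fun j i => by
    have hq : ContDiff ℝ 1 (fun y => ρ t y * u t y i * u t y j) :=
      contDiff_slice (F := fun t y => ρ t y * u t y i * u t y j)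
        ((h.contDiffOn_momentum i).mul (h.velocity_apply j)) htI
    exact (hq.continuous.mul (hc j i)).integrable_of_hasCompactSupport
      (.intro hK fun x hx => by simp [(hout t htI x hx).2])
  have hcp : ∀ j, Integrable fun x => (A * ρ t x ^ γ - A * ρbar ^ γ) *
      waveMean ν (fun σ => 1 * (σ : 𝔼 n) j * (σ : 𝔼 n) j) x := fun j => by
    have hp : ContDiff ℝ 1 (fun y => A * ρ t y ^ γ) :=
      contDiff_slice (F := fun t y => A * ρ t y ^ γ) (h.contDiffOn_pressure hγ) htI
    exact ((hp.continuous.sub continuous_const).mul (hc j j)).integrable_of_hasCompactSupport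
      (.intro hK fun x hx => by simp [(hout t htI x hx).1])
  rw [Finset.sum_sub_distrib, Finset.sum_add_distrib, ← Finset.mul_sum]
  congr 2
  · simp_rw [← integral_finsetSum Finset.univ fun i _ => hcq _ i]
    rw [← integral_finsetSum Finset.univ fun j _ =>
      integrable_finsetSum Finset.univ fun i _ => hcq j i]
    simp_rw [Finset.mul_sum, mul_assoc]
  · rw [← integral_finsetSum Finset.univ fun j _ => hcp j]
    simp_rw [← Finset.mul_sum, sum_waveMean_diag]

/-- The mass of `φ` in the ball of radius `R + c t`. -/
theorem integral_waveMean_cone_le {c R : ℝ} (hn : 0 < n) (hc : 0 < c) (hR : 0 < R) {t : ℝ}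
    (ht : 0 ≤ t) :
    ∫ x in Metric.closedBall (0 : 𝔼 n) (R + c * t), waveMean ν (fun _ => 1) x
      ≤ (ν.real univ + 1) * (2 * Real.exp R * √(4 * Real.pi * (R + c)) ^ (n - 1))
        * ((1 + t) ^ (((n : ℝ) - 1) / 2) * Real.exp (c * t)) := by
  have h1t : 0 ≤ 1 + t := by linarith
  refine (integral_waveMean_closedBall_le hn (by positivity)).trans ?_
  have h1 : √(Real.pi * (4 * (R + c * t))) ≤ √(4 * Real.pi * (R + c)) * √(1 + t) := by
    rw [← Real.sqrt_mul (by positivity)]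
    refine Real.sqrt_le_sqrt ?_
    have : R + c * t ≤ (R + c) * (1 + t) := by nlinarith [mul_nonneg hR.le ht]
    calc _ = 4 * Real.pi * (R + c * t) := by ring
      _ ≤ 4 * Real.pi * ((R + c) * (1 + t)) := by gcongr
      _ = _ := by ring
  have h2 : √(1 + t) ^ (n - 1) = (1 + t) ^ (((n : ℝ) - 1) / 2) := by
    rw [Real.sqrt_eq_rpow, ← Real.rpow_natCast, ← Real.rpow_mul h1t, Nat.cast_pred hn]
    congr 1
    ring
  have h3 := pow_le_pow_left₀ (Real.sqrt_nonneg _) h1 (n - 1)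
  rw [mul_pow, h2] at h3
  have hν : ν.real univ ≤ ν.real univ + 1 := by linarith
  calc _ ≤ (ν.real univ + 1) * (2 * Real.exp (R + c * t) *
        (√(4 * Real.pi * (R + c)) ^ (n - 1) * (1 + t) ^ (((n : ℝ) - 1) / 2))) := by gcongr
    _ = _ := by rw [Real.exp_add]; ring

end MomentInequality

/-! ### The bound for the lifespan -/

section Lifespan

variable {n : ℕ} {A γ μ ρbar ε T R : ℝ} {ρ₀ : 𝔼 n → ℝ} {u₀ : 𝔼 n → 𝔼 n} {ρ : ℝ → 𝔼 n → ℝ}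
  {u : ℝ → 𝔼 n → 𝔼 n}

theorem inner_gradient_eq_sum (f : 𝔼 n → ℝ) (x v : 𝔼 n) :
    inner ℝ v (gradient f x) = ∑ j, v j * partialDeriv j f x := by
  rw [real_inner_comm, gradient, InnerProductSpace.toDual_symm_apply, fderiv_apply_eq_sum]

theorem IsEulerSolution.exists_isCompact_eq_const
    (h : IsEulerSolution A γ 1 μ ρbar ε ρ₀ u₀ (ENNReal.ofReal T) ρ u) (hγ : 1 < γ) (hA : 0 < A)
    (hμ : 0 ≤ μ) (hρbar : 0 < ρbar) (hinit : ∀ x, R < ‖x‖ → ρ 0 x = ρbar ∧ u 0 x = 0) :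
    ∃ B : Set (𝔼 n), IsCompact B ∧ ∀ t ∈ Ico 0 T, ∀ x ∉ B, ρ t x = ρbar ∧ u t x = 0 := by
  have hc := soundSpeed_pos hγ hA hρbar
  refine ⟨Metric.closedBall 0 (R + soundSpeed A γ ρbar * T), isCompact_closedBall _ _,
    fun t ht x hx => h.eq_const_of_lt_norm hγ hA hμ hρbar hinit ht ?_⟩
  rw [mem_closedBall_zero_iff, not_le] at hx
  exact lt_of_le_of_lt (by gcongr; exact ht.2.le) hx

/-- The differential inequality for the two moments of a solution with positive initial density.
The Hessian term is nonnegative and is dropped; the pressure term gives the rest. -/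
theorem IsEulerSolution.moment_inequality {κ K : ℝ} {ν : Measure (Metric.sphere (0 : 𝔼 n) 1)}
    [IsFiniteMeasure ν]
    (h : IsEulerSolution A γ 1 μ ρbar ε ρ₀ u₀ (ENNReal.ofReal T) ρ u) (hγ : 1 < γ) (hA : 0 < A)
    (hρbar : 0 < ρbar) (hμ : 0 ≤ μ)
    (hinit : ∀ x, R < ‖x‖ → ρ 0 x = ρbar ∧ u 0 x = 0) (hpos : ∀ x, 0 < ρ 0 x) (hκ : 0 < κ)
    (hconv : ∀ r > 0, ∀ y > 0, κ * gain (min (γ - 1) 1) y * (r - ρbar - y / 2)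
      ≤ A * r ^ γ - A * ρbar ^ γ - A * γ * ρbar ^ (γ - 1) * (r - ρbar)) (hK : 0 < K)
    (hmass : ∀ t, 0 ≤ t → ∫ x in Metric.closedBall (0 : 𝔼 n) (R + soundSpeed A γ ρbar * t),
      waveMean ν (fun _ => 1) x
        ≤ K * ((1 + t) ^ (((n : ℝ) - 1) / 2) * Real.exp (soundSpeed A γ ρbar * t)))
    {t : ℝ} (ht : t ∈ Ioo 0 T) :
    HasDerivAt (massMoment ν ρbar ρ) (momentumMoment ν ρ u t) t ∧
    HasDerivAt (momentumMoment ν ρ u) (deriv (momentumMoment ν ρ u) t) t ∧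
    (0 < massMoment ν ρbar ρ t → soundSpeed A γ ρbar ^ 2 * massMoment ν ρbar ρ t
        + κ / 2 * massMoment ν ρbar ρ t * gain (min (γ - 1) 1) (massMoment ν ρbar ρ t
          / (K * ((1 + t) ^ (((n : ℝ) - 1) / 2) * Real.exp (soundSpeed A γ ρbar * t))))
      ≤ deriv (momentumMoment ν ρ u) t + μ / (1 + t) * momentumMoment ν ρ u t) := by
  set c := soundSpeed A γ ρbar
  obtain ⟨B, hB, hout⟩ := h.exists_isCompact_eq_const hγ hA hμ hρbar hinit
  have htI := Ioo_subset_Ico_self ht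
  have h1t : 0 < 1 + t := by linarith [ht.1]
  have hrpos : ∀ x, 0 < ρ t x := h.density_pos hγ hA hμ hρbar hinit hpos htI
  have hY := h.hasDerivAt_momentumMoment (ν := ν) hγ hB hout ht
  refine ⟨h.hasDerivAt_massMoment hB hout ht, hY.differentiableAt.hasDerivAt, fun hX => ?_⟩
  have hp := pressure_moment_ge hA hρbar hκ hγ hconv
    (contDiff_slice (F := ρ) h.density htI).continuous hrpos
    (fun x hx => (h.eq_const_of_lt_norm hγ hA hμ hρbar hinit htI hx).1)
    (continuous_waveMean (ν := ν) (w := fun _ => 1) continuous_const)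
    (waveMean_nonneg fun _ => zero_le_one) rfl hX (by positivity) (hmass t ht.1.le)
  rw [hY.deriv]
  have hconvec : 0 ≤ ∫ x, ρ t x * ∑ j, ∑ i, u t x i * u t x j *
      waveMean ν (fun σ => 1 * (σ : 𝔼 n) j * (σ : 𝔼 n) i) x :=
    integral_nonneg fun x => mul_nonneg (hrpos x).le (sum_mul_waveMean_nonneg _ _)
  unfold massMoment at hX ⊢
  linarith

/-- The upper bound for the time of existence, measured by a primitive `τ` of
`(1 + t)^{-(n - 1 + μ) / 2}`. -/
theorem exists_bound_of_isEulerSolution (hn : n = 1 ∨ n = 2) (hγ : 1 < γ) (hA : 0 < A)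
    (hρbar : 0 < ρbar) (hR : 0 < R) (hμ : 0 ≤ μ) (hρ₀ : ContDiff ℝ ∞ ρ₀) (hu₀ : ContDiff ℝ ∞ u₀)
    (hρ₀s : tsupport ρ₀ ⊆ Metric.closedBall 0 R) (hu₀s : tsupport u₀ ⊆ Metric.closedBall 0 R)
    (hx₀ : 0 < ∫ x, ρ₀ x * sphericalExp n x)
    (hy₀ : 0 < ∫ x, inner ℝ (u₀ x) (gradient (sphericalExp n) x)) :
    ∃ ε₀, 0 < ε₀ ∧ ∃ C, 0 < C ∧ ∀ ε, 0 < ε → ε ≤ ε₀ → ∀ T ρ u,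
      IsEulerSolution A γ 1 μ ρbar ε ρ₀ u₀ (ENNReal.ofReal T) ρ u → ∀ τ : ℝ → ℝ,
      (∀ t, 0 ≤ t → HasDerivAt τ ((1 + t) ^ (-(((n : ℝ) - 1) / 2 + μ / 2))) t) → τ 0 = 0 →
      ∀ t ∈ Ico 0 T, τ t ≤ C / ε := by
  obtain ⟨ν, hν, hφ⟩ := exists_sphericalExp_eq_waveMean hn
  obtain ⟨κ, hκ, hconv⟩ := exists_pressure_excess_ge hγ hA hρbar
  have hn0 : 0 < n := by omega
  have hn1 : (1 : ℝ) ≤ n := by exact_mod_cast hn0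
  have hc : 0 < soundSpeed A γ ρbar := soundSpeed_pos hγ hA hρbar
  have hR0 : IsCompact (Metric.closedBall (0 : 𝔼 n) R) := isCompact_closedBall _ _
  have hρ₀out : ∀ x, R < ‖x‖ → ρ₀ x = 0 := fun x hx =>
    image_eq_zero_of_notMem_tsupport fun hx' => by simpa using (hρ₀s hx').trans_lt hx
  have hu₀out : ∀ x, R < ‖x‖ → u₀ x = 0 := fun x hx =>
    image_eq_zero_of_notMem_tsupport fun hx' => by simpa using (hu₀s hx').trans_lt hx
  have hρ₀c : HasCompactSupport ρ₀ := hR0.of_isClosed_subset (isClosed_tsupport _) hρ₀s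
  obtain ⟨b, hb⟩ := hρ₀c.exists_bound_of_continuous hρ₀.continuous
  have hb0 : 0 ≤ b := (norm_nonneg _).trans (hb 0)
  have hu₀j : ∀ j, Continuous fun x => u₀ x j := fun j =>
    (EuclideanSpace.proj (𝕜 := ℝ) j).continuous.comp hu₀.continuous
  have hw : ∀ j, Continuous (waveMean ν fun σ => 1 * (σ : 𝔼 n) j) := fun j =>
    continuous_waveMean (continuous_one_mul_coord j)
  have hi₁ : ∀ j, Integrable fun x => u₀ x j * waveMean ν (fun σ => 1 * (σ : 𝔼 n) j) x := fun j =>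
    ((hu₀j j).mul (hw j)).integrable_of_hasCompactSupport
      (.intro hR0 fun x hx => by simp [hu₀out x (by simpa using hx)])
  have hi₂ : ∀ j, Integrable fun x => ρ₀ x * u₀ x j * waveMean ν (fun σ => 1 * (σ : 𝔼 n) j) x :=
    fun j => ((hρ₀.continuous.mul (hu₀j j)).mul (hw j)).integrable_of_hasCompactSupport
      (.intro hR0 fun x hx => by simp [hu₀out x (by simpa using hx)])
  set J := ∫ x, inner ℝ (u₀ x) (gradient (sphericalExp n) x) with hJ
  have hJeq : J = ∑ j, ∫ x, u₀ x j * waveMean ν (fun σ => 1 * (σ : 𝔼 n) j) x := by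
    rw [hJ, hφ, ← integral_finsetSum _ fun j _ => hi₁ j]
    simp_rw [inner_gradient_eq_sum,
      fun j => partialDeriv_waveMean (ν := ν) (w := fun _ => 1) continuous_const j]
  -- the quadratic part of the initial momentum
  set Q := ∑ j, ∫ x, ρ₀ x * u₀ x j * waveMean ν (fun σ => 1 * (σ : 𝔼 n) j) x with hQ
  set K := (ν.real univ + 1) *
    (2 * Real.exp R * √(4 * Real.pi * (R + soundSpeed A γ ρbar)) ^ (n - 1)) with hK
  have hKpos : 0 < K := by
    have : 0 ≤ ν.real univ := measureReal_nonneg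
    positivity
  obtain ⟨ε₁, hε₁, C, hC, hbound⟩ := exists_bound_of_moment_inequality
    (c := soundSpeed A γ ρbar) (μ := μ) (θ := min (γ - 1) 1) (κ := κ / 2) (K := K)
    (ν := ((n : ℝ) - 1) / 2) (y₀ := ρbar * J / 2) hc hμ (lt_min (by linarith) one_pos)
    (min_le_right _ _) (by positivity) hKpos (by linarith) hx₀ (by positivity)
  refine ⟨min ε₁ (min (ρbar / (b + 1)) (ρbar * J / (2 * (|Q| + 1)))), by positivity, C, hC, ?_⟩
  intro ε hε hεle T ρ u h τ hτ hτ0 t ht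
  have hεb : ε * (b + 1) ≤ ρbar :=
    (le_div_iff₀ (by positivity)).1 (hεle.trans ((min_le_right _ _).trans (min_le_left _ _)))
  have hεQ : ε * (2 * (|Q| + 1)) ≤ ρbar * J :=
    (le_div_iff₀ (by positivity)).1 (hεle.trans ((min_le_right _ _).trans (min_le_right _ _)))
  have hinit : ∀ x, R < ‖x‖ → ρ 0 x = ρbar ∧ u 0 x = 0 := fun x hx => by
    rw [h.initial_density, h.initial_velocity, hρ₀out x hx, hu₀out x hx]
    simp
  have hpos : ∀ x, 0 < ρ 0 x := fun x => by
    rw [h.initial_density]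
    have h1 : -b ≤ ρ₀ x := (abs_le.1 (hb x)).1
    nlinarith [mul_le_mul_of_nonneg_left h1 hε.le]
  obtain ⟨B, hB, hout⟩ := h.exists_isCompact_eq_const hγ hA hμ hρbar hinit
  have hineq := fun t ht => h.moment_inequality (ν := ν) (t := t) hγ hA hρbar hμ hinit hpos
    hκ hconv hKpos (fun t ht => integral_waveMean_cone_le hn0 hc hR ht) ht
  refine hbound ε hε (hεle.trans (min_le_left _ _)) T (massMoment ν ρbar ρ)
    (momentumMoment ν ρ u) (deriv (momentumMoment ν ρ u)) τ ?_ ?_ (fun t ht => (hineq t ht).1)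
    (fun t ht => (hineq t ht).2.1) ?_ ?_ (fun t ht => (hineq t ht).2.2) hτ hτ0 t ht
  · exact continuousOn_moment (f := fun t x => ρ t x - ρbar) (h.density.sub contDiffOn_const) hB
      (fun t ht x hx => by rw [(hout t ht x hx).1, sub_self]) (contDiff_waveMean continuous_const)
  · exact continuousOn_finsetSum _ fun j _ =>
      continuousOn_moment (f := fun t x => ρ t x * u t x j) (h.contDiffOn_momentum j) hB
        (fun t ht x hx => by simp [(hout t ht x hx).2])
        (contDiff_waveMean (continuous_one_mul_coord j))
  · rw [massMoment, hφ, ← integral_const_mul]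
    refine integral_congr_ae (Eventually.of_forall fun x => ?_)
    simp only [h.initial_density]
    ring
  · have hY0 : momentumMoment ν ρ u 0 = ε * (ρbar * J) + ε ^ 2 * Q := by
      rw [momentumMoment, hJeq, hQ, Finset.mul_sum, Finset.mul_sum, Finset.mul_sum,
        ← Finset.sum_add_distrib]
      refine Finset.sum_congr rfl fun j _ => ?_
      rw [← integral_const_mul, ← integral_const_mul, ← integral_const_mul,
        ← integral_add (((hi₁ j).const_mul _).const_mul _) ((hi₂ j).const_mul _)]
      refine integral_congr_ae (Eventually.of_forall fun x => ?_)
      simp only [h.initial_density, h.initial_velocity, PiLp.smul_apply, smul_eq_mul]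
      ring
    rw [hY0]
    have h1 : -|Q| ≤ Q := neg_abs_le Q
    have h2 : 0 ≤ ρbar * J / 2 + ε * Q := by nlinarith [mul_le_mul_of_nonneg_left h1 hε.le]
    nlinarith [mul_nonneg hε.le h2]

theorem IsEulerSolution.mono {lam : ℝ} {T T' : ℝ≥0∞} (hT : T' ≤ T)
    (h : IsEulerSolution A γ lam μ ρbar ε ρ₀ u₀ T ρ u) :
    IsEulerSolution A γ lam μ ρbar ε ρ₀ u₀ T' ρ u where
  contDiffOn_density := h.contDiffOn_density.mono fun _ hq => ⟨hq.1, hq.2.trans_le hT⟩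
  contDiffOn_velocity := h.contDiffOn_velocity.mono fun _ hq => ⟨hq.1, hq.2.trans_le hT⟩
  mass t ht htT := h.mass t ht (htT.trans_le hT)
  momentum t ht htT := h.momentum t ht (htT.trans_le hT)
  initial_density := h.initial_density
  initial_velocity := h.initial_velocity

theorem hasDerivAt_one_add_rpow_div {a t : ℝ} (ha : a ≠ 0) (ht : 0 ≤ t) :
    HasDerivAt (fun t => ((1 + t) ^ a - 1) / a) ((1 + t) ^ (a - 1)) t := by
  have h := ((((hasDerivAt_id t).const_add 1).rpow_const (p := a)
    (Or.inl (by simp only [id]; linarith))).sub_const 1).div_const a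
  refine h.congr_deriv ?_
  simp only [id]
  field_simp

theorem hasDerivAt_log_one_add {t : ℝ} (ht : 0 ≤ t) :
    HasDerivAt (fun t => Real.log (1 + t)) ((1 + t) ^ (-1 : ℝ)) t := by
  have h := ((hasDerivAt_id t).const_add 1).log (by simp only [id]; linarith)
  refine h.congr_deriv ?_
  simp only [id]
  rw [Real.rpow_neg_one, one_div]

/-- A bound for the real times of existence is a bound for the lifespan. -/
theorem le_ofReal_of_forall_mem_Ico {T : ℝ≥0∞} {b : ℝ} (hb : 0 ≤ b)
    (h : ∀ s : ℝ, ENNReal.ofReal s ≤ T → ∀ t ∈ Ico 0 s, t ≤ b) : T ≤ ENNReal.ofReal b := by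
  by_contra! hlt
  obtain ⟨s, hbs, hsT⟩ := ENNReal.lt_iff_exists_nnreal_btwn.1 hlt
  have hs : b < s := by
    rwa [← ENNReal.ofReal_coe_nnreal, ENNReal.ofReal_lt_ofReal_iff_of_nonneg hb] at hbs
  have := h s (by rw [ENNReal.ofReal_coe_nnreal]; exact hsT.le) ((b + s) / 2)
    ⟨by linarith, by linarith⟩
  linarith

end Lifespan

end Blowup

theorem theorem2 (n : ℕ) (hn : n = 1 ∨ n = 2)
    (γ A ρbar R μ : ℝ) (hγ : 1 < γ) (hA : 0 < A) (hρbar : 0 < ρbar) (hR : 0 < R)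
    (hμ_nonneg : 0 ≤ μ) (hμ_le : μ ≤ 3 - (n : ℝ))
    (ρ₀ : EuclideanSpace ℝ (Fin n) → ℝ)
    (u₀ : EuclideanSpace ℝ (Fin n) → EuclideanSpace ℝ (Fin n))
    (hρ₀_smooth : ContDiff ℝ ∞ ρ₀) (hu₀_smooth : ContDiff ℝ ∞ u₀)
    (hρ₀_supp : tsupport ρ₀ ⊆ Metric.closedBall 0 R)
    (hu₀_supp : tsupport u₀ ⊆ Metric.closedBall 0 R)
    (hρ₀_pos : 0 < ∫ x, ρ₀ x * sphericalExp n x)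
    (hu₀_pos : 0 < ∫ x, inner ℝ (u₀ x) (gradient (sphericalExp n) x)) :
    ∃ ε₀ : ℝ, 0 < ε₀ ∧ ∃ C : ℝ, 0 < C ∧ ∀ ε : ℝ, 0 < ε → ε ≤ ε₀ →
      (¬ ∃ ρ u, IsEulerSolution A γ 1 μ ρbar ε ρ₀ u₀ ⊤ ρ u) ∧
      (μ < 3 - (n : ℝ) →
        eulerLifespan A γ 1 μ ρbar ε ρ₀ u₀
          ≤ ENNReal.ofReal (C * ε ^ (-(2 / (3 - (n : ℝ) - μ))))) ∧
      (μ = 3 - (n : ℝ) →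
        eulerLifespan A γ 1 μ ρbar ε ρ₀ u₀ ≤ ENNReal.ofReal (Real.exp (C * ε⁻¹))) := by
  obtain ⟨ε₁, hε₁, C, hC, hbound⟩ := exists_bound_of_isEulerSolution hn hγ hA hρbar hR hμ_nonneg
    hρ₀_smooth hu₀_smooth hρ₀_supp hu₀_supp hρ₀_pos hu₀_pos
  rcases hμ_le.lt_or_eq with hμ | hμ
  · set a := (3 - (n : ℝ) - μ) / 2 with ha
    have hapos : 0 < a := by rw [ha]; linarith
    have haexp : -(2 / (3 - (n : ℝ) - μ)) = -(1 / a) := by rw [ha]; field_simp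
    -- `ε ≤ 1` absorbs the `1` in `(1 + t) ^ a ≤ a C / ε + 1`
    refine ⟨min ε₁ 1, by positivity, (a * C + 1) ^ (1 / a), by positivity, ?_⟩
    intro ε hε hεle
    have hε1 : ε ≤ 1 := hεle.trans (min_le_right _ _)
    have key : ∀ T ρ u, IsEulerSolution A γ 1 μ ρbar ε ρ₀ u₀ T ρ u →
        T ≤ ENNReal.ofReal ((a * C + 1) ^ (1 / a) * ε ^ (-(2 / (3 - (n : ℝ) - μ)))) := by
      intro T ρ u h
      refine le_ofReal_of_forall_mem_Ico (by positivity) fun s hs t ht => ?_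
      have h1t : 0 ≤ 1 + t := by linarith [ht.1]
      have hτ := hbound ε hε (hεle.trans (min_le_left _ _)) s ρ u (h.mono hs)
        (fun t => ((1 + t) ^ a - 1) / a)
        (fun t ht => by
          have := hasDerivAt_one_add_rpow_div hapos.ne' ht
          rwa [show a - 1 = -(((n : ℝ) - 1) / 2 + μ / 2) by rw [ha]; ring] at this)
        (by simp) t ht
      rw [haexp]
      have h2 : (1 + t) ^ a ≤ (a * C + 1) / ε := by
        rw [div_le_iff₀ hapos] at hτ
        have h3 : 1 ≤ 1 / ε := (one_le_div hε).2 hε1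
        have h4 : (a * C + 1) / ε = C / ε * a + 1 / ε := by ring
        linarith
      have h3 := Real.rpow_le_rpow (by positivity) h2 (by positivity : 0 ≤ 1 / a)
      rw [← Real.rpow_mul h1t, mul_one_div_cancel hapos.ne', Real.rpow_one,
        Real.div_rpow (by positivity) hε.le, div_eq_mul_inv, ← Real.rpow_neg hε.le] at h3
      linarith
    refine ⟨fun ⟨ρ, u, h⟩ => ?_, fun _ => sSup_le fun T ⟨ρ, u, h⟩ => key T ρ u h,
      fun h => absurd h hμ.ne⟩
    exact ENNReal.ofReal_ne_top (top_le_iff.1 (key ⊤ ρ u h))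
  · refine ⟨ε₁, hε₁, C, hC, ?_⟩
    intro ε hε hεle
    have key : ∀ T ρ u, IsEulerSolution A γ 1 μ ρbar ε ρ₀ u₀ T ρ u →
        T ≤ ENNReal.ofReal (Real.exp (C * ε⁻¹)) := by
      intro T ρ u h
      refine le_ofReal_of_forall_mem_Ico (by positivity) fun s hs t ht => ?_
      have h1t : 0 < 1 + t := by linarith [ht.1]
      have hτ := hbound ε hε hεle s ρ u (h.mono hs) (fun t => Real.log (1 + t))
        (fun t ht => by
          have := hasDerivAt_log_one_add ht
          rwa [show (-1 : ℝ) = -(((n : ℝ) - 1) / 2 + μ / 2) by rw [hμ]; ring] at this)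
        (by simp) t ht
      rw [← div_eq_mul_inv]
      linarith [(Real.log_le_iff_le_exp h1t).1 hτ]
    refine ⟨fun ⟨ρ, u, h⟩ => ?_, fun h => absurd hμ h.ne,
      fun _ => sSup_le fun T ⟨ρ, u, h⟩ => key T ρ u h⟩
    exact ENNReal.ofReal_ne_top (top_le_iff.1 (key ⊤ ρ u h))
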